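/- **Setting (Hamiltonian mean-field model).** Functions live on the phase space $\mu=S^1\times\mathbb R\ni(q,p)$, $q\in[-\pi,\pi)$. Put $M_x[f]=\iint\cos q\,f$, $M_y[f]=\iint\sin q\,f$, $\mathcal N[f]=\iint f$, $\mathcal P[f]=\iint p f$, $\mathcal U[f]=\iint\frac{p^2}{2}f-\frac12(M_x[f]^2+M_y[f]^2)$ (all integrals $dq\,dp$), and $\mathcal S[f]=\iint s(f)$, where $s:[0,\infty)\to\mathbb R$ is strictly concave and twice differentiable on $(0,\infty)$. Let $f_0>0$ be a continuous function on $\mu$ satisfying the normalization constraint $\mathcal N[f_0]=1$, the momentum constraint $\mathcal P[f_0]=0$ and the energy constraint $\mathcal U[f_0]=U$ (with $\iint p^2f_0<\infty$), which solves the variational equation $\delta\mathcal F=0$ for $\mathcal F=\mathcal S-\beta\,\mathcal U-\alpha\,\mathcal N$ with some $\alpha,\beta\in\mathbb R$, i.e. the first variation of $\mathcal F$ at $f_0$ vanishes in every continuous direction of compact support. Assume that $s''$ vanishes at no value of $f_0$, and that $f_0$ is spatially inhomogeneous, the origin of $q$ being chosen such that $M_y[f_0]=0$ and $M_0:=M_x[f_0]>0$.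 Let $(\theta,J)$ be the angle-action coordinates of $\mathcal E(q,p)=\frac{p^2}{2}-M_0\cos q$ on each of the three regions $U_1=\{\mathcal E>M_0,\,p>0\}$, $U_2=\{|\mathcal E|<M_0\}$, $U_3=\{\mathcal E>M_0,\,p<0\}$, with $\theta\in[-\pi,\pi)$, $\theta=0$ at $q=0$ (with $p>0$ in $U_2$), and $J>4\sqrt{M_0}/\pi$ on $U_1$ and $U_3$, $0<J<8\sqrt{M_0}/\pi$ on $U_2$. Let $\int_L dJ$ be the sum of the integrals over the three ranges of $J$, let $\Omega(J)=d\mathcal E/dJ$ and $C^n(J)=\frac1{2\pi}\int_{-\pi}^{\pi}\cos q(\theta,J)\,e^{-in\theta}d\theta$, and let $\tilde f_0(J)$ be $f_0$ as a function of the action in each region. Put $$\mathcal I[f_0]=1+\int_{-\pi}^{\pi}dq\,\cos^2q\int_{-\infty}^{\infty}\frac1p\frac{\partial f_0}{\partial p}(q,p)\,dp-2\pi\int_L\frac{\tilde f_0'(J)}{\Omega(J)}|C^0(J)|^2\,dJ,$$ $$D_x(\omega)=1+2\pi\sum_{m\in\mathbb Z}\int_L\frac{m\,\tilde f_0'(J)}{m\Omega(J)-\omega}|C^m(J)|^2\,dJ\quad(\operatorname{Im}\omega>0),\qquad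 D_x(0)=\lim_{\epsilon\to0+}D_x(i\epsilon).$$ The perturbations are the functions $\delta f$ on $\mu$, up to equality almost everywhere, for which $\iint|\delta f|$, $\iint p^2|\delta f|$ and $\iint|s''(f_0)|\,\delta f^2$ are finite. The second variation is $$\delta^2\mathcal F[f_0][\delta f,\delta f]=\iint s''(f_0)\,\delta f^2\,dq\,dp+\beta\left(M_x[\delta f]^2+M_y[\delta f]^2\right).$$ A perturbation is even (parallel to the order parameter) if it is even in $\theta$ in each region. Call $f_0$ formally stable (in the most refined sense, against parallel perturbations) if $\delta^2\mathcal F[f_0][\delta f,\delta f]<0$ for every even $\delta f\ne0$ that leaves all Casimir functionals $\iint Q(f)\,dq\,dp$ invariant to first order, i.e. $\iint Q'(f_0)\,\delta f\,dq\,dp=0$ for every $Q$ differentiable on $(0,\infty)$ for which this integral converges. **Proposition 3.** The integrals defining $\mathcal I[f_0]$, and the integrals and the series defining $D_x(i\epsilon)$ for $\epsilon>0$, converge; the limit $D_x(0)$ exists; and $\mathcal I[f_0]=D_x(0)$. Moreover: 1. $\mathcal I[f_0]=D_x(0)>0$ if and only if $\delta^2\mathcal F[f_0][\delta f,\delta f]<0$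 for every even perturbation $\delta f\neq0$ with $\int_{-\pi}^{\pi}\delta f(\theta,J)\,d\theta=0$ for almost every $J$ in each of the three regions. 2. Hence $\mathcal I[f_0]=D_x(0)>0$ is a necessary and sufficient condition for the formal stability of $f_0$; it involves no Lagrange multipliers. -/

import Mathlib

open MeasureTheory Filter Topology Set

namespace HMF

noncomputable section

/-! ### The one-particle phase space and the functionals of the model -/

/-- Integration over the phase space `S¹ × ℝ`, with the circle represented by `[-π, π)`;
a point is a pair `(q, p)`. -/
def phaseMeasure : Measure (ℝ × ℝ) :=
  (volume : Measure (ℝ × ℝ)).restrict (Ico (-Real.pi) Real.pi ×ˢ univ)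

/-- `M_x[f] = ∬ cos q f dq dp`. -/
def orderX (f : ℝ × ℝ → ℝ) : ℝ := ∫ z, Real.cos z.1 * f z ∂phaseMeasure

/-- `M_y[f] = ∬ sin q f dq dp`. -/
def orderY (f : ℝ × ℝ → ℝ) : ℝ := ∫ z, Real.sin z.1 * f z ∂phaseMeasure

/-- `N[f] = ∬ f dq dp`. -/
def mass (f : ℝ × ℝ → ℝ) : ℝ := ∫ z, f z ∂phaseMeasure

/-- `P[f] = ∬ p f dq dp`. -/
def momentum (f : ℝ × ℝ → ℝ) : ℝ := ∫ z, z.2 * f z ∂phaseMeasure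

/-- `U[f] = ∬ (p² / 2) f dq dp - (M_x[f]² + M_y[f]²) / 2`. -/
def totalEnergy (f : ℝ × ℝ → ℝ) : ℝ :=
  (∫ z, z.2 ^ 2 / 2 * f z ∂phaseMeasure) - (orderX f ^ 2 + orderY f ^ 2) / 2

/-! ### Variations of the functionals -/

/-- The `n`-th variation at `f` in the direction `h` of the Casimir functional `∬ Q(f) dq dp`:
the `n`-th derivative at `ε = 0` of `Q(f + ε h)`, integrated over the phase space. -/
def casimirVariation (n : ℕ) (Q : ℝ → ℝ) (f h : ℝ × ℝ → ℝ) : ℝ :=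
  ∫ z, iteratedDeriv n (fun ε : ℝ => Q (f z + ε * h z)) 0 ∂phaseMeasure

/-- The `n`-th variation at `f` in the direction `h` of `F = S - β U - α N`, where
`S[f] = ∬ s(f) dq dp`. -/
def variation (n : ℕ) (s : ℝ → ℝ) (α β : ℝ) (f h : ℝ × ℝ → ℝ) : ℝ :=
  casimirVariation n s f h
    - β * iteratedDeriv n (fun ε : ℝ => totalEnergy (fun z => f z + ε * h z)) 0
    - α * iteratedDeriv n (fun ε : ℝ => mass (fun z => f z + ε * h z)) 0

/-- `f` is a positive, continuous density on the phase space satisfying the normalization,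
momentum and energy constraints, and the variational equation `δ(S - β U - α N) = 0` holds
at `f` (tested on continuous functions on the cylinder with compact support). -/
structure IsCriticalPoint (s : ℝ → ℝ) (α β U : ℝ) (f : ℝ × ℝ → ℝ) : Prop where
  continuous : Continuous f
  periodic : ∀ q p, f (q + 2 * Real.pi, p) = f (q, p)
  pos : ∀ z, 0 < f z
  integrable : Integrable f phaseMeasure
  integrable_kinetic : Integrable (fun z => z.2 ^ 2 / 2 * f z) phaseMeasure
  mass_eq : mass f = 1
  momentum_eq : momentum f = 0
  energy_eq : totalEnergy f = U
  variation_eq : ∀ h : ℝ × ℝ → ℝ, Continuous h →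
    (∀ q p, h (q + 2 * Real.pi, p) = h (q, p)) →
    (∃ R : ℝ, ∀ q p, R ≤ |p| → h (q, p) = 0) →
    variation 1 s α β f h = 0

/-! ### Elliptic integrals and Jacobi elliptic functions -/

/-- Incomplete elliptic integral of the first kind with modulus `k`. -/
def ellipticF (k φ : ℝ) : ℝ :=
  ∫ x in (0 : ℝ)..φ, 1 / Real.sqrt (1 - k ^ 2 * Real.sin x ^ 2)

/-- Complete elliptic integral of the first kind with modulus `k`. -/
def ellipticK (k : ℝ) : ℝ := ellipticF k (Real.pi / 2)

/-- The Jacobi amplitude `am(u, k)`, inverse of `φ ↦ F(φ, k)` (a bijection of `ℝ` when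
`0 ≤ k < 1`). -/
def jacobiAm (u k : ℝ) : ℝ := Function.invFun (ellipticF k) u

/-- `sn(u, k)`. -/
def jacobiSn (u k : ℝ) : ℝ := Real.sin (jacobiAm u k)

/-- `cn(u, k)`. -/
def jacobiCn (u k : ℝ) : ℝ := Real.cos (jacobiAm u k)

/-- `dn(u, k)`. -/
def jacobiDn (u k : ℝ) : ℝ := Real.sqrt (1 - k ^ 2 * jacobiSn u k ^ 2)

/-! ### Angle-action coordinates of the one-particle energy `p² / 2 - M₀ cos q` -/

/-- The three regions of the phase space cut out by the separatrix: rotation with `p > 0`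
(`ℰ > M₀`), libration (`|ℰ| < M₀`), rotation with `p < 0` (`ℰ > M₀`). -/
inductive Region : Type
  | rotPos : Region
  | lib : Region
  | rotNeg : Region

/-- The energies occurring in a region. -/
def energyRange (M₀ : ℝ) : Region → Set ℝ
  | .rotPos => Ioi M₀
  | .lib => Ioo (-M₀) M₀
  | .rotNeg => Ioi M₀

/-- The actions occurring in a region. -/
def actionRange (M₀ : ℝ) : Region → Set ℝ
  | .rotPos => Ioi (4 * Real.sqrt M₀ / Real.pi)
  | .lib => Ioo 0 (8 * Real.sqrt M₀ / Real.pi)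
  | .rotNeg => Ioi (4 * Real.sqrt M₀ / Real.pi)

/-- The action `(1 / 2π) ∮ p dq` of the orbit of energy `e` in a region. For a libration the
two branches `p = ± √(2 (e + M₀ cos q))` contribute equally, and the square root is `0` at the
positions `q` that the orbit does not reach. -/
def action (M₀ : ℝ) : Region → ℝ → ℝ
  | .rotPos, e => 1 / (2 * Real.pi) *
      ∫ q in (-Real.pi)..Real.pi, Real.sqrt (2 * (e + M₀ * Real.cos q))
  | .lib, e => 1 / (2 * Real.pi) *
      (2 * ∫ q in (-Real.pi)..Real.pi, Real.sqrt (2 * (e + M₀ * Real.cos q)))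
  | .rotNeg, e => 1 / (2 * Real.pi) *
      ∫ q in (-Real.pi)..Real.pi, Real.sqrt (2 * (e + M₀ * Real.cos q))

/-- The energy `ℰ(J)` as a function of the action. -/
def energy (M₀ : ℝ) (i : Region) (J : ℝ) : ℝ :=
  Function.invFunOn (action M₀ i) (energyRange M₀ i) J

/-- The frequency `Ω(J) = dℰ / dJ`. -/
def frequency (M₀ : ℝ) (i : Region) (J : ℝ) : ℝ := deriv (energy M₀ i) J

/-- The modulus `k = √((ℰ(J) + M₀) / (2 M₀))`. -/
def modulus (M₀ : ℝ) (i : Region) (J : ℝ) : ℝ :=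
  Real.sqrt ((energy M₀ i J + M₀) / (2 * M₀))

/-- The position `q(θ, J)`. -/
def position (M₀ : ℝ) : Region → ℝ → ℝ → ℝ
  | .rotPos, θ, J =>
      2 * jacobiAm (ellipticK (1 / modulus M₀ .rotPos J) / Real.pi * θ) (1 / modulus M₀ .rotPos J)
  | .lib, θ, J =>
      2 * Real.arcsin (modulus M₀ .lib J *
        jacobiSn (2 * ellipticK (modulus M₀ .lib J) / Real.pi * θ) (modulus M₀ .lib J))
  | .rotNeg, θ, J =>
      -(2 * jacobiAm (ellipticK (1 / modulus M₀ .rotNeg J) / Real.pi * θ)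
        (1 / modulus M₀ .rotNeg J))

/-- The momentum `p(θ, J)`. -/
def momentumCoord (M₀ : ℝ) : Region → ℝ → ℝ → ℝ
  | .rotPos, θ, J => 2 * Real.sqrt M₀ * modulus M₀ .rotPos J *
      jacobiDn (ellipticK (1 / modulus M₀ .rotPos J) / Real.pi * θ) (1 / modulus M₀ .rotPos J)
  | .lib, θ, J => 2 * Real.sqrt M₀ * modulus M₀ .lib J *
      jacobiCn (2 * ellipticK (modulus M₀ .lib J) / Real.pi * θ) (modulus M₀ .lib J)
  | .rotNeg, θ, J => -(2 * Real.sqrt M₀ * modulus M₀ .rotNeg J *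
      jacobiDn (ellipticK (1 / modulus M₀ .rotNeg J) / Real.pi * θ) (1 / modulus M₀ .rotNeg J))

/-- A function on the phase space written in the angle-action coordinates of a region. -/
def inAngleAction (M₀ : ℝ) (g : ℝ × ℝ → ℝ) (i : Region) (θ J : ℝ) : ℝ :=
  g (position M₀ i θ J, momentumCoord M₀ i θ J)

/-- The integral `∫_L` over the actions of all three regions. -/
def actionIntegral {E : Type*} [NormedAddCommGroup E] [NormedSpace ℝ E]
    (M₀ : ℝ) (g : Region → ℝ → E) : E :=
  (∫ J in actionRange M₀ .rotPos, g .rotPos J) + (∫ J in actionRange M₀ .lib, g .lib J)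
    + ∫ J in actionRange M₀ .rotNeg, g .rotNeg J

/-- `C^n(J) = (1 / 2π) ∫ cos q(θ, J) e^{-i n θ} dθ`. -/
def cosCoeff (M₀ : ℝ) (n : ℤ) (i : Region) (J : ℝ) : ℂ :=
  (1 / (2 * Real.pi) : ℂ) * ∫ θ in (-Real.pi)..Real.pi,
    (Real.cos (position M₀ i θ J) : ℂ) * Complex.exp (-(Complex.I * n * θ))

/-! ### The stability functional and the dispersion function

Here `M₀ = M_x[f]`. -/

/-- The density as a function of the action. A critical point depends on `(q, p)` only through
the energy, so it is read off at angle `0`. -/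
def actionProfile (f : ℝ × ℝ → ℝ) (i : Region) (J : ℝ) : ℝ :=
  inAngleAction (orderX f) f i 0 J

/-- The integrand `(1 / p) ∂f/∂p cos² q`. -/
def cosSqIntegrand (f : ℝ × ℝ → ℝ) (z : ℝ × ℝ) : ℝ :=
  Real.cos z.1 ^ 2 * (1 / z.2 * deriv (fun p : ℝ => f (z.1, p)) z.2)

/-- The integrand `f̃'(J) / Ω(J) |C^0(J)|²`. -/
def zeroModeIntegrand (f : ℝ × ℝ → ℝ) (i : Region) (J : ℝ) : ℝ :=
  deriv (actionProfile f i) J / frequency (orderX f) i J * ‖cosCoeff (orderX f) 0 i J‖ ^ 2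

/-- `I[f] = 1 + ∫ dq cos² q ∫ (1 / p) ∂f/∂p dp - 2π ∫_L f̃'(J) / Ω(J) |C^0(J)|² dJ`. -/
def stabilityIndex (f : ℝ × ℝ → ℝ) : ℝ :=
  1 + (∫ q in (-Real.pi)..Real.pi, ∫ p : ℝ, cosSqIntegrand f (q, p))
    - 2 * Real.pi * actionIntegral (orderX f) (zeroModeIntegrand f)

/-- The integrand `m f̃'(J) / (m Ω(J) - ω) |C^m(J)|²`. -/
def dispersionIntegrand (f : ℝ × ℝ → ℝ) (ω : ℂ) (m : ℤ) (i : Region) (J : ℝ) : ℂ :=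
  (m : ℂ) * ((deriv (actionProfile f i) J : ℝ) : ℂ)
      / ((m : ℂ) * ((frequency (orderX f) i J : ℝ) : ℂ) - ω)
    * ((‖cosCoeff (orderX f) m i J‖ ^ 2 : ℝ) : ℂ)

/-- `D_x(ω) = 1 + 2π ∑_{m ∈ ℤ} ∫_L m f̃'(J) / (m Ω(J) - ω) |C^m(J)|² dJ`, for `Im ω > 0`. -/
def dispersionX (f : ℝ × ℝ → ℝ) (ω : ℂ) : ℂ :=
  1 + 2 * (Real.pi : ℂ) * ∑' m : ℤ, actionIntegral (orderX f) (dispersionIntegrand f ω m)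

/-! ### Perturbations and formal stability -/

/-- Perturbations with finite mass, finite kinetic energy, and finite second variation of the
Casimir functional `∬ s(f) dq dp`. -/
structure IsPerturbation (s : ℝ → ℝ) (f h : ℝ × ℝ → ℝ) : Prop where
  integrable : Integrable h phaseMeasure
  integrable_kinetic : Integrable (fun z => z.2 ^ 2 / 2 * h z) phaseMeasure
  integrable_second :
    Integrable (fun z => iteratedDeriv 2 (fun ε : ℝ => s (f z + ε * h z)) 0) phaseMeasure

/-- Perturbations that are even in the angle `θ` (parallel to the order parameter). -/
def IsEvenPerturbation (M₀ : ℝ) (h : ℝ × ℝ → ℝ) : Prop :=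
  ∀ i : Region, ∀ᵐ x ∂((volume : Measure (ℝ × ℝ)).restrict
      (Ico (-Real.pi) Real.pi ×ˢ actionRange M₀ i)),
    inAngleAction M₀ h i (-x.1) x.2 = inAngleAction M₀ h i x.1 x.2

/-- The average over `θ` vanishes for (almost) every action, in each of the three regions. -/
def HasZeroAngleAverage (M₀ : ℝ) (h : ℝ × ℝ → ℝ) : Prop :=
  ∀ i : Region, ∀ᵐ J ∂((volume : Measure ℝ).restrict (actionRange M₀ i)),
    ∫ θ in (-Real.pi)..Real.pi, inAngleAction M₀ h i θ J = 0

/-- The perturbation leaves every Casimir invariant `∬ Q(f) dq dp` unchanged to first order. -/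
def PreservesCasimirs (f h : ℝ × ℝ → ℝ) : Prop :=
  ∀ Q : ℝ → ℝ, DifferentiableOn ℝ Q (Ioi 0) →
    Integrable (fun z => iteratedDeriv 1 (fun ε : ℝ => Q (f z + ε * h z)) 0) phaseMeasure →
    casimirVariation 1 Q f h = 0

/-- Formal stability in the most refined sense, against perturbations parallel to the order
parameter: the second variation of `F = S - β U - α N` is negative for all nonzero even
perturbations that preserve all Casimir invariants to first order. -/
def IsFormallyStable (s : ℝ → ℝ) (α β : ℝ) (f : ℝ × ℝ → ℝ) : Prop :=
  ∀ h : ℝ × ℝ → ℝ, IsPerturbation s f h → IsEvenPerturbation (orderX f) h →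
    PreservesCasimirs f h → ¬ h =ᵐ[phaseMeasure] 0 → variation 2 s α β f h < 0

end

end HMF

namespace HMF

noncomputable section

/-! ### Elliptic integrals and the Jacobi amplitude -/

/-! Write `E` for the one-particle energy and `c` for `cos q` minus its mean along the orbit.
Testing the variational equation against its own residual gives `s'(f₀) = β E + α`. As `s'` is
injective, `f₀ = F(E)` for some `F`. Integrability of `f₀` over the infinite cylinder forces `β >
0`, and differentiating yields `s''(f₀) F'(E) = β` with `F' < 0`.

The hinge is the identity `I[f₀] = 1 + ∬ c² F'(E)` (`IsEnergyProfile.integral_fluctuation_sq`). In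
angle-action variables `f̃₀'/Ω = F'(E)` is constant on orbits, and the variance of `cos q` on an
orbit is its mean square minus `|C⁰|²`. On the dispersion side each term is `mΩ/(mΩ - iε)` times `F'
|C^m|²`. The quotient is bounded by one, vanishes for `m = 0` and tends to one otherwise, so
dominated convergence and Parseval leave the same variance, the absent mode `m = 0` being the
subtracted `|C⁰|²` (`IsEnergyProfile.tendsto_dispersionX`).

For even `h` orthogonal to the orbit mean of `cos q`, one has `M_y[h] = 0` and `M_x[h] = ∬ c h`.
Cauchy-Schwarz with weight `-F'` bounds `β M_x[h]²` by `(1 - I) ∬ |s''| h²`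
(`IsStabilityData.orderX_sq_le`), so `I > 0` makes the second variation negative. Equality holds for
`h = c F'(E)`, which has zero angle average and second variation `β (1 - I)(-I)`
(`IsStabilityData.exists_variation_nonneg`).

Zero angle average implies preservation of all Casimirs, and preservation of all Casimirs implies
orthogonality to the orbit mean of `cos q`. The latter uses Casimirs tailored to produce an
arbitrary bounded continuous function of the energy, followed by an extension to measurable
functions. Both stability notions thus lie between the class covered by the inequality and the
single extremal direction.

Two analytic points support this. The angle-action map preserves Lebesgue measure (`map_angleMap`),
which is shown by explicit substitutions and by comparing areas with the action. And `F'(E)` has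
finite mass and kinetic energy (`IsEnergyProfile.integrable_deriv`), although `dJ/dk` blows up at
the separatrix and `F'` is only known to exist pointwise; monotonicity of `F` compensates for this.
-/

lemma one_sub_sq_mul_sin_sq_pos {k : ℝ} (hk : k ∈ Ico (0 : ℝ) 1) (x : ℝ) :
    0 < 1 - k ^ 2 * Real.sin x ^ 2 := by
  have h1 : k ^ 2 < 1 := by nlinarith [hk.1, hk.2]
  nlinarith [Real.sin_sq_le_one x, sq_nonneg (Real.sin x), sq_nonneg k]

lemma one_sub_sq_mul_sin_sq_le_one (k x : ℝ) : 1 - k ^ 2 * Real.sin x ^ 2 ≤ 1 := by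
  have : 0 ≤ k ^ 2 * Real.sin x ^ 2 := by positivity
  linarith

lemma continuousOn_ellipticIntegrand :
    Continuous fun z : Ico (0 : ℝ) 1 × ℝ =>
      1 / Real.sqrt (1 - (z.1 : ℝ) ^ 2 * Real.sin z.2 ^ 2) := by
  refine Continuous.div₀ continuous_const (by fun_prop) fun z => ?_
  exact (Real.sqrt_pos.2 (one_sub_sq_mul_sin_sq_pos z.1.2 _)).ne'

lemma continuous_ellipticIntegrand {k : ℝ} (hk : k ∈ Ico (0 : ℝ) 1) :
    Continuous fun x : ℝ => 1 / Real.sqrt (1 - k ^ 2 * Real.sin x ^ 2) :=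
  continuousOn_ellipticIntegrand.comp (Continuous.prodMk_right (⟨k, hk⟩ : Ico (0 : ℝ) 1))

lemma one_le_ellipticIntegrand {k : ℝ} (hk : k ∈ Ico (0 : ℝ) 1) (x : ℝ) :
    1 ≤ 1 / Real.sqrt (1 - k ^ 2 * Real.sin x ^ 2) := by
  rw [le_div_iff₀ (Real.sqrt_pos.2 (one_sub_sq_mul_sin_sq_pos hk x)), one_mul]
  exact Real.sqrt_le_one.2 (one_sub_sq_mul_sin_sq_le_one k x)

lemma ellipticIntegrand_le {k : ℝ} (hk : k ∈ Ico (0 : ℝ) 1) (x : ℝ) :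
    1 / Real.sqrt (1 - k ^ 2 * Real.sin x ^ 2) ≤ 1 / Real.sqrt (1 - k) := by
  have h1 : 0 < 1 - k := by linarith [hk.2]
  refine one_div_le_one_div_of_le (Real.sqrt_pos.2 h1) (Real.sqrt_le_sqrt ?_)
  have h2 : k ^ 2 ≤ k := by nlinarith [hk.1, hk.2]
  nlinarith [Real.sin_sq_le_one x, sq_nonneg (Real.sin x), sq_nonneg k]

lemma hasDerivAt_ellipticF {k : ℝ} (hk : k ∈ Ico (0 : ℝ) 1) (φ : ℝ) :
    HasDerivAt (ellipticF k) (1 / Real.sqrt (1 - k ^ 2 * Real.sin φ ^ 2)) φ :=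
  ((continuous_ellipticIntegrand hk).integral_hasStrictDerivAt 0 φ).hasDerivAt

lemma continuous_ellipticF {k : ℝ} (hk : k ∈ Ico (0 : ℝ) 1) : Continuous (ellipticF k) :=
  continuous_iff_continuousAt.2 fun φ => (hasDerivAt_ellipticF hk φ).continuousAt

lemma strictMono_ellipticF {k : ℝ} (hk : k ∈ Ico (0 : ℝ) 1) : StrictMono (ellipticF k) :=
  strictMono_of_hasDerivAt_pos (fun φ => hasDerivAt_ellipticF hk φ) fun φ =>
    zero_lt_one.trans_le (one_le_ellipticIntegrand hk φ)

lemma ellipticF_neg (k φ : ℝ) : ellipticF k (-φ) = -ellipticF k φ := by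
  unfold ellipticF
  have h := intervalIntegral.integral_comp_neg (a := 0) (b := φ)
    fun x : ℝ => 1 / Real.sqrt (1 - k ^ 2 * Real.sin x ^ 2)
  simp only [Real.sin_neg, neg_sq, neg_zero] at h
  rw [h, intervalIntegral.integral_symm]

/-- The integrand is symmetric about `π / 2`. A libration runs through the amplitude interval `(-π,
π)`, so this fixes the factor `2 K(k) / π` between angle and argument; a rotation only needs `(-π/2,
π/2)`. -/
lemma ellipticF_pi {k : ℝ} (hk : k ∈ Ico (0 : ℝ) 1) : ellipticF k Real.pi = 2 * ellipticK k := by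
  have hc := continuous_ellipticIntegrand hk
  have h := intervalIntegral.integral_comp_sub_left (a := 0) (b := Real.pi / 2)
    (fun x : ℝ => 1 / Real.sqrt (1 - k ^ 2 * Real.sin x ^ 2)) Real.pi
  simp only [Real.sin_pi_sub, sub_zero] at h
  have e : Real.pi - Real.pi / 2 = Real.pi / 2 := by ring
  rw [e] at h
  have h2 := intervalIntegral.integral_add_adjacent_intervals
    (hc.intervalIntegrable (μ := volume) 0 (Real.pi / 2))
    (hc.intervalIntegrable (Real.pi / 2) Real.pi)
  unfold ellipticK ellipticF
  rw [← h2, ← h]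
  ring

lemma le_ellipticF {k : ℝ} (hk : k ∈ Ico (0 : ℝ) 1) {φ : ℝ} (hφ : 0 ≤ φ) :
    φ ≤ ellipticF k φ := by
  have h := intervalIntegral.integral_mono_on hφ (intervalIntegrable_const (c := (1 : ℝ)))
    ((continuous_ellipticIntegrand hk).intervalIntegrable (μ := volume) 0 φ)
    fun x _ => one_le_ellipticIntegrand hk x
  simpa [ellipticF] using h

lemma ellipticF_surjective {k : ℝ} (hk : k ∈ Ico (0 : ℝ) 1) :
    Function.Surjective (ellipticF k) := by
  refine (continuous_ellipticF hk).surjective ?_ ?_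
  · exact tendsto_atTop_mono' _ ((eventually_ge_atTop 0).mono fun φ => le_ellipticF hk) tendsto_id
  · refine tendsto_atBot_mono' _ ((eventually_le_atBot 0).mono fun φ hφ => ?_) tendsto_id
    have := le_ellipticF hk (neg_nonneg.2 hφ)
    rw [ellipticF_neg] at this
    simpa using neg_le_neg this

lemma jacobiAm_ellipticF {k : ℝ} (hk : k ∈ Ico (0 : ℝ) 1) (φ : ℝ) :
    jacobiAm (ellipticF k φ) k = φ :=
  Function.leftInverse_invFun (strictMono_ellipticF hk).injective φ

lemma ellipticF_jacobiAm {k : ℝ} (hk : k ∈ Ico (0 : ℝ) 1) (u : ℝ) :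
    ellipticF k (jacobiAm u k) = u :=
  Function.rightInverse_invFun (ellipticF_surjective hk) u

lemma jacobiAm_neg {k : ℝ} (hk : k ∈ Ico (0 : ℝ) 1) (u : ℝ) :
    jacobiAm (-u) k = -jacobiAm u k := by
  apply (strictMono_ellipticF hk).injective
  rw [ellipticF_neg, ellipticF_jacobiAm hk, ellipticF_jacobiAm hk]

lemma continuousOn_ellipticF_modulus (φ : ℝ) :
    ContinuousOn (fun k => ellipticF k φ) (Ico 0 1) := by
  rw [continuousOn_iff_continuous_domRestrict]
  exact intervalIntegral.continuous_parametric_intervalIntegral_of_continuous'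
    (f := fun (k : Ico (0 : ℝ) 1) (x : ℝ) => 1 / Real.sqrt (1 - (k : ℝ) ^ 2 * Real.sin x ^ 2))
    continuousOn_ellipticIntegrand 0 φ

lemma continuousOn_ellipticK : ContinuousOn ellipticK (Ico 0 1) :=
  continuousOn_ellipticF_modulus (Real.pi / 2)

lemma pi_div_two_le_ellipticK {k : ℝ} (hk : k ∈ Ico (0 : ℝ) 1) : Real.pi / 2 ≤ ellipticK k :=
  le_ellipticF hk (by positivity)

lemma ellipticK_pos {k : ℝ} (hk : k ∈ Ico (0 : ℝ) 1) : 0 < ellipticK k :=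
  (by positivity : 0 < Real.pi / 2).trans_le (pi_div_two_le_ellipticK hk)

/-- The true growth as `k → 1` is logarithmic. This cruder inverse square root is enough, because
the integrability argument at the separatrix tolerates exactly that singularity. -/
lemma ellipticK_le {k : ℝ} (hk : k ∈ Ico (0 : ℝ) 1) :
    ellipticK k ≤ Real.pi / 2 * (1 / Real.sqrt (1 - k)) := by
  have h := intervalIntegral.integral_mono_on (a := 0) (b := Real.pi / 2) (by positivity)
    ((continuous_ellipticIntegrand hk).intervalIntegrable (μ := volume) _ _)
    (intervalIntegrable_const (c := 1 / Real.sqrt (1 - k)))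
    fun x _ => ellipticIntegrand_le hk x
  simpa [ellipticF, ellipticK] using h

/-- By monotonicity, `a < am(u, k)` is equivalent to `F(k, a) < u`. Joint continuity of the inverse
then reduces to continuity of `k ↦ F(k, a)` for each fixed `a`, with no implicit function theorem.
-/
lemma continuousOn_jacobiAm :
    ContinuousOn (fun z : ℝ × ℝ => jacobiAm z.1 z.2) (univ ×ˢ Ico 0 1) := by
  rintro ⟨u₀, k₀⟩ ⟨-, hk₀⟩
  have hmem : ∀ᶠ z : ℝ × ℝ in 𝓝[univ ×ˢ Ico 0 1] (u₀, k₀), z.2 ∈ Ico (0 : ℝ) 1 :=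
    eventually_mem_nhdsWithin.mono fun z hz => hz.2
  have hF : ∀ a, Tendsto (fun z : ℝ × ℝ => ellipticF z.2 a - z.1)
      (𝓝[univ ×ˢ Ico 0 1] (u₀, k₀)) (𝓝 (ellipticF k₀ a - u₀)) := fun a => by
    have h1 : Tendsto (fun z : ℝ × ℝ => z.2) (𝓝[univ ×ˢ Ico (0 : ℝ) 1] (u₀, k₀))
        (𝓝[Ico 0 1] k₀) :=
      tendsto_nhdsWithin_iff.2 ⟨(continuous_snd.tendsto _).mono_left nhdsWithin_le_nhds, hmem⟩
    exact ((continuousOn_ellipticF_modulus a k₀ hk₀).tendsto.comp h1).sub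
      ((continuous_fst.tendsto _).mono_left nhdsWithin_le_nhds)
  refine tendsto_order.2 ⟨fun a ha => ?_, fun a ha => ?_⟩
  · have h0 : ellipticF k₀ a - u₀ < 0 := by
      have := strictMono_ellipticF hk₀ ha
      simp only [ellipticF_jacobiAm hk₀] at this
      linarith
    filter_upwards [(hF a).eventually_lt_const h0, hmem] with z hz hk
    apply (strictMono_ellipticF hk).lt_iff_lt.1
    rw [ellipticF_jacobiAm hk]
    linarith
  · have h0 : 0 < ellipticF k₀ a - u₀ := by
      have := strictMono_ellipticF hk₀ ha
      simp only [ellipticF_jacobiAm hk₀] at this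
      linarith
    filter_upwards [(hF a).eventually_const_lt h0, hmem] with z hz hk
    apply (strictMono_ellipticF hk).lt_iff_lt.1
    rw [ellipticF_jacobiAm hk]
    linarith

/-- Substituting the amplitude of `c θ` for `φ`, when `c ℓ = F(ℓ)`. -/
lemma lintegral_comp_jacobiAm {k : ℝ} (hk : k ∈ Ico (0 : ℝ) 1) {c ℓ m : ℝ} (hc : 0 < c)
    (hℓ : c * ℓ = ellipticF k m) (g : ℝ → ENNReal) :
    ENNReal.ofReal c * ∫⁻ θ in Ioo (-ℓ) ℓ, g (jacobiAm (c * θ) k) =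
      ∫⁻ φ in Ioo (-m) m, ENNReal.ofReal (1 / Real.sqrt (1 - k ^ 2 * Real.sin φ ^ 2)) * g φ := by
  have himg : (fun φ => ellipticF k φ / c) '' Ioo (-m) m = Ioo (-ℓ) ℓ := by
    ext θ
    simp only [mem_image, mem_Ioo]
    constructor
    · rintro ⟨φ, ⟨h1, h2⟩, rfl⟩
      have h1' := strictMono_ellipticF hk h1
      have h2' := strictMono_ellipticF hk h2
      rw [ellipticF_neg, ← hℓ] at h1'
      rw [← hℓ] at h2'
      rw [lt_div_iff₀ hc, div_lt_iff₀ hc]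
      constructor <;> linarith
    · rintro ⟨h1, h2⟩
      refine ⟨jacobiAm (c * θ) k, ⟨?_, ?_⟩, ?_⟩
      · apply (strictMono_ellipticF hk).lt_iff_lt.1
        rw [ellipticF_jacobiAm hk, ellipticF_neg, ← hℓ]
        nlinarith
      · apply (strictMono_ellipticF hk).lt_iff_lt.1
        rw [ellipticF_jacobiAm hk, ← hℓ]
        nlinarith
      · rw [ellipticF_jacobiAm hk]
        field_simp
  have hinj : InjOn (fun φ => ellipticF k φ / c) (Ioo (-m) m) := fun x _ y _ hxy =>
    (strictMono_ellipticF hk).injective (by simpa [div_left_inj' hc.ne'] using hxy)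
  have h := lintegral_image_eq_lintegral_abs_deriv_mul measurableSet_Ioo
    (fun φ _ => ((hasDerivAt_ellipticF hk φ).div_const c).hasDerivWithinAt) hinj
    fun θ => g (jacobiAm (c * θ) k)
  rw [himg] at h
  rw [h, ← lintegral_const_mul' _ _ ENNReal.ofReal_ne_top]
  refine lintegral_congr fun φ => ?_
  have e1 : c * (ellipticF k φ / c) = ellipticF k φ := by field_simp
  have hp := zero_lt_one.trans_le (one_le_ellipticIntegrand hk φ)
  rw [e1, jacobiAm_ellipticF hk, ← mul_assoc, ← ENNReal.ofReal_mul hc.le, abs_of_pos (by positivity)]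
  congr 2
  field_simp

/-! ### Orbits of the pendulum and the change of variables to angle and modulus -/

/-- The energy of a particle in the mean field. -/
def particleEnergy (M : ℝ) (z : ℝ × ℝ) : ℝ := z.2 ^ 2 / 2 - M * Real.cos z.1

/-- The regions of the phase space, up to null sets. -/
def regionSet (M : ℝ) : Region → Set (ℝ × ℝ)
  | .rotPos => {z | z.1 ∈ Ioo (-Real.pi) Real.pi ∧ 0 < z.2 ∧ M < particleEnergy M z}
  | .lib => {z | z.1 ∈ Ioo (-Real.pi) Real.pi ∧ particleEnergy M z < M}
  | .rotNeg => {z | z.1 ∈ Ioo (-Real.pi) Real.pi ∧ z.2 < 0 ∧ M < particleEnergy M z}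

/-- The moduli occurring in a region. -/
def modulusRange : Region → Set ℝ
  | .rotPos => Ioi 1
  | .lib => Ioo 0 1
  | .rotNeg => Ioi 1

/-- The orbit of a given modulus, parametrized by the angle. -/
def orbit (M : ℝ) : Region → ℝ → ℝ → ℝ × ℝ
  | .rotPos, k, θ => (2 * jacobiAm (ellipticK (1 / k) / Real.pi * θ) (1 / k),
      2 * Real.sqrt M * k * jacobiDn (ellipticK (1 / k) / Real.pi * θ) (1 / k))
  | .lib, k, θ => (2 * Real.arcsin (k * jacobiSn (2 * ellipticK k / Real.pi * θ) k),
      2 * Real.sqrt M * k * jacobiCn (2 * ellipticK k / Real.pi * θ) k)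
  | .rotNeg, k, θ => (-(2 * jacobiAm (ellipticK (1 / k) / Real.pi * θ) (1 / k)),
      -(2 * Real.sqrt M * k * jacobiDn (ellipticK (1 / k) / Real.pi * θ) (1 / k)))

/-- The derivative of the action with respect to the modulus. -/
def actionDensity (M : ℝ) : Region → ℝ → ℝ
  | .rotPos, k => 4 * Real.sqrt M * (ellipticK (1 / k) / Real.pi)
  | .lib, k => 4 * Real.sqrt M * k * (2 * ellipticK k / Real.pi)
  | .rotNeg, k => 4 * Real.sqrt M * (ellipticK (1 / k) / Real.pi)

lemma orbit_rotNeg (M k θ : ℝ) : orbit M .rotNeg k θ = -orbit M .rotPos k θ := rfl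

lemma measurable_particleEnergy (M : ℝ) : Measurable (particleEnergy M) := by
  unfold particleEnergy; fun_prop

lemma particleEnergy_neg (M : ℝ) (z : ℝ × ℝ) : particleEnergy M (-z) = particleEnergy M z := by
  simp [particleEnergy]

lemma measurableSet_regionSet (M : ℝ) (i : Region) : MeasurableSet (regionSet M i) := by
  have h0 : MeasurableSet {z : ℝ × ℝ | z.1 ∈ Ioo (-Real.pi) Real.pi} :=
    measurable_fst measurableSet_Ioo
  have hE := measurable_particleEnergy M
  cases i
  · exact h0.inter ((measurableSet_lt measurable_const measurable_snd).inter
      (measurableSet_lt measurable_const hE))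
  · exact h0.inter (measurableSet_lt hE measurable_const)
  · exact h0.inter ((measurableSet_lt measurable_snd measurable_const).inter
      (measurableSet_lt measurable_const hE))

lemma measurableSet_modulusRange (i : Region) : MeasurableSet (modulusRange i) := by
  cases i
  exacts [measurableSet_Ioi, measurableSet_Ioo, measurableSet_Ioi]

lemma isOpen_modulusRange (i : Region) : IsOpen (modulusRange i) := by
  cases i
  exacts [isOpen_Ioi, isOpen_Ioo, isOpen_Ioi]

lemma modulusRange_pos {i : Region} {k : ℝ} (hk : k ∈ modulusRange i) : 0 < k := by
  cases i
  exacts [zero_lt_one.trans hk, hk.1, zero_lt_one.trans hk]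

lemma inv_mem_Ico {k : ℝ} (hk : 1 < k) : 1 / k ∈ Ico (0 : ℝ) 1 :=
  ⟨by positivity, by rw [div_lt_one (by linarith)]; exact hk⟩

lemma actionDensity_pos {M : ℝ} (hM : 0 < M) {i : Region} {k : ℝ} (hk : k ∈ modulusRange i) :
    0 < actionDensity M i k := by
  have hs := Real.sqrt_pos.2 hM
  have hk0 := modulusRange_pos hk
  cases i
  · have := ellipticK_pos (inv_mem_Ico hk)
    simp only [actionDensity]; positivity
  · have := ellipticK_pos ⟨hk.1.le, hk.2⟩
    simp only [actionDensity]; positivity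
  · have := ellipticK_pos (inv_mem_Ico hk)
    simp only [actionDensity]; positivity

/-! ### Substitutions to angle and modulus, region by region -/

lemma two_mul_arcsin_image : (fun x => 2 * Real.arcsin x) '' Ioo (-1) 1 =
    Ioo (-Real.pi) Real.pi := by
  ext q
  simp only [mem_image, mem_Ioo]
  constructor
  · rintro ⟨x, ⟨h1, h2⟩, rfl⟩
    have h3 := Real.neg_pi_div_two_lt_arcsin.2 h1
    have h4 := Real.arcsin_lt_pi_div_two.2 h2
    constructor <;> linarith
  · rintro ⟨h1, h2⟩
    refine ⟨Real.sin (q / 2), ⟨?_, ?_⟩, ?_⟩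
    · rw [← Real.neg_pi_div_two_lt_arcsin, Real.arcsin_sin] <;> linarith
    · rw [← Real.arcsin_lt_pi_div_two, Real.arcsin_sin] <;> linarith
    · rw [Real.arcsin_sin] <;> linarith

lemma lintegral_comp_const_mul {c : ℝ} (hc : 0 < c) (g : ℝ → ENNReal) :
    ∫⁻ y, g y = ∫⁻ y, ENNReal.ofReal c * g (c * y) := by
  have h := lintegral_image_eq_lintegral_abs_deriv_mul (f := fun x => c * x) (f' := fun _ => c)
    MeasurableSet.univ (fun x _ => (((hasDerivAt_id' x).const_mul c).congr_deriv (mul_one c)).hasDerivWithinAt)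
    (fun x _ y _ h => mul_left_cancel₀ hc.ne' h) g
  rw [image_univ, (mul_left_surjective₀ hc.ne').range_eq, abs_of_pos hc] at h
  simpa using h

/-- In the variables `x = sin (q / 2)` and `y = p / (2 √M)` the energy is an affine function of `x²
+ y²`: the libration region becomes the unit disc and the modulus is the radius. -/
lemma particleEnergy_two_arcsin {M x : ℝ} (hM : 0 < M) (hx : x ∈ Icc (-1 : ℝ) 1) (y : ℝ) :
    particleEnergy M (2 * Real.arcsin x, 2 * Real.sqrt M * y) = 2 * M * (x ^ 2 + y ^ 2) - M := by
  simp only [particleEnergy]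
  rw [Real.cos_two_mul', Real.sin_arcsin hx.1 hx.2, ← sub_eq_zero, Real.cos_sq',
    Real.sin_arcsin hx.1 hx.2]
  have := Real.sq_sqrt hM.le
  linear_combination (2 * y ^ 2) * this

/-- Integration over the libration region in polar coordinates of `(p / 2√M, sin (q / 2))`. -/
lemma lintegral_libration {M : ℝ} (hM : 0 < M) {g : ℝ × ℝ → ENNReal} (hg : Measurable g) :
    ∫⁻ z in regionSet M .lib, g z = ∫⁻ k in Ioo 0 1, ENNReal.ofReal (4 * Real.sqrt M * k) *
      ∫⁻ φ in Ioo (-Real.pi) Real.pi, ENNReal.ofReal (1 / Real.sqrt (1 - k ^ 2 * Real.sin φ ^ 2)) *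
        g (2 * Real.arcsin (k * Real.sin φ), 2 * Real.sqrt M * (k * Real.cos φ)) := by
  have hs := Real.sqrt_pos.2 hM
  set G : ℝ × ℝ → ENNReal := {z | particleEnergy M z < M}.indicator g with hG
  have hGm : Measurable G :=
    hg.indicator (measurableSet_lt (measurable_particleEnergy M) measurable_const)
  -- The first coordinate is the rescaled momentum, so that the polar angle `φ` satisfies `sin (q /
  -- 2) = k sin φ`. The two weights are the Jacobians of `q = 2 arcsin w.2` and `p = 2 √M w.1`.
  set H : ℝ × ℝ → ENNReal := fun w => {w : ℝ × ℝ | w.1 ^ 2 + w.2 ^ 2 < 1}.indicator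
    (fun w => ENNReal.ofReal (2 / Real.sqrt (1 - w.2 ^ 2)) * (ENNReal.ofReal (2 * Real.sqrt M) *
      g (2 * Real.arcsin w.2, 2 * Real.sqrt M * w.1))) w with hH
  have hHm : Measurable H := by
    refine Measurable.indicator ?_ (measurableSet_lt (by fun_prop) measurable_const)
    have : Measurable fun w : ℝ × ℝ => g (2 * Real.arcsin w.2, 2 * Real.sqrt M * w.1) :=
      hg.comp (by have := Real.continuous_arcsin.measurable; fun_prop)
    fun_prop
  have hd : ∀ x ∈ Ioo (-1 : ℝ) 1, HasDerivWithinAt (fun x => 2 * Real.arcsin x)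
      (2 / Real.sqrt (1 - x ^ 2)) (Ioo (-1) 1) x := fun x hx => by
    have := (Real.hasDerivAt_arcsin hx.1.ne' hx.2.ne).const_mul 2
    rw [mul_one_div] at this
    exact this.hasDerivWithinAt
  have hi : InjOn (fun x => 2 * Real.arcsin x) (Ioo (-1) 1) := fun x hx y hy h =>
    Real.injOn_arcsin ⟨hx.1.le, hx.2.le⟩ ⟨hy.1.le, hy.2.le⟩ (by simpa using h)
  have h1 : ∫⁻ z in regionSet M .lib, g z = ∫⁻ z in Ioo (-Real.pi) Real.pi ×ˢ univ, G z := by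
    have : regionSet M .lib = {z | particleEnergy M z < M} ∩ Ioo (-Real.pi) Real.pi ×ˢ univ := by
      ext z; simp [regionSet, and_comm]
    rw [this, ← setLIntegral_indicator
      (measurableSet_lt (measurable_particleEnergy M) measurable_const)]
  have h2 : ∫⁻ z in Ioo (-Real.pi) Real.pi ×ˢ univ, G z = ∫⁻ w, H w := by
    rw [Measure.volume_eq_prod, ← Measure.prod_restrict, lintegral_prod _ hGm.aemeasurable,
      Measure.restrict_univ, lintegral_prod_symm _ hHm.aemeasurable,
      ← two_mul_arcsin_image,
      lintegral_image_eq_lintegral_abs_deriv_mul measurableSet_Ioo hd hi,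
      ← lintegral_indicator measurableSet_Ioo]
    refine lintegral_congr fun x => ?_
    by_cases hx : x ∈ Ioo (-1 : ℝ) 1
    · rw [indicator_of_mem hx, lintegral_comp_const_mul (c := 2 * Real.sqrt M) (by positivity),
        abs_of_nonneg (by positivity), ← lintegral_const_mul' _ _ ENNReal.ofReal_ne_top]
      refine lintegral_congr fun y => ?_
      have he := particleEnergy_two_arcsin hM ⟨hx.1.le, hx.2.le⟩ y
      have : particleEnergy M (2 * Real.arcsin x, 2 * Real.sqrt M * y) < M ↔
          y ^ 2 + x ^ 2 < 1 := by
        rw [he]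
        constructor <;> intro h <;> nlinarith
      by_cases hxy : y ^ 2 + x ^ 2 < 1
      · rw [hG, hH, indicator_of_mem (by exact this.2 hxy)]
        dsimp only
        rw [indicator_of_mem (by exact hxy)]
      · have hn : (2 * Real.arcsin x, 2 * Real.sqrt M * y) ∉ {z | particleEnergy M z < M} :=
          fun h => hxy (this.1 h)
        rw [hG, hH, indicator_of_notMem hn]
        dsimp only
        rw [indicator_of_notMem (by exact hxy)]
        simp
    · rw [indicator_of_notMem hx]
      symm
      refine lintegral_eq_zero_of_ae_eq_zero (ae_of_all _ fun y => ?_)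
      refine indicator_of_notMem (fun h => hx ?_) _
      have h' : y ^ 2 + x ^ 2 < 1 := h
      rw [mem_Ioo, ← abs_lt, ← sq_lt_one_iff_abs_lt_one]
      nlinarith [sq_nonneg y]
  rw [h1, h2, ← lintegral_comp_polarCoord_symm]
  have h3 : polarCoord.target = Ioi (0 : ℝ) ×ˢ Ioo (-Real.pi) Real.pi := rfl
  have hm : Measurable fun p : ℝ × ℝ => ENNReal.ofReal p.1 • H (polarCoord.symm p) :=
    (by fun_prop : Measurable fun p : ℝ × ℝ => ENNReal.ofReal p.1).smul
      (hHm.comp continuous_polarCoord_symm.measurable)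
  rw [h3, Measure.volume_eq_prod, ← Measure.prod_restrict, lintegral_prod _ hm.aemeasurable]
  have h4 : Ioo (0 : ℝ) 1 = Iio 1 ∩ Ioi 0 := by ext; simp [and_comm]
  rw [h4, ← setLIntegral_indicator measurableSet_Iio]
  refine setLIntegral_congr_fun measurableSet_Ioi fun k hk => ?_
  have hk0 : (0 : ℝ) < k := hk
  have hsq : ∀ φ : ℝ, (k * Real.cos φ) ^ 2 + (k * Real.sin φ) ^ 2 = k ^ 2 := fun φ => by
    linear_combination k ^ 2 * Real.sin_sq_add_cos_sq φ
  by_cases hk1 : k < 1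
  · rw [indicator_of_mem (by exact hk1), ← lintegral_const_mul' _ _ ENNReal.ofReal_ne_top]
    refine lintegral_congr fun φ => ?_
    rw [hH]
    simp only [polarCoord_symm_apply]
    rw [indicator_of_mem (by show (k * Real.cos φ) ^ 2 + (k * Real.sin φ) ^ 2 < 1; rw [hsq]; nlinarith)]
    dsimp only
    rw [smul_eq_mul, ← mul_assoc, ← mul_assoc, ← ENNReal.ofReal_mul hk0.le,
      ← ENNReal.ofReal_mul (by positivity), ← mul_assoc (ENNReal.ofReal (4 * _ * k)),
      ← ENNReal.ofReal_mul (by positivity), mul_pow]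
    congr 2
    ring
  · rw [indicator_of_notMem (by exact hk1)]
    refine lintegral_eq_zero_of_ae_eq_zero (ae_of_all _ fun φ => ?_)
    rw [hH]
    simp only [polarCoord_symm_apply]
    rw [indicator_of_notMem, smul_zero]; rfl
    show ¬ ((k * Real.cos φ) ^ 2 + (k * Real.sin φ) ^ 2 < 1)
    rw [hsq]; nlinarith

lemma sqrt_one_sub_inv {k : ℝ} (hk : 0 < k) (x : ℝ) :
    k * Real.sqrt (1 - (1 / k) ^ 2 * x ^ 2) = Real.sqrt (k ^ 2 - x ^ 2) := by
  rw [← Real.sqrt_sq hk.le, ← Real.sqrt_mul (sq_nonneg _), Real.sqrt_sq hk.le]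
  congr 1
  field_simp

/-- Integration over the region of rotation with positive momentum. -/
lemma lintegral_rotation {M : ℝ} (hM : 0 < M) {g : ℝ × ℝ → ENNReal} (hg : Measurable g) :
    ∫⁻ z in regionSet M .rotPos, g z = ∫⁻ k in Ioi 1, ENNReal.ofReal (4 * Real.sqrt M) *
      ∫⁻ φ in Ioo (-(Real.pi / 2)) (Real.pi / 2),
        ENNReal.ofReal (1 / Real.sqrt (1 - (1 / k) ^ 2 * Real.sin φ ^ 2)) *
        g (2 * φ, 2 * Real.sqrt M * k * Real.sqrt (1 - (1 / k) ^ 2 * Real.sin φ ^ 2)) := by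
  have hs := Real.sqrt_pos.2 hM
  set S : Set (ℝ × ℝ) := {z | 0 < z.2 ∧ M < particleEnergy M z} with hS
  have hSm : MeasurableSet S := (measurableSet_lt measurable_const measurable_snd).inter
      (measurableSet_lt measurable_const (measurable_particleEnergy M))
  have hGm : Measurable (S.indicator g) := hg.indicator hSm
  have h1 : ∫⁻ z in regionSet M .rotPos, g z =
      ∫⁻ z in Ioo (-Real.pi) Real.pi ×ˢ univ, S.indicator g z := by
    have : regionSet M .rotPos = S ∩ Ioo (-Real.pi) Real.pi ×ˢ univ := by
      ext z; simp [regionSet, hS]; tauto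
    rw [this, ← setLIntegral_indicator hSm]
  have himg : (fun x : ℝ => 2 * x) '' Ioo (-(Real.pi / 2)) (Real.pi / 2) =
      Ioo (-Real.pi) Real.pi := by
    rw [image_mul_left_Ioo two_pos]; congr 1 <;> ring
  have h2 := lintegral_image_eq_lintegral_abs_deriv_mul (f := fun x : ℝ => 2 * x)
    (f' := fun _ => 2) (s := Ioo (-(Real.pi / 2)) (Real.pi / 2)) measurableSet_Ioo
    (fun x _ => by simpa using ((hasDerivAt_id x).const_mul (2 : ℝ)).hasDerivWithinAt)
    (fun x _ y _ h => mul_left_cancel₀ two_ne_zero h) fun q => ∫⁻ p, S.indicator g (q, p)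
  rw [himg] at h2
  -- With `φ = q / 2` fixed, substitute `p = 2 √M √(k² - sin² φ)`. The separatrix `p = 2 √M cos φ`
  -- corresponds to `k = 1`.
  have h3 : ∀ φ ∈ Ioo (-(Real.pi / 2)) (Real.pi / 2), ∫⁻ p, S.indicator g (2 * φ, p) =
      ∫⁻ k in Ioi 1, ENNReal.ofReal (2 * Real.sqrt M) *
        (ENNReal.ofReal (1 / Real.sqrt (1 - (1 / k) ^ 2 * Real.sin φ ^ 2)) *
        g (2 * φ, 2 * Real.sqrt M * k * Real.sqrt (1 - (1 / k) ^ 2 * Real.sin φ ^ 2))) := by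
    intro φ hφ
    have hc : 0 < Real.cos φ := Real.cos_pos_of_mem_Ioo hφ
    have hsin : ∀ k : ℝ, 1 < k → 0 < k ^ 2 - Real.sin φ ^ 2 := fun k hk => by
      nlinarith [Real.sin_sq_le_one φ]
    have hset : ∀ p : ℝ, (2 * φ, p) ∈ S ↔ p ∈ Ioi (2 * Real.sqrt M * Real.cos φ) := fun p => by
      have e : particleEnergy M (2 * φ, p) = p ^ 2 / 2 - (2 * Real.sqrt M * Real.cos φ) ^ 2 / 2
          + M := by
        simp only [particleEnergy]
        rw [Real.cos_two_mul]
        have := Real.sq_sqrt hM.le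
        linear_combination (2 * Real.cos φ ^ 2) * this
      have h0 : 0 < 2 * Real.sqrt M * Real.cos φ := by positivity
      simp only [hS, mem_ofPred_eq, mem_Ioi, e]
      constructor
      · rintro ⟨h, h'⟩
        exact lt_of_pow_lt_pow_left₀ 2 h.le (by linarith)
      · intro h
        have := pow_lt_pow_left₀ h h0.le two_ne_zero
        exact ⟨h0.trans h, by linarith⟩
    have hind : (fun p => S.indicator g (2 * φ, p)) =
        (Ioi (2 * Real.sqrt M * Real.cos φ)).indicator fun p => g (2 * φ, p) := by
      funext p
      by_cases hp : (2 * φ, p) ∈ S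
      · rw [indicator_of_mem hp, indicator_of_mem ((hset p).1 hp)]
      · rw [indicator_of_notMem hp, indicator_of_notMem (fun h => hp ((hset p).2 h))]
    have himg' : (fun k => 2 * Real.sqrt M * Real.sqrt (k ^ 2 - Real.sin φ ^ 2)) '' Ioi 1 =
        Ioi (2 * Real.sqrt M * Real.cos φ) := by
      have hcs : Real.cos φ = Real.sqrt (1 ^ 2 - Real.sin φ ^ 2) := by
        rw [one_pow, ← Real.cos_sq', Real.sqrt_sq hc.le]
      ext p
      simp only [mem_image, mem_Ioi]
      constructor
      · rintro ⟨k, hk, rfl⟩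
        rw [hcs]
        refine mul_lt_mul_of_pos_left (Real.sqrt_lt_sqrt ?_ ?_) (by positivity)
        · nlinarith [Real.sin_sq_le_one φ]
        · nlinarith
      · intro hp
        have hp' : Real.cos φ < p / (2 * Real.sqrt M) := by
          rw [lt_div_iff₀ (by positivity)]; linarith
        have hsq := pow_lt_pow_left₀ hp' hc.le two_ne_zero
        have h1 : 1 < (p / (2 * Real.sqrt M)) ^ 2 + Real.sin φ ^ 2 := by
          nlinarith [Real.sin_sq_add_cos_sq φ]
        refine ⟨Real.sqrt ((p / (2 * Real.sqrt M)) ^ 2 + Real.sin φ ^ 2), ?_, ?_⟩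
        · rw [Real.lt_sqrt zero_le_one]; simpa using h1
        · rw [Real.sq_sqrt (by linarith), add_sub_cancel_right, Real.sqrt_sq (hc.trans hp').le]
          field_simp
    have hd : ∀ k ∈ Ioi (1 : ℝ), HasDerivWithinAt
        (fun k => 2 * Real.sqrt M * Real.sqrt (k ^ 2 - Real.sin φ ^ 2))
        (2 * Real.sqrt M * (k / Real.sqrt (k ^ 2 - Real.sin φ ^ 2))) (Ioi 1) k := fun k hk => by
      have := (((hasDerivAt_pow 2 k).sub_const (Real.sin φ ^ 2)).sqrt (hsin k hk).ne').const_mul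
        (2 * Real.sqrt M)
      refine (this.congr_deriv ?_).hasDerivWithinAt
      have := Real.sqrt_pos.2 (hsin k hk)
      field_simp
      simp
    have hi : InjOn (fun k => 2 * Real.sqrt M * Real.sqrt (k ^ 2 - Real.sin φ ^ 2)) (Ioi 1) := by
      intro x hx y hy h
      have h' := mul_left_cancel₀ (by positivity : (2 * Real.sqrt M) ≠ 0) h
      rw [Real.sqrt_inj (hsin x hx).le (hsin y hy).le, sub_left_inj] at h'
      have hx0 : (1 : ℝ) < x := hx
      have hy0 : (1 : ℝ) < y := hy
      exact (pow_left_inj₀ (by linarith) (by linarith) two_ne_zero).1 h'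
    rw [hind, lintegral_indicator measurableSet_Ioi, ← himg',
      lintegral_image_eq_lintegral_abs_deriv_mul measurableSet_Ioi hd hi]
    refine setLIntegral_congr_fun measurableSet_Ioi fun k hk => ?_
    have hk0 : (0 : ℝ) < k := zero_lt_one.trans hk
    have hr := Real.sqrt_pos.2 (hsin k hk)
    rw [mul_assoc (2 * Real.sqrt M) k, sqrt_one_sub_inv hk0, ← mul_assoc (ENNReal.ofReal _),
      ← ENNReal.ofReal_mul (by positivity), abs_of_pos (by positivity)]
    have e : Real.sqrt (1 - (1 / k) ^ 2 * Real.sin φ ^ 2) =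
        Real.sqrt (k ^ 2 - Real.sin φ ^ 2) / k := by
      rw [eq_div_iff hk0.ne', mul_comm, sqrt_one_sub_inv hk0]
    rw [e, one_div_div]
  have hm : Measurable (Function.uncurry fun (φ k : ℝ) => ENNReal.ofReal (4 * Real.sqrt M) *
      (ENNReal.ofReal (1 / Real.sqrt (1 - (1 / k) ^ 2 * Real.sin φ ^ 2)) *
        g (2 * φ, 2 * Real.sqrt M * k * Real.sqrt (1 - (1 / k) ^ 2 * Real.sin φ ^ 2)))) := by
    have : Measurable fun w : ℝ × ℝ => g (2 * w.1, 2 * Real.sqrt M * w.2 *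
        Real.sqrt (1 - (1 / w.2) ^ 2 * Real.sin w.1 ^ 2)) := hg.comp (by fun_prop)
    simp only [Function.uncurry_def]
    fun_prop
  rw [h1, Measure.volume_eq_prod, ← Measure.prod_restrict, lintegral_prod _ hGm.aemeasurable,
    Measure.restrict_univ, h2]
  calc _ = ∫⁻ φ in Ioo (-(Real.pi / 2)) (Real.pi / 2), ∫⁻ k in Ioi 1,
      ENNReal.ofReal (4 * Real.sqrt M) *
        (ENNReal.ofReal (1 / Real.sqrt (1 - (1 / k) ^ 2 * Real.sin φ ^ 2)) *
        g (2 * φ, 2 * Real.sqrt M * k * Real.sqrt (1 - (1 / k) ^ 2 * Real.sin φ ^ 2))) := by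
        refine setLIntegral_congr_fun measurableSet_Ioo fun φ hφ => ?_
        rw [h3 φ hφ, abs_of_pos two_pos, ← lintegral_const_mul' _ _ ENNReal.ofReal_ne_top]
        refine lintegral_congr fun k => ?_
        rw [← mul_assoc, ← ENNReal.ofReal_mul two_pos.le]
        congr 2
        ring
    _ = _ := by
        rw [lintegral_lintegral_swap hm.aemeasurable]
        refine lintegral_congr fun k => ?_
        rw [lintegral_const_mul' _ _ ENNReal.ofReal_ne_top]

/-- Integration over a region in terms of angle and modulus. -/
theorem lintegral_regionSet {M : ℝ} (hM : 0 < M) (i : Region) {g : ℝ × ℝ → ENNReal}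
    (hg : Measurable g) :
    ∫⁻ z in regionSet M i, g z = ∫⁻ k in modulusRange i, ENNReal.ofReal (actionDensity M i k) *
      ∫⁻ θ in Ioo (-Real.pi) Real.pi, g (orbit M i k θ) := by
  have hpi := Real.pi_pos
  have hs := Real.sqrt_pos.2 hM
  have hrot : ∀ {g : ℝ × ℝ → ENNReal}, Measurable g → ∫⁻ z in regionSet M .rotPos, g z =
      ∫⁻ k in modulusRange .rotPos, ENNReal.ofReal (actionDensity M .rotPos k) *
      ∫⁻ θ in Ioo (-Real.pi) Real.pi, g (orbit M .rotPos k θ) := by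
    intro g hg
    rw [lintegral_rotation hM hg]
    refine setLIntegral_congr_fun measurableSet_Ioi fun k hk => ?_
    have hk' := inv_mem_Ico hk
    have hK := ellipticK_pos hk'
    -- The amplitude is `q / 2`, so a full turn of `q` is the amplitude interval of half-width `π /
    -- 2`, and the angle reaches `π` when the argument reaches `K`.
    have h := lintegral_comp_jacobiAm hk' (c := ellipticK (1 / k) / Real.pi) (ℓ := Real.pi)
      (m := Real.pi / 2) (by positivity) (by rw [div_mul_cancel₀ _ hpi.ne']; rfl)
      fun φ => g (2 * φ, 2 * Real.sqrt M * k * Real.sqrt (1 - (1 / k) ^ 2 * Real.sin φ ^ 2))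
    simp only [actionDensity]
    rw [← h, ENNReal.ofReal_mul (p := 4 * Real.sqrt M) (by positivity), mul_assoc (ENNReal.ofReal _)]
    rfl
  cases i
  · exact hrot hg
  · rw [lintegral_libration hM hg]
    refine setLIntegral_congr_fun measurableSet_Ioo fun k hk => ?_
    have hk' : k ∈ Ico (0 : ℝ) 1 := ⟨hk.1.le, hk.2⟩
    have hk0 := hk.1
    have hK := ellipticK_pos hk'
    have h := lintegral_comp_jacobiAm hk' (c := 2 * ellipticK k / Real.pi) (ℓ := Real.pi)
      (m := Real.pi) (by positivity) (by rw [div_mul_cancel₀ _ hpi.ne', ellipticF_pi hk'])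
      fun φ => g (2 * Real.arcsin (k * Real.sin φ), 2 * Real.sqrt M * (k * Real.cos φ))
    simp only [actionDensity]
    rw [← h, ENNReal.ofReal_mul (p := 4 * Real.sqrt M * k) (by positivity),
      mul_assoc (ENNReal.ofReal _)]
    simp only [← mul_assoc (2 * Real.sqrt M)]
    rfl
  -- Rotations with negative momentum are the images of the others under `z ↦ -z`, which preserves
  -- both the energy and Lebesgue measure.
  · have hneg : ∫⁻ z in regionSet M .rotNeg, g z = ∫⁻ z in regionSet M .rotPos, g (-z) := by
      rw [← (Measure.measurePreserving_neg (volume : Measure (ℝ × ℝ))).setLIntegral_comp_preimage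
        (measurableSet_regionSet M .rotNeg) hg]
      congr 2
      ext z
      simp only [regionSet, mem_preimage, mem_ofPred_eq, particleEnergy_neg, Prod.fst_neg,
        Prod.snd_neg, mem_Ioo, Left.neg_neg_iff, neg_lt_neg_iff, neg_lt]
      tauto
    rw [hneg]
    exact hrot (hg.comp measurable_neg)

/-! ### The action as a function of the modulus -/

/-- The energy of the orbit of modulus `k`. -/
def modulusEnergy (M k : ℝ) : ℝ := 2 * M * k ^ 2 - M

/-- The smallest modulus in the closure of a region. -/
def modulusInf : Region → ℝ
  | .rotPos => 1
  | .lib => 0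
  | .rotNeg => 1

lemma particleEnergy_orbit {M : ℝ} (hM : 0 < M) {i : Region} {k : ℝ} (hk : k ∈ modulusRange i)
    (θ : ℝ) : particleEnergy M (orbit M i k θ) = modulusEnergy M k := by
  have hrot : ∀ {k : ℝ}, 1 < k → particleEnergy M (orbit M .rotPos k θ) = modulusEnergy M k := by
    intro k hk
    have hk0 : 0 < k := zero_lt_one.trans hk
    have hM2 := Real.sq_sqrt hM.le
    simp only [particleEnergy, orbit, jacobiDn, jacobiSn, modulusEnergy]
    set φ := jacobiAm (ellipticK (1 / k) / Real.pi * θ) (1 / k)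
    have h1 := Real.sq_sqrt (one_sub_sq_mul_sin_sq_pos (inv_mem_Ico hk) φ).le
    have h2 : k ^ 2 * (1 - (1 / k) ^ 2 * Real.sin φ ^ 2) = k ^ 2 - Real.sin φ ^ 2 := by
      field_simp
    rw [mul_pow, h1, Real.cos_two_mul', Real.cos_sq', mul_pow, mul_pow, hM2]
    linear_combination (2 * M) * h2
  cases i
  · exact hrot hk
  · set φ := jacobiAm (2 * ellipticK k / Real.pi * θ) k with hφ
    have hx : k * Real.sin φ ∈ Icc (-1 : ℝ) 1 := by
      rw [mem_Icc, ← abs_le, abs_mul]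
      have h1 : |k| ≤ 1 := by rw [abs_of_pos hk.1]; exact hk.2.le
      exact mul_le_one₀ h1 (abs_nonneg _) (Real.abs_sin_le_one _)
    have := particleEnergy_two_arcsin hM hx (k * Real.cos φ)
    simp only [orbit, jacobiSn, jacobiCn, ← hφ]
    rw [mul_assoc (2 * Real.sqrt M), this, modulusEnergy]
    linear_combination (2 * M * k ^ 2) * Real.sin_sq_add_cos_sq φ
  · rw [orbit_rotNeg, particleEnergy_neg]
    exact hrot hk

lemma lintegral_comp_particleEnergy {M : ℝ} (hM : 0 < M) (i : Region) {W : ℝ → ENNReal}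
    (hW : Measurable W) :
    ∫⁻ z in regionSet M i, W (particleEnergy M z) = ∫⁻ k in modulusRange i,
      ENNReal.ofReal (2 * Real.pi * actionDensity M i k) * W (modulusEnergy M k) := by
  have h := lintegral_regionSet hM i (hW.comp (measurable_particleEnergy M))
  simp only [Function.comp_apply] at h
  rw [h]
  refine setLIntegral_congr_fun (measurableSet_modulusRange i) fun k hk => ?_
  simp only [particleEnergy_orbit hM hk]
  rw [lintegral_const, Measure.restrict_apply_univ, Real.volume_Ioo, sub_neg_eq_add, ← two_mul,
    ENNReal.ofReal_mul (p := 2 * Real.pi) (by positivity)]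
  ring

lemma continuousOn_actionDensity (M : ℝ) (i : Region) :
    ContinuousOn (actionDensity M i) (modulusRange i) := by
  have hrot : ContinuousOn (actionDensity M .rotPos) (modulusRange .rotPos) := by
    have : ContinuousOn (fun k : ℝ => ellipticK (1 / k)) (Ioi 1) :=
      continuousOn_ellipticK.comp
        (continuousOn_const.div continuousOn_id fun k hk => (zero_lt_one.trans hk).ne')
        fun k hk => inv_mem_Ico hk
    exact continuousOn_const.mul (this.div_const _)
  cases i
  · exact hrot
  · have : ContinuousOn ellipticK (Ioo 0 1) := continuousOn_ellipticK.mono Ioo_subset_Ico_self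
    exact (continuousOn_const.mul continuousOn_id).mul
      ((continuousOn_const.mul this).div_const _)
  · exact hrot

lemma continuous_action (M : ℝ) (i : Region) : Continuous (action M i) := by
  have h : Continuous fun e : ℝ =>
      ∫ q in (-Real.pi)..Real.pi, Real.sqrt (2 * (e + M * Real.cos q)) :=
    intervalIntegral.continuous_parametric_intervalIntegral_of_continuous'
      (by simp only [Function.uncurry_def]; fun_prop) _ _
  cases i
  · exact continuous_const.mul h
  · exact continuous_const.mul (continuous_const.mul h)
  · exact continuous_const.mul h

lemma action_mono (M : ℝ) (i : Region) : Monotone (action M i) := by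
  have h : Monotone fun e : ℝ =>
      ∫ q in (-Real.pi)..Real.pi, Real.sqrt (2 * (e + M * Real.cos q)) := fun e e' hee => by
    refine intervalIntegral.integral_mono_on (by linarith [Real.pi_pos])
      (Continuous.intervalIntegrable (by fun_prop) _ _)
      (Continuous.intervalIntegrable (by fun_prop) _ _) fun q _ => Real.sqrt_le_sqrt (by linarith)
  have hp : 0 ≤ 1 / (2 * Real.pi) := by positivity
  cases i
  · exact h.const_mul hp
  · exact (h.const_mul two_pos.le).const_mul hp
  · exact h.const_mul hp

lemma action_lib_neg {M : ℝ} (hM : 0 < M) : action M .lib (-M) = 0 := by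
  have : ∀ q, Real.sqrt (2 * (-M + M * Real.cos q)) = 0 := fun q =>
    Real.sqrt_eq_zero_of_nonpos (by nlinarith [Real.cos_le_one q])
  simp [action, this]

lemma action_rotPos_self {M : ℝ} (hM : 0 < M) :
    action M .rotPos M = 4 * Real.sqrt M / Real.pi := by
  have h : ∫ q in (-Real.pi)..Real.pi, Real.sqrt (2 * (M + M * Real.cos q)) =
      ∫ q in (-Real.pi)..Real.pi, 2 * Real.sqrt M * Real.cos (q / 2) := by
    refine intervalIntegral.integral_congr fun q hq => ?_
    rw [uIcc_of_le (by linarith [Real.pi_pos])] at hq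
    have hc : 0 ≤ Real.cos (q / 2) :=
      Real.cos_nonneg_of_mem_Icc ⟨by linarith [hq.1], by linarith [hq.2]⟩
    have e : 2 * (M + M * Real.cos q) = (2 * Real.sqrt M * Real.cos (q / 2)) ^ 2 := by
      have h1 : Real.cos q = 2 * Real.cos (q / 2) ^ 2 - 1 := by
        rw [← Real.cos_two_mul]; congr 1; ring
      rw [mul_pow, mul_pow, Real.sq_sqrt hM.le, h1]; ring
    simp only [e]
    rw [Real.sqrt_sq (by positivity)]
  have h2 : ∫ q in (-Real.pi)..Real.pi, Real.cos (q / 2) = 4 := by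
    rw [intervalIntegral.integral_comp_div (fun x => Real.cos x) two_ne_zero, integral_cos, neg_div,
      Real.sin_neg, Real.sin_pi_div_two]
    norm_num
  rw [action, h, intervalIntegral.integral_const_mul, h2]
  field_simp

lemma action_lib_self {M : ℝ} (hM : 0 < M) : action M .lib M = 8 * Real.sqrt M / Real.pi := by
  have : action M .lib M = 2 * action M .rotPos M := by simp only [action]; ring
  rw [this, action_rotPos_self hM]; ring

/-- The area inside an orbit is `∮ p dq`, hence `2π` times the action. Together with the area in
angle-modulus variables, this identifies the derivative of the action. -/
lemma volume_libration_inter {M e : ℝ} (he : e ≤ M) :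
    volume (regionSet M .lib ∩ {z | particleEnergy M z < e}) =
      ENNReal.ofReal (2 * Real.pi * action M .lib e) := by
  have hset : regionSet M .lib ∩ {z | particleEnergy M z < e} =
      regionBetween (fun q => -Real.sqrt (2 * (e + M * Real.cos q)))
        (fun q => Real.sqrt (2 * (e + M * Real.cos q))) (Ioo (-Real.pi) Real.pi) := by
    ext z
    simp only [regionSet, particleEnergy, regionBetween, mem_inter_iff, mem_ofPred_eq]
    rw [mem_Ioo, mem_Ioo (a := -Real.sqrt _), ← abs_lt (a := z.2), Real.lt_sqrt (abs_nonneg _), sq_abs]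
    constructor
    · rintro ⟨⟨h1, h2⟩, h3⟩
      exact ⟨h1, by linarith⟩
    · rintro ⟨h1, h2⟩
      exact ⟨⟨h1, by linarith⟩, by linarith⟩
  have hc : Continuous fun q => Real.sqrt (2 * (e + M * Real.cos q)) := by fun_prop
  have hi : IntegrableOn (fun q => Real.sqrt (2 * (e + M * Real.cos q)))
      (Ioo (-Real.pi) Real.pi) :=
    (hc.integrableOn_Icc).mono_set Ioo_subset_Icc_self
  rw [hset, Measure.volume_eq_prod, volume_regionBetween_eq_integral
    (f := fun q => -Real.sqrt (2 * (e + M * Real.cos q))) hi.neg hi measurableSet_Ioo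
    fun q _ => (neg_nonpos.2 (Real.sqrt_nonneg _)).trans (Real.sqrt_nonneg _)]
  congr 1
  rw [← integral_Ioc_eq_integral_Ioo, ← intervalIntegral.integral_of_le (by linarith [Real.pi_pos])]
  simp only [action, Pi.sub_apply, sub_neg_eq_add, ← two_mul, intervalIntegral.integral_const_mul]
  field_simp

lemma volume_rotation_inter {M e : ℝ} (he : M ≤ e) :
    volume (regionSet M .rotPos ∩ {z | particleEnergy M z < e}) =
      ENNReal.ofReal (2 * Real.pi * (action M .rotPos e - action M .rotPos M)) := by
  have hset : regionSet M .rotPos ∩ {z | particleEnergy M z < e} =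
      regionBetween (fun q => Real.sqrt (2 * (M + M * Real.cos q)))
        (fun q => Real.sqrt (2 * (e + M * Real.cos q))) (Ioo (-Real.pi) Real.pi) := by
    ext z
    simp only [regionSet, particleEnergy, regionBetween, mem_inter_iff, mem_ofPred_eq]
    rw [mem_Ioo (b := Real.sqrt _)]
    constructor
    · rintro ⟨⟨h1, h2, h3⟩, h4⟩
      exact ⟨h1, (Real.sqrt_lt' h2).2 (by linarith), (Real.lt_sqrt h2.le).2 (by linarith)⟩
    · rintro ⟨h1, h2, h3⟩
      have hz := (Real.sqrt_nonneg _).trans_lt h2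
      have h4 := (Real.sqrt_lt' hz).1 h2
      have h5 := (Real.lt_sqrt hz.le).1 h3
      exact ⟨⟨h1, hz, by linarith⟩, by linarith⟩
  have hi : ∀ e, IntegrableOn (fun q => Real.sqrt (2 * (e + M * Real.cos q)))
      (Ioo (-Real.pi) Real.pi) := fun e =>
    (Continuous.integrableOn_Icc (by fun_prop)).mono_set Ioo_subset_Icc_self
  rw [hset, Measure.volume_eq_prod,
    volume_regionBetween_eq_integral (hi M) (hi e) measurableSet_Ioo
    fun q _ => Real.sqrt_le_sqrt (by linarith)]
  congr 1
  simp only [Pi.sub_apply]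
  rw [integral_sub (hi e) (hi M), ← integral_Ioc_eq_integral_Ioo, ← integral_Ioc_eq_integral_Ioo,
    ← intervalIntegral.integral_of_le (by linarith [Real.pi_pos]),
    ← intervalIntegral.integral_of_le (by linarith [Real.pi_pos])]
  simp only [action]
  field_simp

lemma modulusEnergy_lt_iff {M : ℝ} (hM : 0 < M) {k l : ℝ} (hk : 0 ≤ k) (hl : 0 ≤ l) :
    modulusEnergy M k < modulusEnergy M l ↔ k < l := by
  rw [← pow_lt_pow_iff_left₀ hk hl two_ne_zero, modulusEnergy, modulusEnergy]
  constructor <;> intro h <;> nlinarith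

lemma modulusEnergy_one (M : ℝ) : modulusEnergy M 1 = M := by simp [modulusEnergy]; ring

lemma modulusEnergy_zero (M : ℝ) : modulusEnergy M 0 = -M := by simp [modulusEnergy]

/-- The action is a primitive of its density. -/
lemma action_modulusEnergy {M : ℝ} (hM : 0 < M) {i : Region} {k : ℝ} (hk : k ∈ modulusRange i) :
    IntervalIntegrable (actionDensity M i) volume (modulusInf i) k ∧
      action M i (modulusEnergy M k) = action M i (modulusEnergy M (modulusInf i)) +
        ∫ κ in (modulusInf i)..k, actionDensity M i κ := by
  -- The area of the sublevel set is computed twice: geometrically, as a difference of actions, and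
  -- as an integral of `2π` times the density over moduli. Finiteness of the former gives
  -- integrability of the density up to the endpoint. This avoids differentiating the action under
  -- the integral, where the integrand is singular at the turning points.
  have key : ∀ {i : Region} {k : ℝ}, k ∈ modulusRange i → modulusInf i ≤ k →
      Ioo (modulusInf i) k ⊆ modulusRange i → (0 ≤ modulusInf i) →
      (∀ x, x ∈ modulusRange i ∧ x < k ↔ x ∈ Ioo (modulusInf i) k) →
      volume (regionSet M i ∩ {z | particleEnergy M z < modulusEnergy M k}) = ENNReal.ofReal
        (2 * Real.pi * (action M i (modulusEnergy M k) -
          action M i (modulusEnergy M (modulusInf i)))) →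
      IntervalIntegrable (actionDensity M i) volume (modulusInf i) k ∧
      action M i (modulusEnergy M k) = action M i (modulusEnergy M (modulusInf i)) +
        ∫ κ in (modulusInf i)..k, actionDensity M i κ := by
    intro i k hk hle hsub h0 hiff hvol
    have hm : MeasurableSet {z | particleEnergy M z < modulusEnergy M k} :=
      measurableSet_lt (measurable_particleEnergy M) measurable_const
    have h1 : volume (regionSet M i ∩ {z | particleEnergy M z < modulusEnergy M k}) =
        ∫⁻ κ in Ioo (modulusInf i) k, ENNReal.ofReal (2 * Real.pi * actionDensity M i κ) := by
      have := lintegral_comp_particleEnergy hM i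
        (W := (Iio (modulusEnergy M k)).indicator 1) (measurable_one.indicator measurableSet_Iio)
      have e1 : ∫⁻ z in regionSet M i, (Iio (modulusEnergy M k)).indicator 1 (particleEnergy M z) =
          volume (regionSet M i ∩ {z | particleEnergy M z < modulusEnergy M k}) := by
        have : (fun z => (Iio (modulusEnergy M k)).indicator (1 : ℝ → ENNReal)
            (particleEnergy M z)) =
            {z | particleEnergy M z < modulusEnergy M k}.indicator 1 := rfl
        rw [this, lintegral_indicator_one hm, Measure.restrict_apply hm, inter_comm]
      rw [← e1, this]
      have e2 : Ioo (modulusInf i) k = Iio k ∩ modulusRange i := by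
        ext x; rw [← hiff, and_comm]; rfl
      rw [e2, ← setLIntegral_indicator measurableSet_Iio]
      refine setLIntegral_congr_fun (measurableSet_modulusRange i) fun κ hκ => ?_
      have hlt := modulusEnergy_lt_iff hM (modulusRange_pos hκ).le (modulusRange_pos hk).le
      by_cases h : κ < k
      · rw [indicator_of_mem (mem_Iio.2 (hlt.2 h)), indicator_of_mem (mem_Iio.2 h)]
        simp
      · rw [indicator_of_notMem (fun h' => h (hlt.1 (mem_Iio.1 h'))),
          indicator_of_notMem (fun h' => h (mem_Iio.1 h'))]
        simp
    have hms : AEStronglyMeasurable (actionDensity M i)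
        (volume.restrict (Ioo (modulusInf i) k)) :=
      ((continuousOn_actionDensity M i).mono hsub).aestronglyMeasurable measurableSet_Ioo
    have hnn : 0 ≤ᵐ[volume.restrict (Ioo (modulusInf i) k)]
        fun κ => 2 * Real.pi * actionDensity M i κ :=
      (ae_restrict_iff' measurableSet_Ioo).2 (ae_of_all _ fun κ hκ => by
        have := actionDensity_pos hM (hsub hκ)
        show 0 ≤ 2 * Real.pi * actionDensity M i κ
        positivity)
    have hint : IntegrableOn (fun κ => 2 * Real.pi * actionDensity M i κ)
        (Ioo (modulusInf i) k) := by
      refine ⟨hms.const_mul _, ?_⟩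
      rw [hasFiniteIntegral_iff_ofReal hnn, ← h1, hvol]
      exact ENNReal.ofReal_lt_top
    have hint' : IntegrableOn (actionDensity M i) (Ioo (modulusInf i) k) := by
      have := hint.const_mul (1 / (2 * Real.pi))
      refine this.congr (ae_of_all _ fun κ => ?_)
      have := Real.pi_pos
      field_simp
    refine ⟨(intervalIntegrable_iff_integrableOn_Ioo_of_le hle).2 hint', ?_⟩
    rw [h1, ← ofReal_integral_eq_lintegral_ofReal hint hnn] at hvol
    -- Nonnegativity of the difference of actions is needed to remove `ENNReal.ofReal` from both
    -- sides.
    have hmono := action_mono M i (a := modulusEnergy M (modulusInf i)) (b := modulusEnergy M k) (by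
      have := pow_le_pow_left₀ h0 hle 2
      simp only [modulusEnergy]; nlinarith)
    rw [ENNReal.ofReal_eq_ofReal_iff (integral_nonneg_of_ae hnn)
      (mul_nonneg (by positivity) (by linarith)), integral_const_mul] at hvol
    rw [intervalIntegral.integral_of_le hle, integral_Ioc_eq_integral_Ioo]
    have := mul_left_cancel₀ (by positivity) hvol
    linarith
  have hrot : k ∈ Ioi (1 : ℝ) → IntervalIntegrable (actionDensity M .rotPos) volume 1 k ∧
      action M .rotPos (modulusEnergy M k) = action M .rotPos (modulusEnergy M 1) +
        ∫ κ in (1 : ℝ)..k, actionDensity M .rotPos κ := fun hk => by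
    refine key (i := .rotPos) hk (le_of_lt hk) (fun x hx => hx.1) zero_le_one (fun x => Iff.rfl) ?_
    rw [volume_rotation_inter]
    · simp only [modulusInf, modulusEnergy_one]
    · rw [← modulusEnergy_one M]
      simpa [modulusEnergy_one] using
        ((modulusEnergy_lt_iff hM zero_le_one (zero_le_one.trans (le_of_lt hk))).2 hk).le
  cases i
  · exact hrot hk
  · refine key hk hk.1.le (fun x hx => ⟨hx.1, hx.2.trans hk.2⟩) le_rfl (fun x =>
      ⟨fun h => ⟨h.1.1, h.2⟩, fun h => ⟨⟨h.1, h.2.trans hk.2⟩, h.2⟩⟩) ?_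
    rw [volume_libration_inter]
    · simp only [modulusInf, modulusEnergy_zero, action_lib_neg hM, sub_zero]
    · rw [← modulusEnergy_one M]
      simpa [modulusEnergy_one] using ((modulusEnergy_lt_iff hM hk.1.le zero_le_one).2 hk.2).le
  · exact hrot hk

lemma hasDerivAt_action_modulusEnergy {M : ℝ} (hM : 0 < M) {i : Region} {k : ℝ}
    (hk : k ∈ modulusRange i) :
    HasDerivAt (fun k => action M i (modulusEnergy M k)) (actionDensity M i k) k := by
  have hopen := isOpen_modulusRange i
  have hc := continuousOn_actionDensity M i
  have h1 : HasDerivAt (fun k => action M i (modulusEnergy M (modulusInf i)) +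
      ∫ κ in (modulusInf i)..k, actionDensity M i κ) (actionDensity M i k) k :=
    (intervalIntegral.integral_hasDerivAt_right (action_modulusEnergy hM hk).1
      (hc.stronglyMeasurableAtFilter hopen _ hk) (hc.continuousAt (hopen.mem_nhds hk))).const_add _
  refine h1.congr_of_eventuallyEq ?_
  filter_upwards [hopen.mem_nhds hk] with x hx
  exact (action_modulusEnergy hM hx).2

lemma convex_modulusRange (i : Region) : Convex ℝ (modulusRange i) := by
  cases i
  exacts [convex_Ioi _, convex_Ioo _ _, convex_Ioi _]

lemma strictMonoOn_action_modulusEnergy {M : ℝ} (hM : 0 < M) (i : Region) {s : Set ℝ}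
    (hs : Convex ℝ s) (hsi : interior s ⊆ modulusRange i) :
    StrictMonoOn (fun k => action M i (modulusEnergy M k)) s := by
  refine strictMonoOn_of_deriv_pos hs ?_ fun k hk => ?_
  · exact ((continuous_action M i).comp (by unfold modulusEnergy; fun_prop)).continuousOn
  · rw [(hasDerivAt_action_modulusEnergy hM (hsi hk)).deriv]
    exact actionDensity_pos hM (hsi hk)

lemma image_modulusRange {M : ℝ} (hM : 0 < M) (i : Region) :
    (fun k => action M i (modulusEnergy M k)) '' modulusRange i = actionRange M i := by
  have hcont : ∀ i, Continuous fun k => action M i (modulusEnergy M k) := fun i =>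
    (continuous_action M i).comp (by unfold modulusEnergy; fun_prop)
  have hrot : (fun k => action M .rotPos (modulusEnergy M k)) '' Ioi 1 =
      Ioi (4 * Real.sqrt M / Real.pi) := by
    have hmono := strictMonoOn_action_modulusEnergy hM .rotPos (convex_Ici (1 : ℝ))
      (by rw [interior_Ici]; exact subset_rfl)
    have h1 : action M .rotPos (modulusEnergy M 1) = 4 * Real.sqrt M / Real.pi := by
      rw [modulusEnergy_one, action_rotPos_self hM]
    apply Subset.antisymm
    · rintro _ ⟨k, hk, rfl⟩
      rw [← h1]
      exact hmono self_mem_Ici (mem_Ici.2 (le_of_lt hk)) hk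
    · intro J hJ
      obtain ⟨l, hl, hJl⟩ : ∃ l, 1 ≤ l ∧ J < action M .rotPos (modulusEnergy M l) := by
        have hpi := Real.pi_pos
        -- With `l = 1 + b`, the energy satisfies `E + M cos q ≥ 2 M b²`, so the momentum is at
        -- least `2 √M b` along the whole orbit. The choice of `b` makes this `|J| + 1`, and the
        -- action is the mean of the momentum over the circle.
        refine ⟨1 + (|J| + 1) / (2 * Real.sqrt M), ?_, ?_⟩
        · have : 0 ≤ (|J| + 1) / (2 * Real.sqrt M) := by positivity
          linarith
        set b := (|J| + 1) / (2 * Real.sqrt M) with hb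
        have hb0 : 0 ≤ b := by positivity
        have hs := Real.sqrt_pos.2 hM
        have h2 : |J| + 1 ≤ action M .rotPos (modulusEnergy M (1 + b)) := by
          have h3 : ∫ q in (-Real.pi)..Real.pi, (|J| + 1) ≤ ∫ q in (-Real.pi)..Real.pi,
              Real.sqrt (2 * (modulusEnergy M (1 + b) + M * Real.cos q)) := by
            refine intervalIntegral.integral_mono_on (by linarith) (intervalIntegrable_const)
              (Continuous.intervalIntegrable (by fun_prop) _ _) fun q _ => ?_
            apply Real.le_sqrt_of_sq_le
            have e : |J| + 1 = 2 * Real.sqrt M * b := by rw [hb]; field_simp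
            rw [e, mul_pow, mul_pow, Real.sq_sqrt hM.le, modulusEnergy]
            nlinarith [Real.neg_one_le_cos q, mul_nonneg hM.le hb0]
          rw [intervalIntegral.integral_const] at h3
          rw [action, one_div, ← div_eq_inv_mul, le_div_iff₀ (by positivity)]
          simp only [smul_eq_mul, sub_neg_eq_add] at h3
          linarith
        linarith [le_abs_self J]
      obtain ⟨k, hk, hkJ⟩ := intermediate_value_Ioo hl (hcont .rotPos).continuousOn
        (⟨h1.symm ▸ hJ, hJl⟩ : J ∈ Ioo _ _)
      exact ⟨k, hk.1, hkJ⟩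
  cases i
  · exact hrot
  · have hmono := strictMonoOn_action_modulusEnergy hM .lib (convex_Icc (0 : ℝ) 1)
      (by rw [interior_Icc]; exact subset_rfl)
    have h0 : action M .lib (modulusEnergy M 0) = 0 := by
      rw [modulusEnergy_zero, action_lib_neg hM]
    have h1 : action M .lib (modulusEnergy M 1) = 8 * Real.sqrt M / Real.pi := by
      rw [modulusEnergy_one, action_lib_self hM]
    apply Subset.antisymm
    · rintro _ ⟨k, hk, rfl⟩
      simp only [actionRange]
      rw [← h0, ← h1]
      exact ⟨hmono ⟨le_rfl, zero_le_one⟩ ⟨hk.1.le, hk.2.le⟩ hk.1,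
        hmono ⟨hk.1.le, hk.2.le⟩ ⟨zero_le_one, le_rfl⟩ hk.2⟩
    · intro J hJ
      simp only [actionRange] at hJ
      rw [← h0, ← h1] at hJ
      exact intermediate_value_Ioo zero_le_one (hcont .lib).continuousOn hJ
  · exact hrot

/-! ### Inverting the action: energy, modulus and frequency as functions of `J` -/

lemma exists_modulus {M : ℝ} (hM : 0 < M) {i : Region} {e : ℝ} (he : e ∈ energyRange M i) :
    ∃ k ∈ modulusRange i, modulusEnergy M k = e := by
  have hlow : -M < e := by
    cases i
    · have : M < e := he
      linarith
    · exact he.1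
    · have : M < e := he
      linarith
  have hx : 0 < (e + M) / (2 * M) := by apply div_pos <;> linarith
  refine ⟨Real.sqrt ((e + M) / (2 * M)), ?_, ?_⟩
  · have hrot : M < e → 1 < Real.sqrt ((e + M) / (2 * M)) := fun h => by
      rw [Real.lt_sqrt zero_le_one, lt_div_iff₀ (by positivity)]; linarith
    cases i
    · exact hrot he
    · refine ⟨Real.sqrt_pos.2 hx, ?_⟩
      rw [Real.sqrt_lt' one_pos, div_lt_iff₀ (by positivity)]
      linarith [he.2]
    · exact hrot he
  · rw [modulusEnergy, Real.sq_sqrt hx.le]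
    field_simp
    ring

lemma modulusEnergy_mem {M : ℝ} (hM : 0 < M) {i : Region} {k : ℝ} (hk : k ∈ modulusRange i) :
    modulusEnergy M k ∈ energyRange M i := by
  have hrot : 1 < k → M < modulusEnergy M k := fun h => by
    have := (modulusEnergy_lt_iff hM zero_le_one (by linarith)).2 h
    rwa [modulusEnergy_one] at this
  cases i
  · exact hrot hk
  · have h1 := (modulusEnergy_lt_iff hM le_rfl hk.1.le).2 hk.1
    have h2 := (modulusEnergy_lt_iff hM hk.1.le zero_le_one).2 hk.2
    rw [modulusEnergy_zero] at h1
    rw [modulusEnergy_one] at h2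
    exact ⟨h1, h2⟩
  · exact hrot hk

lemma energy_action {M : ℝ} (hM : 0 < M) {i : Region} {k : ℝ} (hk : k ∈ modulusRange i) :
    energy M i (action M i (modulusEnergy M k)) = modulusEnergy M k := by
  have hinj : InjOn (action M i) (energyRange M i) := by
    intro e he e' he' h
    obtain ⟨l, hl, rfl⟩ := exists_modulus hM he
    obtain ⟨l', hl', rfl⟩ := exists_modulus hM he'
    rw [(strictMonoOn_action_modulusEnergy hM i (convex_modulusRange i) interior_subset).injOn
      hl hl' h]
  exact hinj.leftInvOn_invFunOn (modulusEnergy_mem hM hk)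

lemma modulus_action {M : ℝ} (hM : 0 < M) {i : Region} {k : ℝ} (hk : k ∈ modulusRange i) :
    modulus M i (action M i (modulusEnergy M k)) = k := by
  rw [modulus, energy_action hM hk, modulusEnergy]
  have : (2 * M * k ^ 2 - M + M) / (2 * M) = k ^ 2 := by field_simp; ring
  rw [this, Real.sqrt_sq (modulusRange_pos hk).le]

lemma exists_modulus_action {M : ℝ} (hM : 0 < M) {i : Region} {J : ℝ} (hJ : J ∈ actionRange M i) :
    ∃ k ∈ modulusRange i, J = action M i (modulusEnergy M k) := by
  rw [← image_modulusRange hM] at hJ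
  obtain ⟨k, hk, rfl⟩ := hJ
  exact ⟨k, hk, rfl⟩

lemma modulus_mem {M : ℝ} (hM : 0 < M) {i : Region} {J : ℝ} (hJ : J ∈ actionRange M i) :
    modulus M i J ∈ modulusRange i := by
  obtain ⟨k, hk, rfl⟩ := exists_modulus_action hM hJ
  rwa [modulus_action hM hk]

lemma energy_eq_modulusEnergy {M : ℝ} (hM : 0 < M) {i : Region} {J : ℝ}
    (hJ : J ∈ actionRange M i) : energy M i J = modulusEnergy M (modulus M i J) := by
  obtain ⟨k, hk, rfl⟩ := exists_modulus_action hM hJ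
  rw [modulus_action hM hk, energy_action hM hk]

lemma action_modulus {M : ℝ} (hM : 0 < M) {i : Region} {J : ℝ} (hJ : J ∈ actionRange M i) :
    action M i (modulusEnergy M (modulus M i J)) = J := by
  obtain ⟨k, hk, rfl⟩ := exists_modulus_action hM hJ
  rw [modulus_action hM hk]

lemma isOpen_actionRange (M : ℝ) (i : Region) : IsOpen (actionRange M i) := by
  cases i
  exacts [isOpen_Ioi, isOpen_Ioo, isOpen_Ioi]

lemma measurableSet_actionRange (M : ℝ) (i : Region) : MeasurableSet (actionRange M i) :=
  (isOpen_actionRange M i).measurableSet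

/-- A strictly monotone function whose image is a neighbourhood of the value is continuous.
Continuity is the input for differentiating the inverse function below. -/
lemma continuousAt_modulus {M : ℝ} (hM : 0 < M) {i : Region} {J : ℝ} (hJ : J ∈ actionRange M i) :
    ContinuousAt (modulus M i) J := by
  have hmono : StrictMonoOn (modulus M i) (actionRange M i) := by
    intro J hJ J' hJ' h
    obtain ⟨k, hk, rfl⟩ := exists_modulus_action hM hJ
    obtain ⟨k', hk', rfl⟩ := exists_modulus_action hM hJ'
    rw [modulus_action hM hk, modulus_action hM hk']
    exact ((strictMonoOn_action_modulusEnergy hM i (convex_modulusRange i)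
      interior_subset).lt_iff_lt hk hk').1 h
  have himg : modulus M i '' actionRange M i = modulusRange i := by
    apply Subset.antisymm
    · rintro _ ⟨J, hJ, rfl⟩
      exact modulus_mem hM hJ
    · intro k hk
      refine ⟨action M i (modulusEnergy M k), ?_, modulus_action hM hk⟩
      rw [← image_modulusRange hM]
      exact ⟨k, hk, rfl⟩
  refine hmono.continuousAt_of_image_mem_nhds ((isOpen_actionRange M i).mem_nhds hJ) ?_
  rw [himg]
  exact (isOpen_modulusRange i).mem_nhds (modulus_mem hM hJ)

/-- The modulus inverts the action, whose derivative is the positive density; the chain rule then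
gives the energy. The explicit value of `Ω` is never needed, only its positivity, which permits
dividing by it. -/
lemma hasDerivAt_energy {M : ℝ} (hM : 0 < M) {i : Region} {J : ℝ} (hJ : J ∈ actionRange M i) :
    ∃ Ω : ℝ, 0 < Ω ∧ HasDerivAt (energy M i) Ω J := by
  have hk := modulus_mem hM hJ
  have hev : ∀ᶠ x in 𝓝 J, x ∈ actionRange M i := (isOpen_actionRange M i).mem_nhds hJ
  have h1 : HasDerivAt (modulus M i) (actionDensity M i (modulus M i J))⁻¹ J :=
    HasDerivAt.of_local_left_inverse (continuousAt_modulus hM hJ)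
      (hasDerivAt_action_modulusEnergy hM hk) (actionDensity_pos hM hk).ne'
      (hev.mono fun x hx => action_modulus hM hx)
  have h2 : HasDerivAt (fun x => modulusEnergy M (modulus M i x)) _ J :=
    ((h1.pow 2).const_mul (2 * M)).sub_const M
  refine ⟨_, ?_, h2.congr_of_eventuallyEq (hev.mono fun x hx => energy_eq_modulusEnergy hM hx)⟩
  have := actionDensity_pos hM hk
  have := modulusRange_pos hk
  simp only [Nat.cast_ofNat, Nat.add_one_sub_one, pow_one]
  positivity

lemma frequency_pos {M : ℝ} (hM : 0 < M) {i : Region} {J : ℝ} (hJ : J ∈ actionRange M i) :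
    0 < frequency M i J := by
  obtain ⟨Ω, hΩ, h⟩ := hasDerivAt_energy hM hJ
  rw [frequency, h.deriv]
  exact hΩ

lemma hasDerivAt_energy_frequency {M : ℝ} (hM : 0 < M) {i : Region} {J : ℝ}
    (hJ : J ∈ actionRange M i) : HasDerivAt (energy M i) (frequency M i J) J := by
  obtain ⟨Ω, -, h⟩ := hasDerivAt_energy hM hJ
  exact h.differentiableAt.hasDerivAt

/-- Substituting the modulus for the action. -/
lemma lintegral_actionRange {M : ℝ} (hM : 0 < M) (i : Region) (g : ℝ → ENNReal) :
    ∫⁻ J in actionRange M i, g J = ∫⁻ k in modulusRange i,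
      ENNReal.ofReal (actionDensity M i k) * g (action M i (modulusEnergy M k)) := by
  rw [← image_modulusRange hM, lintegral_image_eq_lintegral_abs_deriv_mul
    (measurableSet_modulusRange i)
    (fun k hk => (hasDerivAt_action_modulusEnergy hM hk).hasDerivWithinAt)
    (strictMonoOn_action_modulusEnergy hM i (convex_modulusRange i) interior_subset).injOn]
  refine setLIntegral_congr_fun (measurableSet_modulusRange i) fun k hk => ?_
  rw [abs_of_pos (actionDensity_pos hM hk)]

/-! ### Transfer between the phase space and the angle-action coordinates -/

/-- The angle-action coordinates of a region, as a map `(θ, J) ↦ (q, p)`. -/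
def angleMap (M : ℝ) (i : Region) (x : ℝ × ℝ) : ℝ × ℝ :=
  (position M i x.1 x.2, momentumCoord M i x.1 x.2)

/-- Lebesgue measure on the angle-action coordinates of a region. -/
def angleMeasure (M : ℝ) (i : Region) : Measure (ℝ × ℝ) :=
  (volume : Measure (ℝ × ℝ)).restrict (Ioo (-Real.pi) Real.pi ×ˢ actionRange M i)

lemma angleMap_eq_orbit (M : ℝ) (i : Region) (x : ℝ × ℝ) :
    angleMap M i x = orbit M i (modulus M i x.2) x.1 := by
  cases i <;> rfl

lemma angleMeasure_eq_prod (M : ℝ) (i : Region) : angleMeasure M i =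
    ((volume : Measure ℝ).restrict (Ioo (-Real.pi) Real.pi)).prod
      ((volume : Measure ℝ).restrict (actionRange M i)) := by
  rw [Measure.prod_restrict, angleMeasure, Measure.volume_eq_prod]

lemma restrict_Ico_prod_eq_angleMeasure (M : ℝ) (i : Region) :
    (volume : Measure (ℝ × ℝ)).restrict (Ico (-Real.pi) Real.pi ×ˢ actionRange M i) =
      angleMeasure M i := by
  rw [angleMeasure_eq_prod, Measure.volume_eq_prod, ← Measure.prod_restrict,
    Measure.restrict_congr_set (Ioo_ae_eq_Ico (μ := volume)).symm]

lemma continuousOn_orbit (M : ℝ) (i : Region) :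
    ContinuousOn (fun x : ℝ × ℝ => orbit M i x.2 x.1) (univ ×ˢ modulusRange i) := by
  have hsnd : ContinuousOn (fun x : ℝ × ℝ => x.2) (univ ×ˢ modulusRange i) :=
    continuous_snd.continuousOn
  have hfst : ContinuousOn (fun x : ℝ × ℝ => x.1) (univ ×ˢ modulusRange i) :=
    continuous_fst.continuousOn
  have hrot : ContinuousOn (fun x : ℝ × ℝ => orbit M .rotPos x.2 x.1) (univ ×ˢ Ioi 1) := by
    have hi : ContinuousOn (fun x : ℝ × ℝ => 1 / x.2) (univ ×ˢ Ioi (1 : ℝ)) :=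
      continuousOn_const.div continuous_snd.continuousOn fun x hx =>
        (zero_lt_one.trans (mem_Ioi.1 hx.2)).ne'
    have hK : ContinuousOn (fun x : ℝ × ℝ => ellipticK (1 / x.2)) (univ ×ˢ Ioi (1 : ℝ)) :=
      continuousOn_ellipticK.comp (f := fun x : ℝ × ℝ => 1 / x.2) hi
        fun x hx => inv_mem_Ico (mem_Ioi.1 hx.2)
    have ham : ContinuousOn (fun x : ℝ × ℝ =>
        jacobiAm (ellipticK (1 / x.2) / Real.pi * x.1) (1 / x.2)) (univ ×ˢ Ioi (1 : ℝ)) :=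
      continuousOn_jacobiAm.comp
        (f := fun x : ℝ × ℝ => (ellipticK (1 / x.2) / Real.pi * x.1, 1 / x.2))
        (((hK.div_const _).mul continuous_fst.continuousOn).prodMk hi)
        fun x hx => ⟨mem_univ _, inv_mem_Ico (mem_Ioi.1 hx.2)⟩
    simp only [orbit, jacobiDn, jacobiSn]
    fun_prop
  cases i
  · exact hrot
  · have hK : ContinuousOn (fun x : ℝ × ℝ => ellipticK x.2) (univ ×ˢ modulusRange .lib) :=
      continuousOn_ellipticK.comp (f := fun x : ℝ × ℝ => x.2) hsnd fun x hx => ⟨hx.2.1.le, hx.2.2⟩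
    have ham : ContinuousOn (fun x : ℝ × ℝ =>
        jacobiAm (2 * ellipticK x.2 / Real.pi * x.1) x.2) (univ ×ˢ modulusRange .lib) :=
      continuousOn_jacobiAm.comp
        (f := fun x : ℝ × ℝ => (2 * ellipticK x.2 / Real.pi * x.1, x.2))
        ((((continuousOn_const.mul hK).div_const _).mul hfst).prodMk hsnd)
        fun x hx => ⟨mem_univ _, hx.2.1.le, hx.2.2⟩
    have harc : ContinuousOn (fun x : ℝ × ℝ => Real.arcsin (x.2 *
        Real.sin (jacobiAm (2 * ellipticK x.2 / Real.pi * x.1) x.2)))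
        (univ ×ˢ modulusRange .lib) :=
      Real.continuous_arcsin.comp_continuousOn (by fun_prop)
    simp only [orbit, jacobiCn, jacobiSn]
    fun_prop
  · exact hrot.neg

lemma continuousOn_angleMap {M : ℝ} (hM : 0 < M) (i : Region) :
    ContinuousOn (angleMap M i) (univ ×ˢ actionRange M i) := by
  have h : ContinuousOn (fun x : ℝ × ℝ => (x.1, modulus M i x.2)) (univ ×ˢ actionRange M i) := by
    refine continuous_fst.continuousOn.prodMk fun x hx => ?_
    exact ((continuousAt_modulus hM hx.2).comp continuousAt_snd).continuousWithinAt
  refine ((continuousOn_orbit M i).comp h fun x hx =>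
    ⟨mem_univ _, modulus_mem hM hx.2⟩).congr fun x _ => ?_
  rw [angleMap_eq_orbit]
  rfl

lemma aemeasurable_angleMap {M : ℝ} (hM : 0 < M) (i : Region) :
    AEMeasurable (angleMap M i) (angleMeasure M i) := by
  have hs : MeasurableSet (Ioo (-Real.pi) Real.pi ×ˢ actionRange M i) :=
    measurableSet_Ioo.prod (measurableSet_actionRange M i)
  exact ((continuousOn_angleMap hM i).mono (prod_mono (subset_univ _) subset_rfl)).aemeasurable hs

/-- The weight in the angle-modulus formula is `dJ/dk`, exactly the Jacobian of the substitution `k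
↦ J`, so passing to the action removes it. -/
lemma lintegral_comp_angleMap {M : ℝ} (hM : 0 < M) (i : Region) {g : ℝ × ℝ → ENNReal}
    (hg : Measurable g) :
    ∫⁻ x, g (angleMap M i x) ∂angleMeasure M i = ∫⁻ z in regionSet M i, g z := by
  have hm : AEMeasurable (fun x => g (angleMap M i x)) (angleMeasure M i) :=
    hg.comp_aemeasurable (aemeasurable_angleMap hM i)
  rw [angleMeasure_eq_prod] at hm ⊢
  rw [lintegral_prod_symm _ hm, lintegral_regionSet hM i hg, lintegral_actionRange hM]
  refine setLIntegral_congr_fun (measurableSet_modulusRange i) fun k hk => ?_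
  simp only [angleMap_eq_orbit, modulus_action hM hk]

/-- Measure form of the fact that angle-action coordinates are canonical. Integrability and
integrals transfer through the push-forward, so injectivity of the map never has to be proved. -/
theorem map_angleMap {M : ℝ} (hM : 0 < M) (i : Region) :
    (angleMeasure M i).map (angleMap M i) = volume.restrict (regionSet M i) := by
  ext s hs
  rw [← lintegral_indicator_one hs, ← lintegral_indicator_one hs,
    ← lintegral_comp_angleMap hM i (measurable_one.indicator hs),
    lintegral_map' (measurable_one.indicator hs).aemeasurable (aemeasurable_angleMap hM i)]

/-! ### Splitting phase-space integrals over the three regions -/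

lemma ae_particleEnergy_ne (M : ℝ) : ∀ᵐ z : ℝ × ℝ, particleEnergy M z ≠ M := by
  have hs : MeasurableSet {z : ℝ × ℝ | particleEnergy M z = M} :=
    measurableSet_eq_fun (measurable_particleEnergy M) measurable_const
  have h : volume {z : ℝ × ℝ | particleEnergy M z = M} = 0 := by
    rw [Measure.volume_eq_prod, Measure.measure_prod_null hs]
    refine ae_of_all _ fun q => ?_
    refine (Set.Finite.subset (s := {Real.sqrt (2 * (M + M * Real.cos q)),
      -Real.sqrt (2 * (M + M * Real.cos q))}) (by simp) fun p hp => ?_).measure_zero _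
    have h1 : p ^ 2 / 2 - M * Real.cos q = M := hp
    have h2 : p ^ 2 = 2 * (M + M * Real.cos q) := by linarith
    rw [mem_insert_iff, mem_singleton_iff, ← sq_eq_sq_iff_eq_or_eq_neg, h2, Real.sq_sqrt]
    rw [← h2]; positivity
  exact measure_eq_zero_iff_ae_notMem.1 h

theorem phaseMeasure_eq {M : ℝ} (hM : 0 < M) : phaseMeasure =
    volume.restrict (regionSet M .rotPos) + volume.restrict (regionSet M .lib) +
      volume.restrict (regionSet M .rotNeg) := by
  have hd1 : Disjoint (regionSet M .rotPos) (regionSet M .lib) :=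
    disjoint_left.2 fun z hz hz' => lt_asymm hz.2.2 hz'.2
  have hd2 : Disjoint (regionSet M .rotPos ∪ regionSet M .lib) (regionSet M .rotNeg) :=
    disjoint_left.2 fun z hz hz' => by
      rcases hz with hz | hz
      · exact lt_asymm hz.2.1 hz'.2.1
      · exact lt_asymm hz.2 hz'.2.2
  rw [← Measure.restrict_union hd1 (measurableSet_regionSet M _),
    ← Measure.restrict_union hd2 (measurableSet_regionSet M _), phaseMeasure,
    Measure.volume_eq_prod, ← Measure.prod_restrict, Measure.restrict_congr_set (Ioo_ae_eq_Ico (μ := volume)).symm,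
    Measure.prod_restrict]
  refine Measure.restrict_congr_set ?_
  rw [← Measure.volume_eq_prod]
  filter_upwards [ae_particleEnergy_ne M] with z hz
  refine propext ⟨fun h => ?_, fun h => ⟨?_, mem_univ _⟩⟩
  · have h1 : z.1 ∈ Ioo (-Real.pi) Real.pi := h.1
    rcases lt_or_gt_of_ne hz with h2 | h2
    · exact Or.inl (Or.inr ⟨h1, h2⟩)
    · rcases lt_trichotomy z.2 0 with h3 | h3 | h3
      · exact Or.inr ⟨h1, h3, h2⟩
      -- A point at rest has energy `-M cos q ≤ M`, so it cannot lie outside the separatrix.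
      · exfalso
        simp only [particleEnergy, h3] at h2
        nlinarith [Real.neg_one_le_cos z.1]
      · exact Or.inl (Or.inl ⟨h1, h3, h2⟩)
  · rcases h with (h | h) | h
    exacts [h.1, h.1, h.1]

lemma restrict_regionSet_le {M : ℝ} (hM : 0 < M) (i : Region) :
    volume.restrict (regionSet M i) ≤ phaseMeasure := by
  rw [phaseMeasure_eq hM]
  cases i
  · rw [add_assoc]; exact Measure.le_add_right le_rfl
  · exact Measure.le_add_right (Measure.le_add_left le_rfl)
  · exact Measure.le_add_left le_rfl

lemma integrable_comp_angleMap {M : ℝ} (hM : 0 < M) (i : Region) {g : ℝ × ℝ → ℝ}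
    (hg : Integrable g phaseMeasure) :
    Integrable (fun x => g (angleMap M i x)) (angleMeasure M i) := by
  have := hg.mono_measure (restrict_regionSet_le hM i)
  rw [← map_angleMap hM] at this
  exact this.comp_aemeasurable (aemeasurable_angleMap hM i)

lemma integral_comp_angleMap {M : ℝ} (hM : 0 < M) (i : Region) {g : ℝ × ℝ → ℝ}
    (hg : Integrable g phaseMeasure) :
    ∫ z in regionSet M i, g z = ∫ x, g (angleMap M i x) ∂angleMeasure M i := by
  have := (hg.mono_measure (restrict_regionSet_le hM i)).aestronglyMeasurable
  rw [← map_angleMap hM] at this ⊢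
  rw [integral_map (aemeasurable_angleMap hM i) this]

lemma integral_Ioo_eq_intervalIntegral (g : ℝ → ℝ) :
    ∫ θ in Ioo (-Real.pi) Real.pi, g θ = ∫ θ in (-Real.pi)..Real.pi, g θ := by
  rw [intervalIntegral.integral_of_le (by linarith [Real.pi_pos]), integral_Ioc_eq_integral_Ioo]

lemma integrableOn_angleIntegral {M : ℝ} (hM : 0 < M) (i : Region) {g : ℝ × ℝ → ℝ}
    (hg : Integrable g phaseMeasure) :
    IntegrableOn (fun J => ∫ θ in (-Real.pi)..Real.pi, inAngleAction M g i θ J)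
      (actionRange M i) := by
  have h := integrable_comp_angleMap hM i hg
  rw [angleMeasure_eq_prod] at h
  have h' := h.integral_prod_right
  simp only [integral_Ioo_eq_intervalIntegral] at h'
  exact h'

/-- The integral over the phase space in angle-action coordinates. -/
theorem integral_phaseMeasure {M : ℝ} (hM : 0 < M) {g : ℝ × ℝ → ℝ}
    (hg : Integrable g phaseMeasure) :
    ∫ z, g z ∂phaseMeasure = actionIntegral M fun i J =>
      ∫ θ in (-Real.pi)..Real.pi, inAngleAction M g i θ J := by
  have hi : ∀ i, Integrable g (volume.restrict (regionSet M i)) := fun i =>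
    hg.mono_measure (restrict_regionSet_le hM i)
  have key : ∀ i, ∫ z in regionSet M i, g z = ∫ J in actionRange M i,
      ∫ θ in (-Real.pi)..Real.pi, inAngleAction M g i θ J := fun i => by
    have h := integrable_comp_angleMap hM i hg
    rw [integral_comp_angleMap hM i hg, angleMeasure_eq_prod] at *
    rw [integral_prod_symm _ h]
    simp only [integral_Ioo_eq_intervalIntegral]
    rfl
  rw [phaseMeasure_eq hM, integral_add_measure ((hi _).add_measure (hi _)) (hi _),
    integral_add_measure (hi _) (hi _), actionIntegral, key, key, key]

/-! ### Fourier coefficients of `cos q` along the orbits -/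

lemma particleEnergy_angleMap {M : ℝ} (hM : 0 < M) {i : Region} {x : ℝ × ℝ}
    (hx : x.2 ∈ actionRange M i) : particleEnergy M (angleMap M i x) = energy M i x.2 := by
  rw [angleMap_eq_orbit, particleEnergy_orbit hM (modulus_mem hM hx), energy_eq_modulusEnergy hM hx]

/-- The amplitude is odd in its argument. Thus evenness in `θ` means evenness in `q` at fixed `p`,
in every region, and `θ = 0` lies at `q = 0`. -/
lemma angleMap_neg {M : ℝ} (hM : 0 < M) {i : Region} {J : ℝ} (hJ : J ∈ actionRange M i) (θ : ℝ) :
    angleMap M i (-θ, J) = (-(angleMap M i (θ, J)).1, (angleMap M i (θ, J)).2) := by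
  have hk := modulus_mem hM hJ
  rw [angleMap_eq_orbit, angleMap_eq_orbit]
  cases i
  · have h := inv_mem_Ico hk
    simp only [orbit, jacobiDn, jacobiSn, mul_neg, jacobiAm_neg h, Real.sin_neg, neg_sq]
  · have h : modulus M .lib J ∈ Ico (0 : ℝ) 1 := ⟨hk.1.le, hk.2⟩
    simp only [orbit, jacobiCn, jacobiSn, mul_neg, jacobiAm_neg h, Real.sin_neg, Real.cos_neg,
      Real.arcsin_neg]
  · have h := inv_mem_Ico hk
    simp only [orbit, jacobiDn, jacobiSn, mul_neg, jacobiAm_neg h, Real.sin_neg, neg_sq]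

lemma continuous_position {M : ℝ} (hM : 0 < M) {i : Region} {J : ℝ} (hJ : J ∈ actionRange M i) :
    Continuous fun θ => position M i θ J := by
  have h : Continuous fun θ => angleMap M i (θ, J) := by
    refine (continuousOn_angleMap hM i).comp_continuous (by fun_prop) fun θ => ⟨mem_univ _, hJ⟩
  exact continuous_fst.comp h

lemma cosCoeff_eq_fourierCoeffOn (M : ℝ) (m : ℤ) (i : Region) (J : ℝ) :
    cosCoeff M m i J = fourierCoeffOn (neg_lt_self Real.pi_pos)
      (fun θ => (Real.cos (position M i θ J) : ℂ)) m := by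
  have h2 : ((2 * Real.pi : ℝ) : ℂ) ≠ 0 := by exact_mod_cast (by positivity : (2 * Real.pi) ≠ 0)
  rw [fourierCoeffOn_eq_integral, cosCoeff, Complex.real_smul]
  congr 1
  · push_cast; ring
  · refine intervalIntegral.integral_congr fun θ _ => ?_
    rw [fourier_coe_apply, smul_eq_mul, mul_comm]
    congr 2
    push_cast
    push_cast at h2
    have hpi : (Real.pi : ℂ) ≠ 0 := by exact_mod_cast Real.pi_ne_zero
    have : (Real.pi : ℂ) - -Real.pi = 2 * Real.pi := by ring
    rw [this]
    field_simp

/-- The mean of `cos² q` along an orbit. -/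
def cosSqMean (M : ℝ) (i : Region) (J : ℝ) : ℝ :=
  (2 * Real.pi)⁻¹ * ∫ θ in (-Real.pi)..Real.pi, Real.cos (position M i θ J) ^ 2

/-- The mean of `cos q` along an orbit. -/
def cosMean (M : ℝ) (i : Region) (J : ℝ) : ℝ :=
  (2 * Real.pi)⁻¹ * ∫ θ in (-Real.pi)..Real.pi, Real.cos (position M i θ J)

/-- Parseval on a circle of length `2π`. This is the only place where the whole Fourier series of
`cos q` enters. -/
lemma hasSum_norm_cosCoeff_sq {M : ℝ} (hM : 0 < M) {i : Region} {J : ℝ}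
    (hJ : J ∈ actionRange M i) :
    HasSum (fun m : ℤ => ‖cosCoeff M m i J‖ ^ 2) (cosSqMean M i J) := by
  have hc : Continuous fun θ => (Real.cos (position M i θ J) : ℂ) :=
    Complex.continuous_ofReal.comp (Real.continuous_cos.comp (continuous_position hM hJ))
  have hL : MemLp (fun θ => (Real.cos (position M i θ J) : ℂ)) 2
      (volume.restrict (Ioc (-Real.pi) Real.pi)) := by
    refine MemLp.of_bound hc.aestronglyMeasurable 1 (ae_of_all _ fun θ => ?_)
    rw [Complex.norm_real]
    exact Real.abs_cos_le_one _
  have h := hasSum_sq_fourierCoeffOn (neg_lt_self Real.pi_pos) hL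
  simp only [← cosCoeff_eq_fourierCoeffOn] at h
  convert h using 1
  rw [cosSqMean, smul_eq_mul, sub_neg_eq_add, ← two_mul]
  simp only [Complex.norm_real, Real.norm_eq_abs, sq_abs]

lemma cosCoeff_zero (M : ℝ) (i : Region) (J : ℝ) : cosCoeff M 0 i J = cosMean M i J := by
  have : ∀ θ : ℝ, (Real.cos (position M i θ J) : ℂ) *
      Complex.exp (-(Complex.I * (0 : ℤ) * θ)) = (Real.cos (position M i θ J) : ℝ) := fun θ => by
    simp
  rw [cosCoeff, cosMean]
  simp only [this]
  rw [intervalIntegral.integral_ofReal]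
  push_cast
  ring

lemma norm_cosCoeff_zero_sq (M : ℝ) (i : Region) (J : ℝ) :
    ‖cosCoeff M 0 i J‖ ^ 2 = cosMean M i J ^ 2 := by
  rw [cosCoeff_zero, Complex.norm_real, Real.norm_eq_abs, sq_abs]

lemma continuousOn_cosCoeff {M : ℝ} (hM : 0 < M) (m : ℤ) (i : Region) :
    ContinuousOn (cosCoeff M m i) (actionRange M i) := by
  rw [continuousOn_iff_continuous_domRestrict]
  have hc : Continuous fun x : actionRange M i × ℝ => position M i x.2 x.1 :=
    continuous_fst.comp ((continuousOn_angleMap hM i).comp_continuous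
      (f := fun x : actionRange M i × ℝ => (x.2, (x.1 : ℝ)))
      (by fun_prop) fun x => ⟨mem_univ _, x.1.2⟩)
  refine continuous_const.mul
    (intervalIntegral.continuous_parametric_intervalIntegral_of_continuous'
    (f := fun (J : actionRange M i) (θ : ℝ) => (Real.cos (position M i θ J) : ℂ) *
      Complex.exp (-(Complex.I * m * θ))) ?_ _ _)
  simp only [Function.uncurry_def]
  have := Complex.continuous_ofReal.comp (Real.continuous_cos.comp hc)
  exact this.mul (by fun_prop)

lemma continuousOn_cosMean {M : ℝ} (hM : 0 < M) (i : Region) :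
    ContinuousOn (cosMean M i) (actionRange M i) := by
  have h := Complex.continuous_re.comp_continuousOn (continuousOn_cosCoeff hM 0 i)
  refine h.congr fun J _ => ?_
  rw [Function.comp_apply, cosCoeff_zero, Complex.ofReal_re]

lemma abs_cosMean_le (M : ℝ) (i : Region) (J : ℝ) : |cosMean M i J| ≤ 1 := by
  have h := intervalIntegral.norm_integral_le_of_norm_le_const (a := -Real.pi) (b := Real.pi)
    (f := fun θ => Real.cos (position M i θ J)) (C := 1) fun θ _ => Real.abs_cos_le_one _
  rw [sub_neg_eq_add, ← two_mul, one_mul, Real.norm_eq_abs,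
    abs_of_pos (a := 2 * Real.pi) (by positivity)] at h
  rw [cosMean, abs_mul, abs_of_pos (by positivity), inv_mul_le_iff₀ (by positivity), mul_one]
  exact h

lemma cosSqMean_le_one {M : ℝ} (hM : 0 < M) {i : Region} {J : ℝ} (hJ : J ∈ actionRange M i) :
    cosSqMean M i J ≤ 1 := by
  have hc := (Real.continuous_cos.comp (continuous_position hM hJ)).pow 2
  have h := intervalIntegral.integral_mono_on (a := -Real.pi) (b := Real.pi)
    (by linarith [Real.pi_pos]) (hc.intervalIntegrable (μ := volume) _ _)
    (intervalIntegrable_const (c := (1 : ℝ))) fun θ _ => Real.cos_sq_le_one _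
  rw [intervalIntegral.integral_const, sub_neg_eq_add, ← two_mul, smul_eq_mul, mul_one] at h
  rw [cosSqMean, inv_mul_le_iff₀ (by positivity), mul_one]
  exact h

/-- The mean of `cos q` along the orbit through a point, as a function of the energy. -/
def cosMeanEnergy (M e : ℝ) : ℝ :=
  (Ioi M).indicator (fun e => cosMean M .rotPos (action M .rotPos e)) e +
    (Ioo (-M) M).indicator (fun e => cosMean M .lib (action M .lib e)) e

lemma action_energy {M : ℝ} (hM : 0 < M) {i : Region} {J : ℝ} (hJ : J ∈ actionRange M i) :
    action M i (energy M i J) = J := by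
  rw [energy_eq_modulusEnergy hM hJ, action_modulus hM hJ]

lemma energy_mem {M : ℝ} (hM : 0 < M) {i : Region} {J : ℝ} (hJ : J ∈ actionRange M i) :
    energy M i J ∈ energyRange M i := by
  rw [energy_eq_modulusEnergy hM hJ]
  exact modulusEnergy_mem hM (modulus_mem hM hJ)

lemma neg_lt_energy {M : ℝ} (hM : 0 < M) {i : Region} {J : ℝ} (hJ : J ∈ actionRange M i) :
    -M < energy M i J := by
  have h := energy_mem hM hJ
  cases i
  · have : M < energy M .rotPos J := h
    linarith
  · exact h.1
  · have : M < energy M .rotNeg J := h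
    linarith

/-- The two rotating orbits of equal energy are reflections of each other and `cos` is even. Hence
the orbit mean of `cos q` is a function of the energy alone, which is what Casimirs of `F(E)` can
detect. -/
lemma cosMean_rotNeg (M J : ℝ) : cosMean M .rotNeg J = cosMean M .rotPos J := by
  have h : ∀ θ, position M .rotNeg θ J = -position M .rotPos θ J := fun θ => rfl
  simp only [cosMean, h, Real.cos_neg]

lemma cosMeanEnergy_of_gt {M e : ℝ} (he : M < e) :
    cosMeanEnergy M e = cosMean M .rotPos (action M .rotPos e) := by
  rw [cosMeanEnergy, indicator_of_mem (mem_Ioi.2 he),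
    indicator_of_notMem (fun h => lt_asymm he h.2), add_zero]

lemma cosMeanEnergy_of_mem {M e : ℝ} (he : e ∈ Ioo (-M) M) :
    cosMeanEnergy M e = cosMean M .lib (action M .lib e) := by
  rw [cosMeanEnergy, indicator_of_mem he,
    indicator_of_notMem (fun h => lt_asymm (mem_Ioi.1 h) he.2), zero_add]

lemma cosMeanEnergy_energy {M : ℝ} (hM : 0 < M) {i : Region} {J : ℝ} (hJ : J ∈ actionRange M i) :
    cosMeanEnergy M (energy M i J) = cosMean M i J := by
  have he := energy_mem hM hJ
  have ha := action_energy hM hJ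
  cases i
  · rw [cosMeanEnergy_of_gt he, ha]
  · rw [cosMeanEnergy_of_mem he, ha]
  · rw [cosMeanEnergy_of_gt he, cosMean_rotNeg]
    exact congrArg _ ha

lemma abs_cosMeanEnergy_le (M e : ℝ) : |cosMeanEnergy M e| ≤ 1 := by
  by_cases h1 : M < e
  · rw [cosMeanEnergy_of_gt h1]
    exact abs_cosMean_le _ _ _
  · by_cases h2 : e ∈ Ioo (-M) M
    · rw [cosMeanEnergy_of_mem h2]
      exact abs_cosMean_le _ _ _
    · rw [cosMeanEnergy, indicator_of_notMem (by exact h1), indicator_of_notMem h2]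
      simp

lemma action_mem {M : ℝ} (hM : 0 < M) {i : Region} {e : ℝ} (he : e ∈ energyRange M i) :
    action M i e ∈ actionRange M i := by
  obtain ⟨k, hk, rfl⟩ := exists_modulus hM he
  rw [← image_modulusRange hM]
  exact ⟨k, hk, rfl⟩

open Classical in
lemma measurable_indicator_of_continuousOn {g : ℝ → ℝ} {s : Set ℝ} (hg : ContinuousOn g s)
    (hs : MeasurableSet s) : Measurable (s.indicator g) := by
  rw [← piecewise_eq_indicator]
  exact hg.measurable_piecewise continuousOn_const hs

/-- Continuity on each energy range suffices; nothing has to be known about the behaviour at the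
separatrix energy. -/
lemma measurable_cosMeanEnergy {M : ℝ} (hM : 0 < M) : Measurable (cosMeanEnergy M) := by
  have h : ∀ i, ContinuousOn (fun e => cosMean M i (action M i e)) (energyRange M i) := fun i =>
    (continuousOn_cosMean hM i).comp (continuous_action M i).continuousOn fun e he =>
      action_mem hM he
  exact (measurable_indicator_of_continuousOn (h .rotPos) measurableSet_Ioi).add
    (measurable_indicator_of_continuousOn (h .lib) measurableSet_Ioo)

/-! ### First and second variations -/

lemma iteratedDeriv_one_comp_affine {Q : ℝ → ℝ} {a b : ℝ} (hQ : DifferentiableAt ℝ Q a) :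
    iteratedDeriv 1 (fun ε : ℝ => Q (a + ε * b)) 0 = deriv Q a * b := by
  have h1 : HasDerivAt (fun ε : ℝ => a + ε * b) b 0 := by
    simpa using ((hasDerivAt_id' (0 : ℝ)).mul_const b).const_add a
  have h2 : HasDerivAt Q (deriv Q a) (a + 0 * b) := by simpa using hQ.hasDerivAt
  rw [iteratedDeriv_one]
  exact (h2.comp 0 h1).deriv

lemma iteratedDeriv_two_comp_affine {s : ℝ → ℝ} {a b : ℝ} (ha : 0 < a)
    (hs : DifferentiableOn ℝ s (Ioi 0)) (hs' : DifferentiableOn ℝ (deriv s) (Ioi 0)) :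
    iteratedDeriv 2 (fun ε : ℝ => s (a + ε * b)) 0 = deriv (deriv s) a * b ^ 2 := by
  have h1 : ∀ ε : ℝ, HasDerivAt (fun ε : ℝ => a + ε * b) b ε := fun ε => by
    simpa using ((hasDerivAt_id' ε).mul_const b).const_add a
  -- The entropy function is only differentiable on the positive half-line. Positivity for small `ε`
  -- may depend on the point, since the variation differentiates before integrating.
  have hev : ∀ᶠ ε : ℝ in 𝓝 0, 0 < a + ε * b := by
    have : ContinuousAt (fun ε : ℝ => a + ε * b) 0 := (h1 0).continuousAt
    exact this.eventually_const_lt (by simpa using ha)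
  have h2 : deriv (fun ε : ℝ => s (a + ε * b)) =ᶠ[𝓝 0] fun ε => deriv s (a + ε * b) * b := by
    filter_upwards [hev] with ε hε
    exact (((hs.differentiableAt (Ioi_mem_nhds hε)).hasDerivAt).comp ε (h1 ε)).deriv
  have h3 : HasDerivAt (deriv s) (deriv (deriv s) a) (a + 0 * b) := by
    simpa using (hs'.differentiableAt (Ioi_mem_nhds ha)).hasDerivAt
  rw [iteratedDeriv_succ, iteratedDeriv_one, h2.deriv_eq, sq, ← mul_assoc]
  exact ((h3.comp 0 (h1 0)).mul_const b).deriv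

lemma integrable_bdd_mul {g h : ℝ × ℝ → ℝ} (hh : Integrable h phaseMeasure) (hg : Continuous g)
    (hb : ∀ z, |g z| ≤ 1) : Integrable (fun z => g z * h z) phaseMeasure :=
  hh.bdd_mul (c := 1) hg.aestronglyMeasurable (ae_of_all _ hb)

lemma integrable_cos_mul {h : ℝ × ℝ → ℝ} (hh : Integrable h phaseMeasure) :
    Integrable (fun z : ℝ × ℝ => Real.cos z.1 * h z) phaseMeasure :=
  integrable_bdd_mul hh (by fun_prop) fun z => Real.abs_cos_le_one _

lemma integrable_sin_mul {h : ℝ × ℝ → ℝ} (hh : Integrable h phaseMeasure) :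
    Integrable (fun z : ℝ × ℝ => Real.sin z.1 * h z) phaseMeasure :=
  integrable_bdd_mul hh (by fun_prop) fun z => Real.abs_sin_le_one _

lemma integral_weight_add {w f h : ℝ × ℝ → ℝ} (hf : Integrable (fun z => w z * f z) phaseMeasure)
    (hh : Integrable (fun z => w z * h z) phaseMeasure) (ε : ℝ) :
    ∫ z, w z * (f z + ε * h z) ∂phaseMeasure =
      ∫ z, w z * f z ∂phaseMeasure + ε * ∫ z, w z * h z ∂phaseMeasure := by
  rw [← integral_const_mul, ← integral_add hf (hh.const_mul ε)]
  congr 1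
  funext z
  ring

/-- The energy functional is a quadratic polynomial along a line, so its variations can be read off
from coefficients. -/
lemma totalEnergy_add {f h : ℝ × ℝ → ℝ} (hf : Integrable f phaseMeasure)
    (hf2 : Integrable (fun z => z.2 ^ 2 / 2 * f z) phaseMeasure) (hh : Integrable h phaseMeasure)
    (hh2 : Integrable (fun z => z.2 ^ 2 / 2 * h z) phaseMeasure) (ε : ℝ) :
    totalEnergy (fun z => f z + ε * h z) = totalEnergy f +
      ε * ((∫ z, z.2 ^ 2 / 2 * h z ∂phaseMeasure) - orderX f * orderX h - orderY f * orderY h) +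
      ε ^ 2 * (-(orderX h ^ 2 + orderY h ^ 2) / 2) := by
  have e1 := integral_weight_add hf2 hh2 ε
  have e2 := integral_weight_add (integrable_cos_mul hf) (integrable_cos_mul hh) ε
  have e3 := integral_weight_add (integrable_sin_mul hf) (integrable_sin_mul hh) ε
  simp only [totalEnergy, orderX, orderY]
  rw [e1, e2, e3]
  ring

lemma mass_add {f h : ℝ × ℝ → ℝ} (hf : Integrable f phaseMeasure)
    (hh : Integrable h phaseMeasure) (ε : ℝ) :
    mass (fun z => f z + ε * h z) = mass f + ε * mass h + ε ^ 2 * 0 := by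
  simp only [mass]
  rw [integral_add hf (hh.const_mul ε), integral_const_mul]
  ring

/-- The vanishing term `ε ^ 2 * 0` keeps the derivative in the same quadratic form, so that the
statement applies to itself for the second derivative. -/
lemma hasDerivAt_quadratic (A B C ε : ℝ) :
    HasDerivAt (fun ε : ℝ => A + ε * B + ε ^ 2 * C) (B + ε * (2 * C) + ε ^ 2 * 0) ε := by
  have h1 := ((hasDerivAt_id' ε).mul_const B).const_add A
  have h2 := (hasDerivAt_pow 2 ε).mul_const C
  exact (h1.add h2).congr_deriv (by simp; ring)

lemma iteratedDeriv_one_quadratic (A B C : ℝ) :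
    iteratedDeriv 1 (fun ε : ℝ => A + ε * B + ε ^ 2 * C) 0 = B := by
  rw [iteratedDeriv_one, (hasDerivAt_quadratic A B C 0).deriv]
  ring

lemma iteratedDeriv_two_quadratic (A B C : ℝ) :
    iteratedDeriv 2 (fun ε : ℝ => A + ε * B + ε ^ 2 * C) 0 = 2 * C := by
  have : deriv (fun ε : ℝ => A + ε * B + ε ^ 2 * C) =
      fun ε => B + ε * (2 * C) + ε ^ 2 * 0 := funext fun ε => (hasDerivAt_quadratic A B C ε).deriv
  rw [iteratedDeriv_succ, iteratedDeriv_one, this, (hasDerivAt_quadratic B (2 * C) 0 0).deriv]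
  ring

lemma variation_one {s : ℝ → ℝ} {f h : ℝ × ℝ → ℝ} (α β : ℝ) (hf0 : ∀ z, 0 < f z)
    (hs : DifferentiableOn ℝ s (Ioi 0)) (hf : Integrable f phaseMeasure)
    (hf2 : Integrable (fun z => z.2 ^ 2 / 2 * f z) phaseMeasure) (hh : Integrable h phaseMeasure)
    (hh2 : Integrable (fun z => z.2 ^ 2 / 2 * h z) phaseMeasure) :
    variation 1 s α β f h = (∫ z, deriv s (f z) * h z ∂phaseMeasure) -
      β * ((∫ z, z.2 ^ 2 / 2 * h z ∂phaseMeasure) - orderX f * orderX h - orderY f * orderY h) -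
      α * mass h := by
  simp only [variation, casimirVariation, totalEnergy_add hf hf2 hh hh2, mass_add hf hh,
    iteratedDeriv_one_quadratic,
    iteratedDeriv_one_comp_affine (hs.differentiableAt (Ioi_mem_nhds (hf0 _)))]

lemma variation_two {s : ℝ → ℝ} {f h : ℝ × ℝ → ℝ} (α β : ℝ) (hf0 : ∀ z, 0 < f z)
    (hs : DifferentiableOn ℝ s (Ioi 0)) (hs' : DifferentiableOn ℝ (deriv s) (Ioi 0))
    (hf : Integrable f phaseMeasure)
    (hf2 : Integrable (fun z => z.2 ^ 2 / 2 * f z) phaseMeasure) (hh : Integrable h phaseMeasure)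
    (hh2 : Integrable (fun z => z.2 ^ 2 / 2 * h z) phaseMeasure) :
    variation 2 s α β f h = (∫ z, deriv (deriv s) (f z) * h z ^ 2 ∂phaseMeasure) +
      β * (orderX h ^ 2 + orderY h ^ 2) := by
  simp only [variation, casimirVariation, totalEnergy_add hf hf2 hh hh2, mass_add hf hh,
    iteratedDeriv_two_quadratic, iteratedDeriv_two_comp_affine (hf0 _) hs hs']
  ring

/-! ### Critical points are functions of the energy -/

/-- The density `f` is the function `F` of the energy `p² / 2 - M cos q`. -/
structure IsEnergyProfile (M : ℝ) (f : ℝ × ℝ → ℝ) (F : ℝ → ℝ) : Prop where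
  order_pos : 0 < M
  eq_comp : ∀ z : ℝ × ℝ, z.1 ∈ Ioo (-Real.pi) Real.pi → f z = F (particleEnergy M z)
  continuous : Continuous F
  differentiableAt : ∀ e, -M < e → DifferentiableAt ℝ F e
  deriv_neg : ∀ e, -M < e → deriv F e < 0
  antitone : Antitone F
  pos : ∀ e, 0 < F e
  integrable : Integrable f phaseMeasure

lemma integrable_of_compactSupport {g : ℝ × ℝ → ℝ} (hg : Continuous g)
    {R : ℝ} (hR : ∀ q p, R ≤ |p| → g (q, p) = 0) : Integrable g phaseMeasure := by
  have h1 : IntegrableOn g (Icc (-Real.pi) Real.pi ×ˢ Icc (-R) R) :=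
    hg.continuousOn.integrableOn_compact (isCompact_Icc.prod isCompact_Icc)
  refine h1.of_forall_sdiff_eq_zero (measurableSet_Ico.prod MeasurableSet.univ) ?_
  rintro ⟨q, p⟩ ⟨⟨hq, -⟩, hn⟩
  apply hR
  by_contra hlt
  rw [not_le, abs_lt] at hlt
  exact hn ⟨⟨hq.1, hq.2.le⟩, hlt.1.le, hlt.2.le⟩

lemma neg_le_particleEnergy {M : ℝ} (hM : 0 < M) (z : ℝ × ℝ) : -M ≤ particleEnergy M z := by
  unfold particleEnergy
  nlinarith [Real.cos_le_one z.1, sq_nonneg z.2]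

section CriticalPoint

variable {s : ℝ → ℝ} {α β U : ℝ} {f : ℝ × ℝ → ℝ}

/-- The Euler-Lagrange equation. -/
lemma IsCriticalPoint.deriv_entropy_eq (hf : IsCriticalPoint s α β U f)
    (hs : DifferentiableOn ℝ s (Ioi 0)) (hs' : DifferentiableOn ℝ (deriv s) (Ioi 0))
    (hMy : orderY f = 0) {z : ℝ × ℝ} (hz : z.1 ∈ Ioo (-Real.pi) Real.pi) :
    deriv s (f z) = β * particleEnergy (orderX f) z + α := by
  set r : ℝ × ℝ → ℝ := fun z => deriv s (f z) - (β * particleEnergy (orderX f) z + α) with hr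
  have hsf : Continuous fun z => deriv s (f z) :=
    hs'.continuousOn.comp_continuous hf.continuous hf.pos
  have hE : Continuous (particleEnergy (orderX f)) := by unfold particleEnergy; fun_prop
  have hrc : Continuous r := by fun_prop
  have key : ∀ R : ℝ, ∀ z : ℝ × ℝ, z.1 ∈ Ioo (-Real.pi) Real.pi →
      r z ^ 2 * max 0 (R - |z.2|) = 0 := by
    intro R
    -- The test direction is the residual `r` of the expected equation times a tent function in `p`.
    -- The vanishing first variation then says that the integral of `r²` times the tent is zero.
    set h : ℝ × ℝ → ℝ := fun z => r z * max 0 (R - |z.2|) with hh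
    have hhc : Continuous h := by fun_prop
    have hsupp : ∀ q p, R ≤ |p| → h (q, p) = 0 := fun q p hp => by
      simp only [hh]
      rw [max_eq_left (by linarith), mul_zero]
    have hint : ∀ g : ℝ × ℝ → ℝ, Continuous g → Integrable (fun z => g z * h z) phaseMeasure :=
      fun g hg => integrable_of_compactSupport (R := R) (hg.mul hhc) fun q p hp => by
        rw [hsupp q p hp, mul_zero]
    have hv := hf.variation_eq h hhc (fun q p => by
      simp only [hh, hr, hf.periodic, particleEnergy, Real.cos_add_two_pi]) ⟨R, hsupp⟩
    have hhi : Integrable h phaseMeasure := integrable_of_compactSupport hhc hsupp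
    have hk := hint (fun z => z.2 ^ 2 / 2) (by fun_prop)
    have hcos := hint (fun z => Real.cos z.1) (by fun_prop)
    rw [variation_one α β hf.pos hs hf.integrable hf.integrable_kinetic hhi hk, hMy, zero_mul,
      sub_zero, orderX.eq_def h, mass] at hv
    have hzero : ∫ z, r z ^ 2 * max 0 (R - |z.2|) ∂phaseMeasure = 0 := by
      have e : (fun z : ℝ × ℝ => r z ^ 2 * max 0 (R - |z.2|)) = fun z => deriv s (f z) * h z -
          β * (z.2 ^ 2 / 2 * h z - orderX f * (Real.cos z.1 * h z)) - α * h z := by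
        funext z
        simp only [hh, hr, particleEnergy]
        ring
      have i1 : Integrable (fun z => deriv s (f z) * h z) phaseMeasure := hint _ hsf
      have i2 : Integrable (fun z => orderX f * (Real.cos z.1 * h z)) phaseMeasure :=
        hcos.const_mul _
      have i3 : Integrable (fun z => β * (z.2 ^ 2 / 2 * h z - orderX f * (Real.cos z.1 * h z)))
          phaseMeasure := (hk.sub i2).const_mul β
      have i4 : Integrable (fun z => deriv s (f z) * h z -
          β * (z.2 ^ 2 / 2 * h z - orderX f * (Real.cos z.1 * h z))) phaseMeasure := i1.sub i3
      rw [e, integral_sub i4 (hhi.const_mul α), integral_sub i1 i3, integral_const_mul,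
        integral_sub hk i2, integral_const_mul, integral_const_mul]
      exact hv
    have hnn : 0 ≤ fun z : ℝ × ℝ => r z ^ 2 * max 0 (R - |z.2|) := fun z =>
      mul_nonneg (sq_nonneg _) (le_max_left _ _)
    have hcont : Continuous fun z : ℝ × ℝ => r z ^ 2 * max 0 (R - |z.2|) := by fun_prop
    have hi2 : Integrable (fun z : ℝ × ℝ => r z ^ 2 * max 0 (R - |z.2|)) phaseMeasure :=
      (hint r hrc).congr (ae_of_all _ fun z => by simp only [hh]; ring)
    have hae := (integral_eq_zero_iff_of_nonneg hnn hi2).1 hzero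
    have hae' : (fun z : ℝ × ℝ => r z ^ 2 * max 0 (R - |z.2|)) =ᵐ[volume.restrict
        (Ioo (-Real.pi) Real.pi ×ˢ univ)] 0 :=
      ae_restrict_of_ae_restrict_of_subset (prod_mono Ioo_subset_Ico_self subset_rfl) hae
    intro z hz
    exact Measure.eqOn_open_of_ae_eq hae' (isOpen_Ioo.prod isOpen_univ) hcont.continuousOn
      continuousOn_const ⟨hz, mem_univ _⟩
  -- For this radius the tent function equals one at `z`.
  have h1 := key (|z.2| + 1) z hz
  rw [add_sub_cancel_left, max_eq_right zero_le_one, mul_one, sq_eq_zero_iff] at h1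
  exact sub_eq_zero.1 h1

lemma strictAntiOn_deriv_entropy (hs : StrictConcaveOn ℝ (Ici 0) s)
    (hsd : DifferentiableOn ℝ s (Ioi 0)) : StrictAntiOn (deriv s) (Ioi 0) :=
  (hs.subset Ioi_subset_Ici_self (convex_Ioi 0)).strictAntiOn_deriv fun _ hx =>
    hsd.differentiableAt (Ioi_mem_nhds hx)

/-- If `β ≤ 0`, then `s'(f)` is largest at the energy minimum at the origin, so the decreasing `s'`
makes `f` at least `f 0 > 0` everywhere; such an `f` is not integrable on a cylinder of infinite
area. -/
lemma IsCriticalPoint.beta_pos (hf : IsCriticalPoint s α β U f)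
    (hs : StrictConcaveOn ℝ (Ici 0) s) (hsd : DifferentiableOn ℝ s (Ioi 0))
    (hs' : DifferentiableOn ℝ (deriv s) (Ioi 0)) (hMx : 0 < orderX f) (hMy : orderY f = 0) :
    0 < β := by
  by_contra hβ
  rw [not_lt] at hβ
  have hpi := Real.pi_pos
  have h0 : (0 : ℝ × ℝ).1 ∈ Ioo (-Real.pi) Real.pi := ⟨by simpa using hpi, by simpa using hpi⟩
  have hanti := strictAntiOn_deriv_entropy hs hsd
  have hle : ∀ z : ℝ × ℝ, z.1 ∈ Ioo (-Real.pi) Real.pi → f 0 ≤ f z := by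
    intro z hz
    rw [← hanti.le_iff_ge (hf.pos _) (hf.pos _), hf.deriv_entropy_eq hsd hs' hMy hz,
      hf.deriv_entropy_eq hsd hs' hMy h0]
    have h1 := neg_le_particleEnergy hMx z
    have h2 : particleEnergy (orderX f) 0 = -orderX f := by simp [particleEnergy]
    rw [h2]
    nlinarith
  have hi : IntegrableOn f (Ioo (-Real.pi) Real.pi ×ˢ univ) :=
    hf.integrable.mono_measure (Measure.restrict_mono (prod_mono Ioo_subset_Ico_self subset_rfl)
      le_rfl)
  have hc : IntegrableOn (fun _ => f 0) (Ioo (-Real.pi) Real.pi ×ˢ (univ : Set ℝ)) := by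
    refine Integrable.mono' hi aestronglyMeasurable_const
      ((ae_restrict_iff' (measurableSet_Ioo.prod MeasurableSet.univ)).2 (ae_of_all _ fun z hz => ?_))
    rw [Real.norm_eq_abs, abs_of_pos (hf.pos _)]
    exact hle z hz.1
  rw [integrableOn_const_iff] at hc
  rcases hc with hc | hc
  · exact (hf.pos 0).ne' (by simpa using hc)
  · rw [Measure.volume_eq_prod, Measure.prod_prod, Real.volume_univ, Real.volume_Ioo,
      ENNReal.mul_top (by simpa using hpi)] at hc
    exact lt_irrefl _ hc

/-- The Euler-Lagrange equation makes `s'(f)` a function of the energy and `s'` is injective.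
Differentiability of the profile is that of an inverse function, and this is where `s''(f) ≠ 0`
enters. -/
theorem IsCriticalPoint.exists_profile (hf : IsCriticalPoint s α β U f)
    (hs : StrictConcaveOn ℝ (Ici 0) s) (hsd : DifferentiableOn ℝ s (Ioi 0))
    (hs' : DifferentiableOn ℝ (deriv s) (Ioi 0)) (hs2 : ∀ z, deriv (deriv s) (f z) ≠ 0)
    (hMx : 0 < orderX f) (hMy : orderY f = 0) :
    ∃ F : ℝ → ℝ, IsEnergyProfile (orderX f) f F ∧
      ∀ z : ℝ × ℝ, z.1 ∈ Ioo (-Real.pi) Real.pi → -orderX f < particleEnergy (orderX f) z →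
        deriv (deriv s) (f z) * deriv F (particleEnergy (orderX f) z) = β := by
  have hβ := hf.beta_pos hs hsd hs' hMx hMy
  have hpi := Real.pi_pos
  have hanti := strictAntiOn_deriv_entropy hs hsd
  set M := orderX f with hM
  -- Every energy `e ≥ -M` is attained on the axis `q = 0`. Below `-M` the square root is zero, so
  -- `F` is continued by a constant; this is the source of `max (-M) e` below.
  set F : ℝ → ℝ := fun e => f (0, Real.sqrt (2 * (e + M))) with hF
  have hFc : Continuous F := hf.continuous.comp (by fun_prop)
  have hFpos : ∀ e, 0 < F e := fun e => hf.pos _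
  have h0 : (0 : ℝ) ∈ Ioo (-Real.pi) Real.pi := ⟨by linarith, hpi⟩
  have hsF : ∀ e, deriv s (F e) = β * max (-M) e + α := by
    intro e
    rw [hF, hf.deriv_entropy_eq hsd hs' hMy h0, ← hM, particleEnergy]
    rcases le_total (-M) e with h | h
    · rw [max_eq_right h, Real.sq_sqrt (by linarith), Real.cos_zero]
      ring
    · rw [max_eq_left h, Real.sqrt_eq_zero_of_nonpos (by linarith), Real.cos_zero]
      ring
  have heq : ∀ z : ℝ × ℝ, z.1 ∈ Ioo (-Real.pi) Real.pi → f z = F (particleEnergy M z) := by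
    intro z hz
    apply hanti.injOn (hf.pos z) (hFpos _)
    rw [hsF, hf.deriv_entropy_eq hsd hs' hMy hz, max_eq_right (neg_le_particleEnergy hMx z)]
  have hFanti : Antitone F := by
    intro e e' h
    rw [← hanti.le_iff_ge (hFpos e) (hFpos e'), hsF, hsF]
    have := max_le_max_left (-M) h
    nlinarith
  have hder : ∀ e, -M < e → HasDerivAt F (deriv (deriv s) (F e) / β)⁻¹ e := by
    intro e he
    -- The map `x ↦ (s'(x) - α) / β` recovers the energy from the density, so it is a local left
    -- inverse of `F`.
    have h1 : HasDerivAt (fun x => (deriv s x - α) / β) (deriv (deriv s) (F e) / β) (F e) :=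
      (((hs'.differentiableAt (Ioi_mem_nhds (hFpos e))).hasDerivAt).sub_const α).div_const β
    refine HasDerivAt.of_local_left_inverse hFc.continuousAt h1 (div_ne_zero (hs2 _) hβ.ne') ?_
    filter_upwards [Ioi_mem_nhds he] with x hx
    rw [hsF, max_eq_right (le_of_lt hx)]
    field_simp
    ring
  have hne : ∀ e, -M < e → deriv F e ≠ 0 := fun e he => by
    rw [(hder e he).deriv]
    exact inv_ne_zero (div_ne_zero (hs2 _) hβ.ne')
  refine ⟨F, ⟨hMx, heq, hFc, fun e he => (hder e he).differentiableAt,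
    fun e he => lt_of_le_of_ne hFanti.deriv_nonpos (hne e he), hFanti, hFpos, hf.integrable⟩, ?_⟩
  intro z hz he
  have h2 : deriv (deriv s) (f z) ≠ 0 := hs2 z
  rw [(hder _ he).deriv, ← heq z hz]
  field_simp

end CriticalPoint

/-! ### Integrability of derivatives of monotone functions -/

/-- Only the sign of `G'` and a Lipschitz bound at the endpoint are available. Differentiating `(G a
- G x) / √(x - a)` produces `-G' / √(x - a)` and an error which the Lipschitz bound controls by the
derivative of `C √(x - a)`. Their sum `Θ` is continuous up to the endpoint with `Θ' ≥ -G' / √(x - a)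
≥ 0`, and a nonnegative derivative of a continuous function is integrable. -/
lemma integrableOn_deriv_mul_inv_sqrt_right {G G' : ℝ → ℝ} {a b C : ℝ}
    (hc : ContinuousOn G (Icc a b)) (hd : ∀ x ∈ Ioo a b, HasDerivAt G (G' x) x)
    (hneg : ∀ x ∈ Ioo a b, G' x ≤ 0) (hC : ∀ x ∈ Icc a b, |G x - G a| ≤ C * (x - a))
    (hm : Measurable G') :
    IntegrableOn (fun x => G' x * (Real.sqrt (x - a))⁻¹) (Ioo a b) := by
  set Θ : ℝ → ℝ := fun x => (G a - G x) / Real.sqrt (x - a) + C * Real.sqrt (x - a) with hΘ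
  set Θ' : ℝ → ℝ := fun x => (-G' x * Real.sqrt (x - a) -
    (G a - G x) * (1 / (2 * Real.sqrt (x - a)))) / Real.sqrt (x - a) ^ 2 +
    C * (1 / (2 * Real.sqrt (x - a))) with hΘ'
  have hder : ∀ x ∈ Ioo a b, HasDerivAt Θ (Θ' x) x := fun x hx => by
    have hpos : 0 < x - a := sub_pos.2 hx.1
    have hs : HasDerivAt (fun x => Real.sqrt (x - a)) (1 / (2 * Real.sqrt (x - a))) x :=
      ((hasDerivAt_id' x).sub_const a).sqrt hpos.ne'
    exact (((hd x hx).const_sub (G a)).div hs (Real.sqrt_pos.2 hpos).ne').add (hs.const_mul C)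
  have hbound : ∀ x ∈ Ioo a b, -(G' x * (Real.sqrt (x - a))⁻¹) ≤ Θ' x := fun x hx => by
    have hpos : 0 < x - a := sub_pos.2 hx.1
    have hs := Real.sqrt_pos.2 hpos
    have hsq := Real.sq_sqrt hpos.le
    have h1 : G a - G x ≤ C * Real.sqrt (x - a) ^ 2 := by
      rw [hsq]
      have := (abs_le.1 (hC x ⟨hx.1.le, hx.2.le⟩)).1
      linarith
    have e : Θ' x = -(G' x * (Real.sqrt (x - a))⁻¹) +
        (C * Real.sqrt (x - a) ^ 2 - (G a - G x)) / (2 * Real.sqrt (x - a) ^ 3) := by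
      simp only [hΘ']
      field_simp
      ring
    rw [e]
    have : 0 ≤ (C * Real.sqrt (x - a) ^ 2 - (G a - G x)) / (2 * Real.sqrt (x - a) ^ 3) := by
      apply div_nonneg <;> [linarith; positivity]
    linarith
  have hnn : ∀ x ∈ Ioo a b, 0 ≤ -(G' x * (Real.sqrt (x - a))⁻¹) := fun x hx => by
    have := hneg x hx
    have h2 : 0 ≤ (Real.sqrt (x - a))⁻¹ := by positivity
    nlinarith
  have hcont : ContinuousOn Θ (Icc a b) := by
    intro x hx
    rcases eq_or_lt_of_le hx.1 with rfl | hlt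
    · have h0 : Θ a = 0 := by simp [hΘ]
      rw [ContinuousWithinAt, h0]
      have hlim : Tendsto (fun x => 2 * C * Real.sqrt (x - a)) (𝓝[Icc a b] a) (𝓝 0) := by
        have : Continuous fun x => 2 * C * Real.sqrt (x - a) := by fun_prop
        simpa using (this.tendsto a).mono_left nhdsWithin_le_nhds
      refine squeeze_zero_norm' ?_ hlim
      filter_upwards [self_mem_nhdsWithin] with x hx
      have h1 : 0 ≤ x - a := sub_nonneg.2 hx.1
      have hs := Real.sqrt_nonneg (x - a)
      have hsq := Real.sq_sqrt h1
      have h2 : |(G a - G x) / Real.sqrt (x - a)| ≤ C * Real.sqrt (x - a) := by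
        rw [abs_div, abs_of_nonneg hs]
        rcases eq_or_lt_of_le hs with h | h
        · rw [← h]; simp
        · rw [div_le_iff₀ h, abs_sub_comm, mul_assoc, ← sq, hsq]
          exact hC x hx
      have h3 : |C * Real.sqrt (x - a)| = C * Real.sqrt (x - a) :=
        abs_of_nonneg ((abs_nonneg _).trans h2)
      calc ‖Θ x‖ ≤ |(G a - G x) / Real.sqrt (x - a)| + |C * Real.sqrt (x - a)| := abs_add_le _ _
        _ ≤ 2 * C * Real.sqrt (x - a) := by linarith
    · have hpos : 0 < x - a := sub_pos.2 hlt
      refine ((continuousWithinAt_const.sub (hc x hx)).div ?_ (Real.sqrt_pos.2 hpos).ne').add ?_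
      · exact Continuous.continuousWithinAt (by fun_prop)
      · exact Continuous.continuousWithinAt (by fun_prop)
  have hint : IntegrableOn Θ' (Ioo a b) := (intervalIntegral.integrableOn_deriv_of_nonneg hcont hder
    fun x hx => (hnn x hx).trans (hbound x hx)).mono_set Ioo_subset_Ioc_self
  refine Integrable.mono' hint (Measurable.aestronglyMeasurable (by fun_prop))
    ((ae_restrict_iff' measurableSet_Ioo).2 (ae_of_all _ fun x hx => ?_))
  rw [Real.norm_eq_abs, ← abs_neg, abs_of_nonneg (hnn x hx)]
  exact hbound x hx

lemma integrableOn_deriv_mul_inv_sqrt_left {G G' : ℝ → ℝ} {a b C : ℝ}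
    (hc : ContinuousOn G (Icc a b)) (hd : ∀ x ∈ Ioo a b, HasDerivAt G (G' x) x)
    (hneg : ∀ x ∈ Ioo a b, G' x ≤ 0) (hC : ∀ x ∈ Icc a b, |G x - G b| ≤ C * (b - x))
    (hm : Measurable G') :
    IntegrableOn (fun x => G' x * (Real.sqrt (b - x))⁻¹) (Ioo a b) := by
  have hmem : ∀ x ∈ Ioo (-b) (-a), -x ∈ Ioo a b := fun x hx =>
    ⟨by linarith [hx.2], by linarith [hx.1]⟩
  have hmem' : ∀ x ∈ Icc (-b) (-a), -x ∈ Icc a b := fun x hx =>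
    ⟨by linarith [hx.2], by linarith [hx.1]⟩
  have h := integrableOn_deriv_mul_inv_sqrt_right (G := fun x => -G (-x)) (G' := fun x => G' (-x))
    (a := -b) (b := -a) (C := C) (hc.comp continuous_neg.continuousOn hmem').neg
    (fun x hx => by
      have := ((hd _ (hmem x hx)).comp x (hasDerivAt_neg x)).neg
      exact this.congr_deriv (by simp))
    (fun x hx => hneg _ (hmem x hx))
    (fun x hx => by
      have := hC _ (hmem' x hx)
      rw [neg_neg, ← abs_neg]
      calc _ = |G (-x) - G b| := by congr 1; ring
        _ ≤ _ := this.trans (le_of_eq (by ring)))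
    (hm.comp measurable_neg)
  have h2 := ((Measure.measurePreserving_neg (volume : Measure ℝ)).integrableOn_comp_preimage
    (Homeomorph.neg ℝ).measurableEmbedding (f := fun x => G' x * (Real.sqrt (b - x))⁻¹)
    (s := Ioo a b)).1
  apply h2
  have e : (Neg.neg ⁻¹' Ioo a b : Set ℝ) = Ioo (-b) (-a) := by
    ext x
    simp only [mem_preimage, mem_Ioo]
    constructor <;> rintro ⟨h1, h2⟩ <;> constructor <;> linarith
  rw [e]
  refine h.congr_fun (fun x _ => ?_) measurableSet_Ioo
  simp only [Function.comp_apply, sub_neg_eq_add]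
  rw [add_comm]

/-- Integration by parts: `-x G + ∫ G` has derivative `-x G' ≥ 0` and is bounded by the total
integral of `G`, so it converges at infinity. -/
lemma integrableOn_mul_deriv_Ioi {G G' : ℝ → ℝ} {a : ℝ} (ha : 0 ≤ a) (hG : Continuous G)
    (hd : ∀ x ∈ Ici a, HasDerivAt G (G' x) x) (hneg : ∀ x ∈ Ioi a, G' x ≤ 0) (hpos : ∀ x, 0 ≤ G x)
    (hi : IntegrableOn G (Ioi a)) : IntegrableOn (fun x => x * G' x) (Ioi a) := by
  set Θ : ℝ → ℝ := fun x => -(x * G x) + ∫ y in a..x, G y with hΘ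
  have hder : ∀ x ∈ Ici a, HasDerivAt Θ (-(x * G' x)) x := fun x hx => by
    have h1 := ((hasDerivAt_id' x).mul (hd x hx)).neg
    have h2 := (hG.integral_hasStrictDerivAt a x).hasDerivAt
    exact (h1.add h2).congr_deriv (by ring)
  have hnn : ∀ x ∈ Ioi a, 0 ≤ -(x * G' x) := fun x hx => by
    have h1 := hneg x hx
    have h2 : 0 ≤ x := ha.trans (le_of_lt hx)
    nlinarith
  have hmono : MonotoneOn Θ (Ici a) := by
    refine monotoneOn_of_deriv_nonneg (convex_Ici a)
      (fun x hx => (hder x hx).continuousAt.continuousWithinAt)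
      (fun x hx => (hder x (interior_subset hx)).differentiableAt.differentiableWithinAt)
      fun x hx => ?_
    rw [(hder x (interior_subset hx)).deriv]
    rw [interior_Ici] at hx
    exact hnn x hx
  have hbdd : ∀ x ∈ Ici a, Θ x ≤ ∫ y in Ioi a, G y := fun x hx => by
    have h1 : ∫ y in a..x, G y ≤ ∫ y in Ioi a, G y := by
      rw [intervalIntegral.integral_of_le hx]
      exact setIntegral_mono_set hi (ae_of_all _ hpos) (ae_of_all _ Ioc_subset_Ioi_self)
    have h2 : 0 ≤ x * G x := mul_nonneg (ha.trans hx) (hpos x)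
    simp only [hΘ]
    linarith
  have hlim : ∃ l, Tendsto Θ atTop (𝓝 l) := by
    -- Freezing `Θ` to the left of `a` makes it monotone on the whole line, as the convergence
    -- theorem for bounded monotone functions requires.
    have hm : Monotone fun x => Θ (max a x) := fun x y hxy =>
      hmono (mem_Ici.2 (le_max_left _ _)) (mem_Ici.2 (le_max_left _ _)) (max_le_max_left a hxy)
    have hb : BddAbove (range fun x => Θ (max a x)) :=
      ⟨_, by rintro _ ⟨x, rfl⟩; exact hbdd _ (mem_Ici.2 (le_max_left _ _))⟩
    refine ⟨_, (tendsto_atTop_ciSup hm hb).congr' ?_⟩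
    filter_upwards [eventually_ge_atTop a] with x hx
    rw [max_eq_right hx]
  obtain ⟨l, hl⟩ := hlim
  have h := (integrableOn_Ioi_deriv_of_nonneg' hder hnn hl).neg
  simpa using h

/-- Differentiability gives the bound near `a`; at distance at least `δ`, boundedness gives it with
constant `2 B / δ`. -/
lemma exists_lipschitz_at {G : ℝ → ℝ} {a B : ℝ} (hd : DifferentiableAt ℝ G a)
    (hB : ∀ x, |G x| ≤ B) : ∃ C, ∀ x, |G x - G a| ≤ C * |x - a| := by
  obtain ⟨C, hC⟩ := hd.isBigO_sub.bound
  obtain ⟨δ, hδ, hball⟩ := Metric.eventually_nhds_iff.1 hC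
  refine ⟨max C (2 * B / δ), fun x => ?_⟩
  rcases lt_or_ge |x - a| δ with h | h
  · exact (hball (by rwa [Real.dist_eq])).trans
      (mul_le_mul_of_nonneg_right (le_max_left _ _) (abs_nonneg _))
  · have h1 : |G x - G a| ≤ 2 * B := (abs_sub _ _).trans (by linarith [hB x, hB a])
    have hB0 : 0 ≤ B := (abs_nonneg _).trans (hB a)
    calc |G x - G a| ≤ 2 * B / δ * δ := by rw [div_mul_cancel₀ _ hδ.ne']; exact h1
      _ ≤ 2 * B / δ * |x - a| := mul_le_mul_of_nonneg_left h (by positivity)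
      _ ≤ _ := mul_le_mul_of_nonneg_right (le_max_right _ _) (abs_nonneg _)

/-! ### Integrability of `F'(ℰ)` over the phase space -/

section Profile

variable {M : ℝ} {f : ℝ × ℝ → ℝ} {F : ℝ → ℝ}

lemma neg_lt_modulusEnergy (hM : 0 < M) {k : ℝ} (hk : 0 < k) : -M < modulusEnergy M k := by
  have : 0 < 2 * M * k ^ 2 := by positivity
  unfold modulusEnergy
  linarith

lemma IsEnergyProfile.hasDerivAt_modulus (hF : IsEnergyProfile M f F) {k : ℝ} (hk : 0 < k) :
    HasDerivAt (fun k => F (modulusEnergy M k)) (deriv F (modulusEnergy M k) * (4 * M * k)) k := by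
  have h1 : HasDerivAt (modulusEnergy M) (4 * M * k) k := by
    have := ((hasDerivAt_pow 2 k).const_mul (2 * M)).sub_const M
    exact this.congr_deriv (by simp; ring)
  exact (hF.differentiableAt _ (neg_lt_modulusEnergy hF.order_pos hk)).hasDerivAt.comp k h1

lemma IsEnergyProfile.deriv_modulus_nonpos (hF : IsEnergyProfile M f F) {k : ℝ} (hk : 0 < k) :
    deriv F (modulusEnergy M k) * (4 * M * k) ≤ 0 := by
  have h := hF.deriv_neg _ (neg_lt_modulusEnergy hF.order_pos hk)
  have hM := hF.order_pos
  exact mul_nonpos_of_nonpos_of_nonneg h.le (by positivity)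

lemma IsEnergyProfile.continuous_modulus (hF : IsEnergyProfile M f F) :
    Continuous fun k => F (modulusEnergy M k) :=
  hF.continuous.comp (by unfold modulusEnergy; fun_prop)

lemma measurable_deriv_modulusEnergy (M : ℝ) (F : ℝ → ℝ) :
    Measurable fun k => deriv F (modulusEnergy M k) :=
  (measurable_deriv F).comp (by unfold modulusEnergy; fun_prop)

/-- The profile is differentiable across the separatrix energy `k = 1` and bounded by its value at
the energy minimum. This is the endpoint hypothesis used on both sides of the separatrix. -/
lemma IsEnergyProfile.exists_lipschitz (hF : IsEnergyProfile M f F) :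
    ∃ C, ∀ k, |F (modulusEnergy M k) - F (modulusEnergy M 1)| ≤ C * |k - 1| := by
  refine exists_lipschitz_at (G := fun k => F (modulusEnergy M k)) (B := F (-M))
    (hF.hasDerivAt_modulus one_pos).differentiableAt fun k => ?_
  rw [abs_of_pos (hF.pos _)]
  refine hF.antitone ?_
  have := hF.order_pos
  have : 0 ≤ 2 * M * k ^ 2 := by positivity
  unfold modulusEnergy
  linarith

lemma aestronglyMeasurable_actionDensity_mul (M : ℝ) (F : ℝ → ℝ) (i : Region) :
    AEStronglyMeasurable (fun k => actionDensity M i k *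
      ((1 + 4 * M * k ^ 2) * deriv F (modulusEnergy M k))) (volume.restrict (modulusRange i)) := by
  have hm := measurable_deriv_modulusEnergy M F
  exact ((continuousOn_actionDensity M i).aestronglyMeasurable (measurableSet_modulusRange i)).mul
    (Measurable.aestronglyMeasurable (by fun_prop))

/-- The factor `1 + 4 M k²` equals `1 + 2 (E + M)` and dominates `1 + p²`. The bound on `K` turns
the density into `1 / √(1 - k)`, to which the endpoint lemma applies. -/
lemma IsEnergyProfile.integrableOn_lib (hF : IsEnergyProfile M f F) :
    IntegrableOn (fun k => actionDensity M .lib k *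
      ((1 + 4 * M * k ^ 2) * deriv F (modulusEnergy M k))) (modulusRange .lib) := by
  have hM := hF.order_pos
  have hs := Real.sqrt_pos.2 hM
  obtain ⟨C, hC⟩ := hF.exists_lipschitz
  have hmm := measurable_deriv_modulusEnergy M F
  have h := integrableOn_deriv_mul_inv_sqrt_left (a := 0) (b := 1) (C := C)
    hF.continuous_modulus.continuousOn (fun k hk => hF.hasDerivAt_modulus hk.1)
    (fun k hk => hF.deriv_modulus_nonpos hk.1)
    (fun k hk => by
      have := hC k
      rwa [abs_sub_comm k, abs_of_nonneg (sub_nonneg.2 hk.2)] at this) (by fun_prop)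
  refine Integrable.mono (h.const_mul ((1 + 4 * M) / Real.sqrt M))
    (aestronglyMeasurable_actionDensity_mul M F .lib)
    ((ae_restrict_iff' measurableSet_Ioo).2 (ae_of_all _ fun k hk => ?_))
  have hk0 := hk.1
  have hK := ellipticK_le ⟨hk.1.le, hk.2⟩
  have hKp := ellipticK_pos ⟨hk.1.le, hk.2⟩
  have hr := Real.sqrt_pos.2 (sub_pos.2 hk.2)
  set D := deriv F (modulusEnergy M k)
  have e1 : ‖actionDensity M .lib k * ((1 + 4 * M * k ^ 2) * D)‖ =
      4 * Real.sqrt M * k * (1 + 4 * M * k ^ 2) * |D| * (2 * ellipticK k / Real.pi) := by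
    rw [norm_mul, norm_mul, Real.norm_eq_abs, Real.norm_eq_abs, Real.norm_eq_abs,
      abs_of_pos (actionDensity_pos hM hk), abs_of_pos (a := 1 + _) (by positivity)]
    simp only [actionDensity]
    ring
  have e2 : ‖(1 + 4 * M) / Real.sqrt M * (D * (4 * M * k) * (Real.sqrt (1 - k))⁻¹)‖ =
      4 * Real.sqrt M * k * (1 + 4 * M) * |D| * (Real.sqrt (1 - k))⁻¹ := by
    have hMs : M = Real.sqrt M * Real.sqrt M := (Real.mul_self_sqrt hM.le).symm
    rw [norm_mul, norm_mul, norm_mul, Real.norm_eq_abs, Real.norm_eq_abs, Real.norm_eq_abs,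
      Real.norm_eq_abs, abs_of_pos (a := _ / _) (by positivity), abs_of_pos (a := 4 * M * k)
      (by positivity), abs_of_pos (a := _⁻¹) (by positivity)]
    field_simp
    rw [Real.sq_sqrt hM.le]
  rw [e1, e2]
  have h3 : 2 * ellipticK k / Real.pi ≤ (Real.sqrt (1 - k))⁻¹ := by
    rw [div_le_iff₀ Real.pi_pos]
    rw [one_div] at hK
    linarith
  have h4 : 1 + 4 * M * k ^ 2 ≤ 1 + 4 * M := by
    have : k ^ 2 ≤ 1 := pow_le_one₀ hk.1.le hk.2.le
    nlinarith
  gcongr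

lemma IsEnergyProfile.norm_actionDensity_mul_le (hM : 0 < M) {k : ℝ} (hk : 1 < k) (D : ℝ) :
    ‖actionDensity M .rotPos k * ((1 + 4 * M * k ^ 2) * D)‖ ≤
      (1 + 4 * M * k ^ 2) / (2 * Real.sqrt M) * |D * (4 * M * k)| *
        (Real.sqrt (k * (k - 1)))⁻¹ := by
  have hs := Real.sqrt_pos.2 hM
  have hk0 : 0 < k := zero_lt_one.trans hk
  have hk1 : 0 < k - 1 := sub_pos.2 hk
  have hK := ellipticK_le (inv_mem_Ico hk)
  have hr : k * Real.sqrt (1 - 1 / k) = Real.sqrt (k * (k - 1)) := by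
    rw [← Real.sqrt_sq hk0.le, ← Real.sqrt_mul (sq_nonneg _), Real.sqrt_sq hk0.le]
    congr 1
    field_simp
  have hrp : 0 < Real.sqrt (1 - 1 / k) := Real.sqrt_pos.2 (sub_pos.2 (inv_mem_Ico hk).2)
  have e1 : ‖actionDensity M .rotPos k * ((1 + 4 * M * k ^ 2) * D)‖ =
      4 * Real.sqrt M * (1 + 4 * M * k ^ 2) * |D| * (ellipticK (1 / k) / Real.pi) := by
    rw [norm_mul, norm_mul, Real.norm_eq_abs, Real.norm_eq_abs, Real.norm_eq_abs,
      abs_of_pos (actionDensity_pos (i := .rotPos) hM hk), abs_of_pos (a := 1 + _) (by positivity)]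
    simp only [actionDensity]
    ring
  have e2 : (1 + 4 * M * k ^ 2) / (2 * Real.sqrt M) * |D * (4 * M * k)| *
        (Real.sqrt (k * (k - 1)))⁻¹ =
      4 * Real.sqrt M * (1 + 4 * M * k ^ 2) * |D| * (1 / 2 * (1 / Real.sqrt (1 - 1 / k))) := by
    rw [← hr, abs_mul, abs_of_pos (a := 4 * M * k) (by positivity)]
    field_simp
    rw [Real.sq_sqrt hM.le]
  have h3 : ellipticK (1 / k) / Real.pi ≤ 1 / 2 * (1 / Real.sqrt (1 - 1 / k)) := by
    rw [div_le_iff₀ Real.pi_pos]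
    linarith
  rw [e1, e2]
  gcongr

/-- Normalizability of the density, read in the modulus: since `K ≥ π / 2`, the weight `dJ/dk` is
bounded below by a positive constant. -/
lemma IsEnergyProfile.integrableOn_profile (hF : IsEnergyProfile M f F) :
    IntegrableOn (fun k => F (modulusEnergy M k)) (Ioi 2) := by
  have hM := hF.order_pos
  have hs := Real.sqrt_pos.2 hM
  have hpi := Real.pi_pos
  have h1 : ∫⁻ z in regionSet M .rotPos, ENNReal.ofReal (F (particleEnergy M z)) < ⊤ := by
    have h2 : IntegrableOn f (regionSet M .rotPos) :=
      hF.integrable.mono_measure (restrict_regionSet_le hM _)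
    have h3 : IntegrableOn (fun z => F (particleEnergy M z)) (regionSet M .rotPos) :=
      h2.congr_fun (fun z hz => hF.eq_comp z hz.1) (measurableSet_regionSet M _)
    exact (hasFiniteIntegral_iff_ofReal (ae_of_all _ fun z => (hF.pos _).le)).1 h3.2
  rw [lintegral_comp_particleEnergy hM .rotPos
    (W := fun e => ENNReal.ofReal (F e)) hF.continuous.measurable.ennreal_ofReal] at h1
  refine ⟨hF.continuous_modulus.aestronglyMeasurable, ?_⟩
  rw [hasFiniteIntegral_iff_ofReal (ae_of_all _ fun k => (hF.pos _).le)]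
  have h2 : ENNReal.ofReal (4 * Real.pi * Real.sqrt M) *
      ∫⁻ k in Ioi 2, ENNReal.ofReal (F (modulusEnergy M k)) < ⊤ := by
    refine lt_of_le_of_lt ?_ h1
    rw [← lintegral_const_mul' _ _ ENNReal.ofReal_ne_top]
    refine (setLIntegral_mono' measurableSet_Ioi fun k hk => ?_).trans
      (lintegral_mono_set (Ioi_subset_Ioi one_le_two))
    refine mul_le_mul_left (ENNReal.ofReal_le_ofReal ?_) _
    have hk1 : (1 : ℝ) < k := one_lt_two.trans hk
    have hK := pi_div_two_le_ellipticK (inv_mem_Ico hk1)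
    have h5 : 1 / 2 ≤ ellipticK (1 / k) / Real.pi := by
      rw [le_div_iff₀ hpi]; linarith
    simp only [actionDensity]
    have h6 : 4 * Real.sqrt M * (1 / 2) ≤ 4 * Real.sqrt M * (ellipticK (1 / k) / Real.pi) :=
      mul_le_mul_of_nonneg_left h5 (by positivity)
    nlinarith
  by_contra htop
  rw [not_lt, top_le_iff] at htop
  rw [htop, ENNReal.mul_top (by simpa using (by positivity))] at h2
  exact lt_irrefl _ h2

lemma IsEnergyProfile.integrableOn_rotPos (hF : IsEnergyProfile M f F) :
    IntegrableOn (fun k => actionDensity M .rotPos k *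
      ((1 + 4 * M * k ^ 2) * deriv F (modulusEnergy M k))) (modulusRange .rotPos) := by
  have hM := hF.order_pos
  have hs := Real.sqrt_pos.2 hM
  obtain ⟨C, hC⟩ := hF.exists_lipschitz
  have hmm := measurable_deriv_modulusEnergy M F
  have hmeas := aestronglyMeasurable_actionDensity_mul M F .rotPos
  -- Near `k = 1` the difficulty is the divergent period, treated by the inverse square root lemma.
  -- Beyond `k = 2` it is the tail with the kinetic weight, treated by integration by parts.
  have hsplit : modulusRange .rotPos = Ioo 1 2 ∪ Ici 2 := (Ioo_union_Ici_eq_Ioi one_lt_two).symm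
  rw [hsplit] at hmeas ⊢
  refine IntegrableOn.union ?_ ?_
  · have h := integrableOn_deriv_mul_inv_sqrt_right (a := 1) (b := 2) (C := C)
      hF.continuous_modulus.continuousOn
      (fun k hk => hF.hasDerivAt_modulus (zero_lt_one.trans hk.1))
      (fun k hk => hF.deriv_modulus_nonpos (zero_lt_one.trans hk.1))
      (fun k hk => by
        have := hC k
        rwa [abs_of_nonneg (sub_nonneg.2 hk.1)] at this) (by fun_prop)
    refine Integrable.mono (h.const_mul ((1 + 16 * M) / (2 * Real.sqrt M)))
      (hmeas.mono_measure (Measure.restrict_mono subset_union_left le_rfl))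
      ((ae_restrict_iff' measurableSet_Ioo).2 (ae_of_all _ fun k hk => ?_))
    refine (IsEnergyProfile.norm_actionDensity_mul_le hM hk.1 _).trans ?_
    have hk1 : 0 < k - 1 := sub_pos.2 hk.1
    set A := deriv F (modulusEnergy M k) * (4 * M * k)
    rw [norm_mul, norm_mul, Real.norm_eq_abs, Real.norm_eq_abs, Real.norm_eq_abs,
      abs_of_pos (a := _ / _) (by positivity), abs_of_pos (a := _⁻¹) (by positivity), ← mul_assoc]
    have h4 : 1 + 4 * M * k ^ 2 ≤ 1 + 16 * M := by
      have : k ^ 2 ≤ 2 ^ 2 := pow_le_pow_left₀ (by linarith) hk.2.le 2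
      nlinarith
    have h5 : Real.sqrt (k - 1) ≤ Real.sqrt (k * (k - 1)) :=
      Real.sqrt_le_sqrt (by nlinarith [hk.1])
    have h6 := Real.sqrt_pos.2 hk1
    gcongr
  · rw [integrableOn_Ici_iff_integrableOn_Ioi]
    have h := integrableOn_mul_deriv_Ioi (a := 2) two_pos.le hF.continuous_modulus
      (fun k hk => hF.hasDerivAt_modulus (two_pos.trans_le hk))
      (fun k hk => hF.deriv_modulus_nonpos (two_pos.trans hk)) (fun k => (hF.pos _).le)
      hF.integrableOn_profile
    refine Integrable.mono (h.const_mul ((1 + 4 * M) / Real.sqrt M))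
      (hmeas.mono_measure (Measure.restrict_mono
        (Ioi_subset_Ici_self.trans subset_union_right) le_rfl))
      ((ae_restrict_iff' measurableSet_Ioi).2 (ae_of_all _ fun k hk => ?_))
    have hk2 : (2 : ℝ) < k := hk
    have hk0 : 0 < k := by linarith
    refine (IsEnergyProfile.norm_actionDensity_mul_le hM (one_lt_two.trans hk2) _).trans ?_
    set A := deriv F (modulusEnergy M k) * (4 * M * k)
    rw [norm_mul, norm_mul, Real.norm_eq_abs, Real.norm_eq_abs, Real.norm_eq_abs,
      abs_of_pos (a := _ / _) (by positivity), abs_of_pos (a := k) hk0]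
    -- Valid as soon as `k ≥ 4 / 3`. The resulting `2 / k` cancels one of the two powers of `k` in
    -- the kinetic weight and leaves the integrable `k |G'|`, where `G` is the profile in the
    -- modulus.
    have h5 : k / 2 ≤ Real.sqrt (k * (k - 1)) := Real.le_sqrt_of_sq_le (by nlinarith)
    have h6 : (Real.sqrt (k * (k - 1)))⁻¹ ≤ (k / 2)⁻¹ := inv_anti₀ (by positivity) h5
    have h7 : 1 + 4 * M * k ^ 2 ≤ (1 + 4 * M) * k ^ 2 := by nlinarith
    calc (1 + 4 * M * k ^ 2) / (2 * Real.sqrt M) * |A| * (Real.sqrt (k * (k - 1)))⁻¹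
        ≤ (1 + 4 * M) * k ^ 2 / (2 * Real.sqrt M) * |A| * (k / 2)⁻¹ := by gcongr
      _ = (1 + 4 * M) / Real.sqrt M * (k * |A|) := by field_simp

/-- `F'(ℰ)` has finite mass and kinetic energy. -/
theorem IsEnergyProfile.integrable_deriv (hF : IsEnergyProfile M f F) :
    Integrable (fun z : ℝ × ℝ => (1 + z.2 ^ 2) * deriv F (particleEnergy M z)) phaseMeasure := by
  have hM := hF.order_pos
  have hm : Measurable fun z : ℝ × ℝ => (1 + z.2 ^ 2) * deriv F (particleEnergy M z) :=
    (by fun_prop : Measurable fun z : ℝ × ℝ => 1 + z.2 ^ 2).mul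
      ((measurable_deriv F).comp (measurable_particleEnergy M))
  have hW : Measurable fun e => ENNReal.ofReal ((1 + 2 * (e + M)) * |deriv F e|) := by
    have := measurable_deriv F
    fun_prop
  have hreg : ∀ i, IntegrableOn (fun z : ℝ × ℝ => (1 + z.2 ^ 2) * deriv F (particleEnergy M z))
      (regionSet M i) := by
    intro i
    have hmod : IntegrableOn (fun k => actionDensity M i k *
        ((1 + 4 * M * k ^ 2) * deriv F (modulusEnergy M k))) (modulusRange i) := by
      cases i
      exacts [hF.integrableOn_rotPos, hF.integrableOn_lib, hF.integrableOn_rotPos]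
    refine ⟨hm.aestronglyMeasurable, ?_⟩
    rw [hasFiniteIntegral_iff_norm]
    -- From `p² = 2 (E + M cos q) ≤ 2 (E + M)` the integrand is dominated by a function of the
    -- energy.
    have h1 : ∫⁻ z in regionSet M i, ENNReal.ofReal ‖(1 + z.2 ^ 2) * deriv F (particleEnergy M z)‖ ≤
        ∫⁻ z in regionSet M i, ENNReal.ofReal
          ((1 + 2 * (particleEnergy M z + M)) * |deriv F (particleEnergy M z)|) := by
      refine lintegral_mono fun z => ENNReal.ofReal_le_ofReal ?_
      rw [norm_mul, Real.norm_eq_abs, Real.norm_eq_abs, abs_of_pos (by positivity)]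
      refine mul_le_mul_of_nonneg_right ?_ (abs_nonneg _)
      unfold particleEnergy
      nlinarith [Real.cos_le_one z.1]
    refine h1.trans_lt ?_
    rw [lintegral_comp_particleEnergy hM i hW]
    have h2 := ((hasFiniteIntegral_iff_norm _).1 (hmod.const_mul (2 * Real.pi)).2)
    refine lt_of_le_of_lt (le_of_eq ?_) h2
    refine setLIntegral_congr_fun (measurableSet_modulusRange i) fun k hk => ?_
    have hd := actionDensity_pos hM hk
    rw [← ENNReal.ofReal_mul (by positivity), norm_mul (2 * Real.pi),
      norm_mul (actionDensity M i k), norm_mul (1 + 4 * M * k ^ 2), Real.norm_eq_abs, Real.norm_eq_abs, Real.norm_eq_abs, Real.norm_eq_abs, abs_of_pos (a := 2 * Real.pi)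
      (by positivity), abs_of_pos hd, abs_of_pos (a := 1 + _) (by positivity)]
    congr 1
    unfold modulusEnergy
    ring
  rw [phaseMeasure_eq hM]
  exact ((hreg _).integrable.add_measure (hreg _)).add_measure (hreg _)

end Profile

/-! ### The stability index and the dispersion function -/

/-- The slope `F'(ℰ(J))` of the energy profile as a function of the action. -/
def profileSlope (M : ℝ) (F : ℝ → ℝ) (i : Region) (J : ℝ) : ℝ := deriv F (energy M i J)

section Profile

variable {M : ℝ} {f : ℝ × ℝ → ℝ} {F : ℝ → ℝ}

lemma ae_phaseMeasure_generic :
    ∀ᵐ z ∂phaseMeasure, z.1 ∈ Ioo (-Real.pi) Real.pi ∧ z.2 ≠ 0 := by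
  have h1 : ∀ᵐ z : ℝ × ℝ, z.1 ≠ -Real.pi :=
    Measure.quasiMeasurePreserving_fst.ae (Measure.ae_ne volume (-Real.pi))
  have h2 : ∀ᵐ z : ℝ × ℝ, z.2 ≠ 0 :=
    Measure.quasiMeasurePreserving_snd.ae (Measure.ae_ne volume (0 : ℝ))
  rw [phaseMeasure, ae_restrict_iff' (measurableSet_Ico.prod MeasurableSet.univ)]
  filter_upwards [h1, h2] with z hz1 hz2 hz
  exact ⟨⟨lt_of_le_of_ne hz.1.1 hz1.symm, hz.1.2⟩, hz2⟩

lemma neg_lt_particleEnergy (hM : 0 < M) {z : ℝ × ℝ} (hz : z.2 ≠ 0) :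
    -M < particleEnergy M z := by
  have : 0 < z.2 ^ 2 := by positivity
  unfold particleEnergy
  nlinarith [Real.cos_le_one z.1]

lemma IsEnergyProfile.integrable_slope (hF : IsEnergyProfile M f F) :
    Integrable (fun z => deriv F (particleEnergy M z)) phaseMeasure := by
  refine hF.integrable_deriv.mono
    ((measurable_deriv F).comp (measurable_particleEnergy M)).aestronglyMeasurable
    (ae_of_all _ fun z => ?_)
  rw [norm_mul, Real.norm_eq_abs (1 + _), abs_of_pos (by positivity)]
  nlinarith [norm_nonneg (deriv F (particleEnergy M z)), sq_nonneg z.2]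

/-- By the chain rule `∂f/∂p = p F'(E)`, so the apparent singularity `1 / p` cancels off the null
line `p = 0`. -/
lemma IsEnergyProfile.cosSqIntegrand_ae (hF : IsEnergyProfile M f F) :
    cosSqIntegrand f =ᵐ[phaseMeasure]
      fun z => Real.cos z.1 ^ 2 * deriv F (particleEnergy M z) := by
  filter_upwards [ae_phaseMeasure_generic] with z hz
  have h1 : (fun p : ℝ => f (z.1, p)) = fun p => F (particleEnergy M (z.1, p)) :=
    funext fun p => hF.eq_comp _ hz.1
  have h2 : HasDerivAt (fun p : ℝ => particleEnergy M (z.1, p)) z.2 z.2 :=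
    (((hasDerivAt_pow 2 z.2).div_const 2).sub_const (M * Real.cos z.1)).congr_deriv (by simp)
  have h3 := (hF.differentiableAt _ (neg_lt_particleEnergy hF.order_pos hz.2)).hasDerivAt
  have h4 : deriv (fun p => F (particleEnergy M (z.1, p))) z.2 =
      deriv F (particleEnergy M z) * z.2 :=
    (HasDerivAt.comp (h₂ := F) (h := fun p : ℝ => particleEnergy M (z.1, p)) z.2 h3 h2).deriv
  have hz2 := hz.2
  rw [cosSqIntegrand, h1, h4]
  field_simp

lemma IsEnergyProfile.integrable_cosSq_slope (hF : IsEnergyProfile M f F) :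
    Integrable (fun z : ℝ × ℝ => Real.cos z.1 ^ 2 * deriv F (particleEnergy M z)) phaseMeasure :=
  integrable_bdd_mul hF.integrable_slope (by fun_prop) fun z => by
    rw [abs_of_nonneg (sq_nonneg _)]
    exact Real.cos_sq_le_one _

lemma IsEnergyProfile.integrable_cosSqIntegrand (hF : IsEnergyProfile M f F) :
    Integrable (cosSqIntegrand f) phaseMeasure :=
  hF.integrable_cosSq_slope.congr hF.cosSqIntegrand_ae.symm

lemma angleIntegral_slope (hM : 0 < M) {i : Region} {J : ℝ} (hJ : J ∈ actionRange M i)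
    (g : ℝ × ℝ → ℝ) :
    ∫ θ in (-Real.pi)..Real.pi,
      inAngleAction M (fun z => g z * deriv F (particleEnergy M z)) i θ J =
      (∫ θ in (-Real.pi)..Real.pi, inAngleAction M g i θ J) * profileSlope M F i J := by
  rw [← intervalIntegral.integral_mul_const]
  congr 1
  funext θ
  have := particleEnergy_angleMap hM (x := (θ, J)) hJ
  rw [angleMap] at this
  simp only [inAngleAction, this, profileSlope]

lemma IsEnergyProfile.integrableOn_profileSlope (hF : IsEnergyProfile M f F) (i : Region) :
    IntegrableOn (profileSlope M F i) (actionRange M i) := by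
  have hM := hF.order_pos
  have h : Integrable (fun z => (1 : ℝ) * deriv F (particleEnergy M z)) phaseMeasure := by
    simpa using hF.integrable_slope
  have h2 := (integrableOn_angleIntegral hM i h).const_mul (2 * Real.pi)⁻¹
  refine Integrable.congr h2 ((ae_restrict_iff' (measurableSet_actionRange M i)).2
    (ae_of_all _ fun J hJ => ?_))
  dsimp only
  rw [angleIntegral_slope hM hJ fun _ => (1 : ℝ)]
  simp only [inAngleAction, intervalIntegral.integral_const, smul_eq_mul, mul_one, sub_neg_eq_add,
    ← two_mul]
  have := Real.pi_pos
  field_simp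

lemma actionIntegral_congr {E : Type*} [NormedAddCommGroup E] [NormedSpace ℝ E]
    {g h : Region → ℝ → E} (H : ∀ i, ∀ J ∈ actionRange M i, g i J = h i J) :
    actionIntegral M g = actionIntegral M h := by
  have : ∀ i, ∫ J in actionRange M i, g i J = ∫ J in actionRange M i, h i J := fun i =>
    setIntegral_congr_fun (measurableSet_actionRange M i) (H i)
  simp only [actionIntegral, this]

lemma actionIntegral_const_mul (c : ℝ) (g : Region → ℝ → ℝ) :
    actionIntegral M (fun i J => c * g i J) = c * actionIntegral M g := by
  simp only [actionIntegral, integral_const_mul]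
  ring

lemma actionIntegral_sub {g h : Region → ℝ → ℝ} (hg : ∀ i, IntegrableOn (g i) (actionRange M i))
    (hh : ∀ i, IntegrableOn (h i) (actionRange M i)) :
    actionIntegral M (fun i J => g i J - h i J) = actionIntegral M g - actionIntegral M h := by
  simp only [actionIntegral, integral_sub (hg _) (hh _)]
  ring

lemma norm_actionIntegral_le {E : Type*} [NormedAddCommGroup E] [NormedSpace ℝ E]
    {g : Region → ℝ → E} {h : Region → ℝ → ℝ} (hh : ∀ i, IntegrableOn (h i) (actionRange M i))
    (H : ∀ i, ∀ J ∈ actionRange M i, ‖g i J‖ ≤ h i J) :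
    ‖actionIntegral M g‖ ≤ actionIntegral M h := by
  have : ∀ i, ‖∫ J in actionRange M i, g i J‖ ≤ ∫ J in actionRange M i, h i J := fun i =>
    norm_integral_le_of_norm_le (hh i)
      ((ae_restrict_iff' (measurableSet_actionRange M i)).2 (ae_of_all _ (H i)))
  exact (norm_add₃_le).trans (add_le_add (add_le_add (this _) (this _)) (this _))

lemma actionIntegral_ofReal (g : Region → ℝ → ℝ) :
    actionIntegral M (fun i J => (g i J : ℂ)) = (actionIntegral M g : ℝ) := by
  simp only [actionIntegral, integral_complex_ofReal]
  push_cast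
  rfl

lemma norm_cosCoeff_sq_le_one (hM : 0 < M) {i : Region} {J : ℝ} (hJ : J ∈ actionRange M i)
    (m : ℤ) : ‖cosCoeff M m i J‖ ^ 2 ≤ 1 :=
  (le_hasSum (hasSum_norm_cosCoeff_sq hM hJ) m fun _ _ => sq_nonneg _).trans
    (cosSqMean_le_one hM hJ)

lemma aestronglyMeasurable_norm_cosCoeff_sq (hM : 0 < M) (m : ℤ) (i : Region) :
    AEStronglyMeasurable (fun J => ‖cosCoeff M m i J‖ ^ 2) (volume.restrict (actionRange M i)) :=
  ((continuousOn_cosCoeff hM m i).norm.pow 2).aestronglyMeasurable (measurableSet_actionRange M i)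

lemma IsEnergyProfile.integrableOn_slope_mul (hF : IsEnergyProfile M f F) (m : ℤ) (i : Region) :
    IntegrableOn (fun J => profileSlope M F i J * ‖cosCoeff M m i J‖ ^ 2) (actionRange M i) := by
  have hM := hF.order_pos
  refine (hF.integrableOn_profileSlope i).mul_bdd (c := 1) (aestronglyMeasurable_norm_cosCoeff_sq hM m i)
    ((ae_restrict_iff' (measurableSet_actionRange M i)).2 (ae_of_all _ fun J hJ => ?_))
  rw [Real.norm_eq_abs, abs_of_nonneg (sq_nonneg _)]
  exact norm_cosCoeff_sq_le_one hM hJ m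

lemma IsEnergyProfile.integrableOn_abs_slope_mul (hF : IsEnergyProfile M f F) (m : ℤ)
    (i : Region) :
    IntegrableOn (fun J => |profileSlope M F i J| * ‖cosCoeff M m i J‖ ^ 2) (actionRange M i) := by
  refine (hF.integrableOn_slope_mul m i).abs.congr (ae_of_all _ fun J => ?_)
  simp only [abs_mul, abs_of_nonneg (sq_nonneg ‖cosCoeff M m i J‖)]

/-- Summation of the Fourier modes, in each region. -/
lemma IsEnergyProfile.hasSum_integral_slope (hF : IsEnergyProfile M f F) (i : Region) :
    HasSum (fun m : ℤ => ∫ J in actionRange M i, profileSlope M F i J * ‖cosCoeff M m i J‖ ^ 2)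
      (∫ J in actionRange M i, profileSlope M F i J * cosSqMean M i J) ∧
    Summable fun m : ℤ =>
      ∫ J in actionRange M i, |profileSlope M F i J| * ‖cosCoeff M m i J‖ ^ 2 := by
  have hM := hF.order_pos
  have hsum : Summable fun m : ℤ =>
      ∫ J in actionRange M i, |profileSlope M F i J| * ‖cosCoeff M m i J‖ ^ 2 := by
    -- By Parseval the finite sums of `|C^m|²` are at most the mean of `cos² q`, hence at most one,
    -- uniformly in `J`.
    refine summable_of_sum_le (c := ∫ J in actionRange M i, |profileSlope M F i J|)
      (fun m => integral_nonneg fun J => by positivity) fun u => ?_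
    rw [← integral_finsetSum _ fun m _ => hF.integrableOn_abs_slope_mul m i]
    refine setIntegral_mono_on (integrable_finsetSum _ fun m _ => hF.integrableOn_abs_slope_mul m i)
      (hF.integrableOn_profileSlope i).abs (measurableSet_actionRange M i) fun J hJ => ?_
    rw [← Finset.mul_sum]
    exact mul_le_of_le_one_right (abs_nonneg _)
      ((sum_le_hasSum u (fun _ _ => sq_nonneg _) (hasSum_norm_cosCoeff_sq hM hJ)).trans
        (cosSqMean_le_one hM hJ))
  refine ⟨?_, hsum⟩
  have h := hasSum_integral_of_summable_integral_norm (μ := volume.restrict (actionRange M i))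
    (fun m : ℤ => hF.integrableOn_slope_mul m i) (by
      simpa only [norm_mul, Real.norm_eq_abs, abs_pow, abs_norm] using hsum)
  have e : ∫ J in actionRange M i, profileSlope M F i J * cosSqMean M i J =
      ∫ J in actionRange M i, ∑' m : ℤ, profileSlope M F i J * ‖cosCoeff M m i J‖ ^ 2 := by
    refine setIntegral_congr_fun (measurableSet_actionRange M i) fun J hJ => ?_
    exact ((hasSum_norm_cosCoeff_sq hM hJ).mul_left (profileSlope M F i J)).tsum_eq.symm
  rw [e]
  exact h

lemma IsEnergyProfile.integrableOn_slope_mul_cosSqMean (hF : IsEnergyProfile M f F)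
    (i : Region) :
    IntegrableOn (fun J => profileSlope M F i J * cosSqMean M i J) (actionRange M i) := by
  have hM := hF.order_pos
  have h := (integrableOn_angleIntegral hM i hF.integrable_cosSq_slope).const_mul (2 * Real.pi)⁻¹
  refine Integrable.congr h ((ae_restrict_iff' (measurableSet_actionRange M i)).2
    (ae_of_all _ fun J hJ => ?_))
  dsimp only
  rw [angleIntegral_slope hM hJ fun z : ℝ × ℝ => Real.cos z.1 ^ 2]
  simp only [inAngleAction, cosSqMean]
  ring

lemma IsEnergyProfile.integral_cosSq_slope (hF : IsEnergyProfile M f F) :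
    ∫ z, Real.cos z.1 ^ 2 * deriv F (particleEnergy M z) ∂phaseMeasure =
      2 * Real.pi * actionIntegral M fun i J => profileSlope M F i J * cosSqMean M i J := by
  have hM := hF.order_pos
  rw [integral_phaseMeasure hM hF.integrable_cosSq_slope, ← actionIntegral_const_mul]
  refine actionIntegral_congr fun i J hJ => ?_
  rw [angleIntegral_slope hM hJ fun z : ℝ × ℝ => Real.cos z.1 ^ 2]
  simp only [inAngleAction, cosSqMean]
  have := Real.pi_pos
  field_simp

lemma integral_phaseMeasure_eq_iterated {g : ℝ × ℝ → ℝ} (hg : Integrable g phaseMeasure) :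
    ∫ q in (-Real.pi)..Real.pi, ∫ p : ℝ, g (q, p) = ∫ z, g z ∂phaseMeasure := by
  have e : phaseMeasure = (volume.restrict (Ioo (-Real.pi) Real.pi)).prod (volume : Measure ℝ) := by
    rw [phaseMeasure, Measure.volume_eq_prod, ← Measure.prod_restrict, Measure.restrict_univ,
      Measure.restrict_congr_set (Ioo_ae_eq_Ico (μ := volume)).symm]
  rw [e] at hg ⊢
  rw [integral_prod _ hg, integral_Ioo_eq_intervalIntegral]

end Profile

/-! ### The index and the limit of the dispersion function as variances of `cos q` -/

section StabilityIndex

variable {f : ℝ × ℝ → ℝ} {F : ℝ → ℝ}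

/-- The position at angle zero is odd under `θ ↦ -θ`, hence zero, so the density read there is
`F(E(J))` and the chain rule applies. In particular `f̃'/Ω` is `F'(E(J))`. -/
lemma IsEnergyProfile.hasDerivAt_actionProfile (hF : IsEnergyProfile (orderX f) f F) {i : Region}
    {J : ℝ} (hJ : J ∈ actionRange (orderX f) i) :
    HasDerivAt (actionProfile f i)
      (profileSlope (orderX f) F i J * frequency (orderX f) i J) J := by
  have hM := hF.order_pos
  have h1 : ∀ᶠ x in 𝓝 J, actionProfile f i x = F (energy (orderX f) i x) := by
    filter_upwards [(isOpen_actionRange (orderX f) i).mem_nhds hJ] with x hx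
    have h0 := congrArg Prod.fst (angleMap_neg hM hx 0)
    rw [neg_zero] at h0
    have h2 : (angleMap (orderX f) i (0, x)).1 = 0 := by
      have h3 : (angleMap (orderX f) i (0, x)).1 = -(angleMap (orderX f) i (0, x)).1 := h0
      linarith
    rw [← particleEnergy_angleMap hM (x := (0, x)) hx, ← hF.eq_comp _ (by
      rw [h2]; exact ⟨neg_lt_zero.2 Real.pi_pos, Real.pi_pos⟩)]
    rfl
  refine HasDerivAt.congr_of_eventuallyEq ?_ h1
  exact (hF.differentiableAt _ (neg_lt_energy hM hJ)).hasDerivAt.comp J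
    (hasDerivAt_energy_frequency hM hJ)

lemma IsEnergyProfile.zeroModeIntegrand_eq (hF : IsEnergyProfile (orderX f) f F) {i : Region}
    {J : ℝ} (hJ : J ∈ actionRange (orderX f) i) :
    zeroModeIntegrand f i J =
      profileSlope (orderX f) F i J * ‖cosCoeff (orderX f) 0 i J‖ ^ 2 := by
  have hΩ := (frequency_pos hF.order_pos hJ).ne'
  rw [zeroModeIntegrand, (hF.hasDerivAt_actionProfile hJ).deriv, mul_div_cancel_right₀ _ hΩ]

lemma IsEnergyProfile.integrableOn_zeroModeIntegrand (hF : IsEnergyProfile (orderX f) f F)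
    (i : Region) : IntegrableOn (zeroModeIntegrand f i) (actionRange (orderX f) i) :=
  (hF.integrableOn_slope_mul 0 i).congr_fun (fun _ hJ => (hF.zeroModeIntegrand_eq hJ).symm)
    (measurableSet_actionRange _ i)

lemma IsEnergyProfile.stabilityIndex_eq (hF : IsEnergyProfile (orderX f) f F) :
    stabilityIndex f = 1 + 2 * Real.pi *
      ((actionIntegral (orderX f) fun i J =>
          profileSlope (orderX f) F i J * cosSqMean (orderX f) i J) -
        actionIntegral (orderX f) fun i J =>
          profileSlope (orderX f) F i J * ‖cosCoeff (orderX f) 0 i J‖ ^ 2) := by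
  have h1 : actionIntegral (orderX f) (zeroModeIntegrand f) =
      actionIntegral (orderX f) fun i J =>
        profileSlope (orderX f) F i J * ‖cosCoeff (orderX f) 0 i J‖ ^ 2 :=
    actionIntegral_congr fun i J hJ => hF.zeroModeIntegrand_eq hJ
  rw [stabilityIndex, integral_phaseMeasure_eq_iterated hF.integrable_cosSqIntegrand,
    integral_congr_ae hF.cosSqIntegrand_ae, hF.integral_cosSq_slope, h1]
  ring

lemma IsEnergyProfile.dispersionIntegrand_eq (hF : IsEnergyProfile (orderX f) f F) {i : Region}
    {J : ℝ} (hJ : J ∈ actionRange (orderX f) i) (ω : ℂ) (m : ℤ) :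
    dispersionIntegrand f ω m i J =
      ((m * frequency (orderX f) i J : ℝ) : ℂ) / (((m * frequency (orderX f) i J : ℝ) : ℂ) - ω) *
        ((profileSlope (orderX f) F i J * ‖cosCoeff (orderX f) m i J‖ ^ 2 : ℝ) : ℂ) := by
  rw [dispersionIntegrand, (hF.hasDerivAt_actionProfile hJ).deriv]
  push_cast
  ring

/-- The real part of the denominator is the numerator. The bound is independent of both arguments
and so provides one dominating function for all modes and all `ε`. -/
lemma norm_div_sub_le_one (a ε : ℝ) : ‖(a : ℂ) / ((a : ℂ) - Complex.I * ε)‖ ≤ 1 := by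
  rw [norm_div]
  refine div_le_one_of_le₀ ?_ (norm_nonneg _)
  have := Complex.abs_re_le_norm ((a : ℂ) - Complex.I * ε)
  simpa using this

lemma IsEnergyProfile.norm_dispersionIntegrand_le (hF : IsEnergyProfile (orderX f) f F)
    {i : Region} {J : ℝ} (hJ : J ∈ actionRange (orderX f) i) (ε : ℝ) (m : ℤ) :
    ‖dispersionIntegrand f (Complex.I * ε) m i J‖ ≤
      |profileSlope (orderX f) F i J| * ‖cosCoeff (orderX f) m i J‖ ^ 2 := by
  rw [hF.dispersionIntegrand_eq hJ, norm_mul, Complex.norm_real, norm_mul, Real.norm_eq_abs,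
    Real.norm_eq_abs, abs_of_nonneg (sq_nonneg ‖cosCoeff (orderX f) m i J‖)]
  exact mul_le_of_le_one_left (by positivity) (norm_div_sub_le_one _ _)

lemma aestronglyMeasurable_dispersionIntegrand (hM : 0 < orderX f) (ω : ℂ) (m : ℤ) (i : Region) :
    AEStronglyMeasurable (dispersionIntegrand f ω m i)
      (volume.restrict (actionRange (orderX f) i)) := by
  have h1 : Measurable fun J => (m : ℂ) * ((deriv (actionProfile f i) J : ℝ) : ℂ)
      / ((m : ℂ) * ((frequency (orderX f) i J : ℝ) : ℂ) - ω) := by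
    have h2 := measurable_deriv (actionProfile f i)
    have h3 : Measurable (frequency (orderX f) i) := measurable_deriv (energy (orderX f) i)
    fun_prop
  exact h1.aestronglyMeasurable.mul (Complex.continuous_ofReal.comp_aestronglyMeasurable
    (aestronglyMeasurable_norm_cosCoeff_sq hM m i))

lemma IsEnergyProfile.integrableOn_dispersionIntegrand (hF : IsEnergyProfile (orderX f) f F)
    (ε : ℝ) (m : ℤ) (i : Region) :
    IntegrableOn (dispersionIntegrand f (Complex.I * ε) m i) (actionRange (orderX f) i) :=
  Integrable.mono' (hF.integrableOn_abs_slope_mul m i)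
    (aestronglyMeasurable_dispersionIntegrand hF.order_pos _ m i)
    ((ae_restrict_iff' (measurableSet_actionRange _ i)).2
      (ae_of_all _ fun _ hJ => hF.norm_dispersionIntegrand_le hJ ε m))

lemma IsEnergyProfile.summable_bound (hF : IsEnergyProfile (orderX f) f F) :
    Summable fun m : ℤ => actionIntegral (orderX f) fun i J =>
      |profileSlope (orderX f) F i J| * ‖cosCoeff (orderX f) m i J‖ ^ 2 :=
  ((hF.hasSum_integral_slope _).2.add (hF.hasSum_integral_slope _).2).add
    (hF.hasSum_integral_slope _).2

lemma IsEnergyProfile.norm_actionIntegral_dispersion_le (hF : IsEnergyProfile (orderX f) f F)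
    (ε : ℝ) (m : ℤ) :
    ‖actionIntegral (orderX f) (dispersionIntegrand f (Complex.I * ε) m)‖ ≤
      actionIntegral (orderX f) fun i J =>
        |profileSlope (orderX f) F i J| * ‖cosCoeff (orderX f) m i J‖ ^ 2 :=
  norm_actionIntegral_le (fun i => hF.integrableOn_abs_slope_mul m i)
    fun _ _ hJ => hF.norm_dispersionIntegrand_le hJ ε m

lemma IsEnergyProfile.summable_dispersion (hF : IsEnergyProfile (orderX f) f F) (ε : ℝ) :
    Summable fun m : ℤ =>
      actionIntegral (orderX f) (dispersionIntegrand f (Complex.I * ε) m) :=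
  Summable.of_norm_bounded hF.summable_bound fun m => hF.norm_actionIntegral_dispersion_le ε m

/-- For `m ≠ 0` the quotient `mΩ / (mΩ - iε)` tends to one because `Ω > 0`, while for `m = 0` it is
zero for every `ε`. The conditional term subtracts precisely the zero mode that the limit loses. -/
lemma IsEnergyProfile.tendsto_actionIntegral_dispersion (hF : IsEnergyProfile (orderX f) f F)
    (m : ℤ) :
    Tendsto (fun ε : ℝ => actionIntegral (orderX f) (dispersionIntegrand f (Complex.I * ε) m))
      (𝓝[>] 0) (𝓝 (((actionIntegral (orderX f) fun i J =>
        profileSlope (orderX f) F i J * ‖cosCoeff (orderX f) m i J‖ ^ 2) -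
        if m = 0 then actionIntegral (orderX f) fun i J =>
          profileSlope (orderX f) F i J * ‖cosCoeff (orderX f) 0 i J‖ ^ 2 else 0 : ℝ) : ℂ)) := by
  have hM := hF.order_pos
  by_cases hm : m = 0
  · subst hm
    have h0 : ∀ ε : ℝ, actionIntegral (orderX f) (dispersionIntegrand f (Complex.I * ε) 0) = 0 :=
      fun ε => by simp [actionIntegral, dispersionIntegrand]
    simp only [h0, if_true, sub_self, Complex.ofReal_zero]
    exact tendsto_const_nhds
  · rw [if_neg hm, sub_zero, ← actionIntegral_ofReal]
    have key : ∀ i, Tendsto (fun ε : ℝ => ∫ J in actionRange (orderX f) i,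
        dispersionIntegrand f (Complex.I * ε) m i J) (𝓝[>] 0)
        (𝓝 (∫ J in actionRange (orderX f) i,
          ((profileSlope (orderX f) F i J * ‖cosCoeff (orderX f) m i J‖ ^ 2 : ℝ) : ℂ))) := by
      intro i
      refine tendsto_integral_filter_of_dominated_convergence _
        (Eventually.of_forall fun ε => aestronglyMeasurable_dispersionIntegrand hM _ m i)
        (Eventually.of_forall fun ε => (ae_restrict_iff' (measurableSet_actionRange _ i)).2
          (ae_of_all _ fun _ hJ => hF.norm_dispersionIntegrand_le hJ ε m))
        (hF.integrableOn_abs_slope_mul m i)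
        ((ae_restrict_iff' (measurableSet_actionRange _ i)).2 (ae_of_all _ fun J hJ => ?_))
      simp only [hF.dispersionIntegrand_eq hJ]
      set a : ℝ := m * frequency (orderX f) i J with ha
      have ha0 : (a : ℂ) ≠ 0 := by
        have : a ≠ 0 := mul_ne_zero (by exact_mod_cast hm) (frequency_pos hM hJ).ne'
        exact_mod_cast this
      have hcont : ContinuousAt (fun ε : ℝ => (a : ℂ) / ((a : ℂ) - Complex.I * ε)) 0 := by
        refine ContinuousAt.div continuousAt_const (Continuous.continuousAt (by fun_prop)) ?_
        simpa using ha0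
      have hlim := (hcont.tendsto.mono_left (nhdsWithin_le_nhds (s := Ioi 0))).mul_const
        ((profileSlope (orderX f) F i J * ‖cosCoeff (orderX f) m i J‖ ^ 2 : ℝ) : ℂ)
      simpa [ha0] using hlim
    exact ((key _).add (key _)).add (key _)

theorem IsEnergyProfile.tendsto_dispersionX (hF : IsEnergyProfile (orderX f) f F) :
    Tendsto (fun ε : ℝ => dispersionX f (Complex.I * ε)) (𝓝[>] 0)
      (𝓝 (stabilityIndex f : ℂ)) := by
  have h1 := tendsto_tsum_of_dominated_convergence hF.summable_bound
    hF.tendsto_actionIntegral_dispersion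
    (Eventually.of_forall fun ε m => hF.norm_actionIntegral_dispersion_le ε m)
  have hs : HasSum (fun m : ℤ => actionIntegral (orderX f) fun i J =>
      profileSlope (orderX f) F i J * ‖cosCoeff (orderX f) m i J‖ ^ 2)
      (actionIntegral (orderX f) fun i J =>
        profileSlope (orderX f) F i J * cosSqMean (orderX f) i J) :=
    ((hF.hasSum_integral_slope _).1.add (hF.hasSum_integral_slope _).1).add
      (hF.hasSum_integral_slope _).1
  have h2 := Complex.hasSum_ofReal.2 (hs.sub (hasSum_ite_eq (0 : ℤ)
    (actionIntegral (orderX f) fun i J =>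
      profileSlope (orderX f) F i J * ‖cosCoeff (orderX f) 0 i J‖ ^ 2)))
  rw [h2.tsum_eq] at h1
  have h3 := (h1.const_mul (2 * (Real.pi : ℂ))).const_add 1
  rw [hF.stabilityIndex_eq]
  push_cast at h3 ⊢
  exact h3

end StabilityIndex

/-! ### Formal stability -/

/-- A signed density whose image under `T` integrates all bounded continuous functions to zero
integrates all bounded measurable ones to zero. -/
lemma integral_comp_mul_eq_zero {X : Type*} [MeasurableSpace X] {μ : Measure X} {h T : X → ℝ}
    (hh : Integrable h μ) (hT : Measurable T)
    (H : ∀ W : ℝ → ℝ, Continuous W → (∃ C, ∀ x, |W x| ≤ C) → ∫ x, W (T x) * h x ∂μ = 0)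
    {c : ℝ → ℝ} (hc : Measurable c) {C : ℝ} (hC : ∀ x, |c x| ≤ C) :
    ∫ x, c (T x) * h x ∂μ = 0 := by
  -- As `ENNReal.ofReal` truncates at zero, `ν h` and `ν (-h)` are the images under `T` of the
  -- positive and negative parts of the signed density.
  set ν : (X → ℝ) → Measure ℝ := fun h => (μ.withDensity fun x => ENNReal.ofReal (h x)).map T
    with hν
  have hfin : ∀ h, Integrable h μ → IsFiniteMeasure (ν h) := fun h hh => by
    have : IsFiniteMeasure (μ.withDensity fun x => ENNReal.ofReal (h x)) :=
      isFiniteMeasure_withDensity_ofReal hh.2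
    exact Measure.isFiniteMeasure_map _ _
  have hint : ∀ h, Integrable h μ → ∀ W : ℝ → ℝ, Measurable W →
      ∫ y, W y ∂ν h = ∫ x, max (h x) 0 * W (T x) ∂μ := by
    intro h hh W hW
    rw [hν, integral_map hT.aemeasurable hW.aestronglyMeasurable,
      integral_withDensity_eq_integral_toReal_smul₀ hh.aemeasurable.ennreal_ofReal
        (ae_of_all _ fun _ => ENNReal.ofReal_lt_top)]
    simp only [ENNReal.toReal_ofReal', smul_eq_mul]
  have hdiff : ∀ W : ℝ → ℝ, Measurable W → (∃ C, ∀ x, |W x| ≤ C) →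
      ∫ x, W (T x) * h x ∂μ = ∫ y, W y ∂ν h - ∫ y, W y ∂ν (-h) := by
    rintro W hW ⟨C, hC⟩
    rw [hint h hh W hW, hint (-h) hh.neg W hW]
    have hWT : AEStronglyMeasurable (fun x => W (T x)) μ := (hW.comp hT).aestronglyMeasurable
    have h1 : Integrable (fun x => max (h x) 0 * W (T x)) μ :=
      hh.pos_part.mul_bdd (c := C) hWT (ae_of_all _ fun x => hC _)
    have h2 : Integrable (fun x => max ((-h) x) 0 * W (T x)) μ :=
      hh.neg.pos_part.mul_bdd (c := C) hWT (ae_of_all _ fun x => hC _)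
    rw [← integral_sub h1 h2]
    congr 1
    funext x
    rcases le_total (h x) 0 with hx | hx
    · rw [max_eq_right hx, max_eq_left (by simpa using hx), Pi.neg_apply]
      ring
    · rw [max_eq_left hx, max_eq_right (by simpa using hx)]
      ring
  -- Finite measures on the line are determined by their integrals of bounded continuous functions.
  have heq : ν h = ν (-h) := by
    have := hfin h hh
    have := hfin (-h) hh.neg
    refine ext_of_forall_integral_eq_of_IsFiniteMeasure fun W => ?_
    have hb : ∃ C, ∀ x, |W x| ≤ C := ⟨‖W‖, fun x => W.norm_coe_le_norm x⟩
    have h1 := hdiff W W.continuous.measurable hb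
    rw [H W W.continuous hb] at h1
    linarith
  rw [hdiff c hc ⟨C, hC⟩, heq, sub_self]

/-- The deviation of `cos q` from its mean along the orbit. -/
def cosFluctuation (M : ℝ) (z : ℝ × ℝ) : ℝ :=
  Real.cos z.1 - cosMeanEnergy M (particleEnergy M z)

lemma measurable_cosFluctuation {M : ℝ} (hM : 0 < M) : Measurable (cosFluctuation M) :=
  (by fun_prop : Measurable fun z : ℝ × ℝ => Real.cos z.1).sub
    ((measurable_cosMeanEnergy hM).comp (measurable_particleEnergy M))

lemma abs_cosFluctuation_le (M : ℝ) (z : ℝ × ℝ) : |cosFluctuation M z| ≤ 2 := by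
  have h1 := Real.abs_cos_le_one z.1
  have h2 := abs_cosMeanEnergy_le M (particleEnergy M z)
  exact (abs_sub _ _).trans (by linarith)

lemma cosFluctuation_angleMap {M : ℝ} (hM : 0 < M) {i : Region} {J : ℝ}
    (hJ : J ∈ actionRange M i) (θ : ℝ) :
    cosFluctuation M (angleMap M i (θ, J)) = Real.cos (position M i θ J) - cosMean M i J := by
  rw [cosFluctuation, particleEnergy_angleMap hM hJ, cosMeanEnergy_energy hM hJ]
  rfl

lemma integral_cosFluctuation {M : ℝ} (hM : 0 < M) {i : Region} {J : ℝ}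
    (hJ : J ∈ actionRange M i) :
    ∫ θ in (-Real.pi)..Real.pi, inAngleAction M (cosFluctuation M) i θ J = 0 := by
  have hc : Continuous fun θ => Real.cos (position M i θ J) :=
    Real.continuous_cos.comp (continuous_position hM hJ)
  have h : ∀ θ, inAngleAction M (cosFluctuation M) i θ J =
      Real.cos (position M i θ J) - cosMean M i J := cosFluctuation_angleMap hM hJ
  simp only [h]
  rw [intervalIntegral.integral_sub (hc.intervalIntegrable _ _) intervalIntegrable_const,
    intervalIntegral.integral_const, cosMean, smul_eq_mul, sub_neg_eq_add, ← two_mul,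
    mul_inv_cancel_left₀ (by positivity), sub_self]

lemma integral_cosFluctuation_sq {M : ℝ} (hM : 0 < M) {i : Region} {J : ℝ}
    (hJ : J ∈ actionRange M i) :
    ∫ θ in (-Real.pi)..Real.pi, inAngleAction M (fun z => cosFluctuation M z ^ 2) i θ J =
      2 * Real.pi * (cosSqMean M i J - ‖cosCoeff M 0 i J‖ ^ 2) := by
  have hc := Real.continuous_cos.comp (continuous_position hM hJ)
  have h : ∀ θ, inAngleAction M (fun z => cosFluctuation M z ^ 2) i θ J =
      Real.cos (position M i θ J) ^ 2 - 2 * cosMean M i J * Real.cos (position M i θ J) +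
        cosMean M i J ^ 2 := fun θ => by
    have := cosFluctuation_angleMap hM hJ θ
    rw [angleMap] at this
    simp only [inAngleAction, this]
    ring
  simp only [h]
  have i1 : IntervalIntegrable (fun θ => Real.cos (position M i θ J) ^ 2) volume
      (-Real.pi) Real.pi := (hc.pow 2).intervalIntegrable _ _
  have i2 : IntervalIntegrable (fun θ => 2 * cosMean M i J * Real.cos (position M i θ J)) volume
      (-Real.pi) Real.pi := (continuous_const.mul hc).intervalIntegrable _ _
  have e : ∫ θ in (-Real.pi)..Real.pi, Real.cos (position M i θ J) =
      2 * Real.pi * cosMean M i J := by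
    rw [cosMean, mul_inv_cancel_left₀ (by positivity)]
  have e2 : ∫ θ in (-Real.pi)..Real.pi, Real.cos (position M i θ J) ^ 2 =
      2 * Real.pi * cosSqMean M i J := by
    rw [cosSqMean, mul_inv_cancel_left₀ (by positivity)]
  rw [intervalIntegral.integral_add (i1.sub i2) intervalIntegrable_const,
    intervalIntegral.integral_sub i1 i2, intervalIntegral.integral_const,
    intervalIntegral.integral_const_mul, e, e2, norm_cosCoeff_zero_sq, smul_eq_mul]
  ring

section Profile

variable {M : ℝ} {f h : ℝ × ℝ → ℝ} {F : ℝ → ℝ}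

lemma IsEnergyProfile.integrable_fluctuation_sq (hF : IsEnergyProfile M f F) :
    Integrable (fun z => cosFluctuation M z ^ 2 * deriv F (particleEnergy M z)) phaseMeasure := by
  refine hF.integrable_slope.bdd_mul (c := 4)
    ((measurable_cosFluctuation hF.order_pos).pow_const 2).aestronglyMeasurable
    (ae_of_all _ fun z => ?_)
  have := abs_cosFluctuation_le M z
  rw [norm_pow, Real.norm_eq_abs]
  nlinarith [abs_nonneg (cosFluctuation M z)]

/-- On each orbit the mean of the squared fluctuation is the variance of `cos q`, that is, its mean
square minus `|C⁰|²`. These are the two integrals in the index, and `F'(E)` factors out of both. -/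
lemma IsEnergyProfile.integral_fluctuation_sq (hF : IsEnergyProfile (orderX f) f F) :
    ∫ z, cosFluctuation (orderX f) z ^ 2 * deriv F (particleEnergy (orderX f) z) ∂phaseMeasure =
      stabilityIndex f - 1 := by
  have hM := hF.order_pos
  rw [integral_phaseMeasure hM hF.integrable_fluctuation_sq, hF.stabilityIndex_eq,
    add_sub_cancel_left, ← actionIntegral_sub (fun i => hF.integrableOn_slope_mul_cosSqMean i)
    (fun i => hF.integrableOn_slope_mul 0 i), ← actionIntegral_const_mul]
  refine actionIntegral_congr fun i J hJ => ?_
  rw [angleIntegral_slope hM hJ fun z => cosFluctuation (orderX f) z ^ 2,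
    integral_cosFluctuation_sq hM hJ]
  ring

lemma integral_eq_zero_of_ae_angleIntegral (hM : 0 < M) (hh : Integrable h phaseMeasure)
    (H : ∀ i, ∀ᵐ J ∂((volume : Measure ℝ).restrict (actionRange M i)),
      ∫ θ in (-Real.pi)..Real.pi, inAngleAction M h i θ J = 0) :
    ∫ z, h z ∂phaseMeasure = 0 := by
  have : ∀ i, ∫ J in actionRange M i, ∫ θ in (-Real.pi)..Real.pi, inAngleAction M h i θ J = 0 :=
    fun i => integral_eq_zero_of_ae (H i)
  rw [integral_phaseMeasure hM hh, actionIntegral, this, this, this, add_zero, add_zero]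

lemma HasZeroAngleAverage.integral_energy_mul (hz : HasZeroAngleAverage M h) (hM : 0 < M)
    {W : ℝ → ℝ} (hW : Integrable (fun z => W (particleEnergy M z) * h z) phaseMeasure) :
    ∫ z, W (particleEnergy M z) * h z ∂phaseMeasure = 0 := by
  refine integral_eq_zero_of_ae_angleIntegral hM hW fun i => ?_
  filter_upwards [hz i, ae_restrict_mem (measurableSet_actionRange M i)] with J h0 hJ
  have e : ∀ θ, inAngleAction M (fun z => W (particleEnergy M z) * h z) i θ J =
      W (energy M i J) * inAngleAction M h i θ J := fun θ => by
    have := particleEnergy_angleMap hM (x := (θ, J)) hJ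
    rw [angleMap] at this
    simp only [inAngleAction, this]
  simp only [e]
  rw [intervalIntegral.integral_const_mul, h0, mul_zero]

/-- The integrand `sin q · h` is odd in `θ` on almost every orbit. -/
lemma IsEvenPerturbation.orderY_eq_zero (he : IsEvenPerturbation M h) (hM : 0 < M)
    (hh : Integrable h phaseMeasure) : orderY h = 0 := by
  refine integral_eq_zero_of_ae_angleIntegral hM (integrable_sin_mul hh) fun i => ?_
  have h1 := he i
  rw [restrict_Ico_prod_eq_angleMeasure, angleMeasure_eq_prod] at h1
  have h2 := Measure.ae_ae_of_ae_prod
    (Measure.measurePreserving_swap.quasiMeasurePreserving.ae h1)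
  filter_upwards [h2, ae_restrict_mem (measurableSet_actionRange M i)] with J h0 hJ
  set G : ℝ → ℝ := fun θ => inAngleAction M (fun z => Real.sin z.1 * h z) i θ J with hG
  have h3 : ∫ θ in (-Real.pi)..Real.pi, G (-θ) = ∫ θ in (-Real.pi)..Real.pi, G θ := by
    rw [intervalIntegral.integral_comp_neg, neg_neg]
  have h4 : ∫ θ in (-Real.pi)..Real.pi, G (-θ) = ∫ θ in (-Real.pi)..Real.pi, -G θ := by
    rw [← integral_Ioo_eq_intervalIntegral, ← integral_Ioo_eq_intervalIntegral]
    refine integral_congr_ae ?_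
    filter_upwards [h0] with θ hθ
    have h5 : position M i (-θ) J = -position M i θ J := congrArg Prod.fst (angleMap_neg hM hJ θ)
    simp only [Prod.fst_swap, Prod.snd_swap, inAngleAction] at hθ
    simp only [hG, inAngleAction, hθ]
    rw [h5, Real.sin_neg, neg_mul]
  rw [intervalIntegral.integral_neg] at h4
  change ∫ θ in (-Real.pi)..Real.pi, G θ = 0
  linarith

end Profile

/-! ### The second variation on even perturbations and its extremal direction -/

section Stability

variable {s : ℝ → ℝ} {α β U : ℝ} {f h : ℝ × ℝ → ℝ} {F : ℝ → ℝ}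

/-- Orthogonality to the orbit mean of `cos q` is all that the stability estimate asks of a
perturbation. It allows `cos q` to be replaced by its fluctuation, which improves the Cauchy-Schwarz
constant to `1 - I`. -/
lemma orderX_eq_integral_fluctuation {M : ℝ} (hM : 0 < M) (hh : Integrable h phaseMeasure)
    (h0 : ∫ z, cosMeanEnergy M (particleEnergy M z) * h z ∂phaseMeasure = 0) :
    orderX h = ∫ z, cosFluctuation M z * h z ∂phaseMeasure ∧
      Integrable (fun z => cosFluctuation M z * h z) phaseMeasure := by
  have hc : Integrable (fun z => cosMeanEnergy M (particleEnergy M z) * h z) phaseMeasure :=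
    hh.bdd_mul (c := 1)
      ((measurable_cosMeanEnergy hM).comp (measurable_particleEnergy M)).aestronglyMeasurable
      (ae_of_all _ fun z => abs_cosMeanEnergy_le _ _)
  have e : (fun z => cosFluctuation M z * h z) = fun z : ℝ × ℝ =>
      Real.cos z.1 * h z - cosMeanEnergy M (particleEnergy M z) * h z :=
    funext fun z => by rw [cosFluctuation, sub_mul]
  rw [e, integral_sub (integrable_cos_mul hh) hc, h0, sub_zero]
  exact ⟨rfl, (integrable_cos_mul hh).sub hc⟩

/-- The properties of a critical point used in the stability analysis. -/
structure IsStabilityData (s : ℝ → ℝ) (α β : ℝ) (f : ℝ × ℝ → ℝ) (F : ℝ → ℝ) : Prop where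
  profile : IsEnergyProfile (orderX f) f F
  beta_pos : 0 < β
  pos : ∀ z, 0 < f z
  differentiableOn : DifferentiableOn ℝ s (Ioi 0)
  differentiableOn_deriv : DifferentiableOn ℝ (deriv s) (Ioi 0)
  integrable_kinetic : Integrable (fun z => z.2 ^ 2 / 2 * f z) phaseMeasure
  eq_comp_ae : ∀ᵐ z ∂phaseMeasure, f z = F (particleEnergy (orderX f) z)
  slope_neg_ae : ∀ᵐ z ∂phaseMeasure, deriv F (particleEnergy (orderX f) z) < 0
  slope_mul_ae : ∀ᵐ z ∂phaseMeasure,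
    deriv (deriv s) (f z) * deriv F (particleEnergy (orderX f) z) = β
  euler_ae : ∀ᵐ z ∂phaseMeasure, deriv s (f z) = β * particleEnergy (orderX f) z + α

theorem IsCriticalPoint.exists_stabilityData (hf : IsCriticalPoint s α β U f)
    (hs : StrictConcaveOn ℝ (Ici 0) s) (hsd : DifferentiableOn ℝ s (Ioi 0))
    (hs' : DifferentiableOn ℝ (deriv s) (Ioi 0)) (hs2 : ∀ z, deriv (deriv s) (f z) ≠ 0)
    (hMx : 0 < orderX f) (hMy : orderY f = 0) : ∃ F, IsStabilityData s α β f F := by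
  obtain ⟨F, hF, hβ⟩ := hf.exists_profile hs hsd hs' hs2 hMx hMy
  have hgen := ae_phaseMeasure_generic
  refine ⟨F, hF, hf.beta_pos hs hsd hs' hMx hMy, hf.pos, hsd, hs', hf.integrable_kinetic,
    hgen.mono fun z hz => hF.eq_comp z hz.1,
    hgen.mono fun z hz => hF.deriv_neg _ (neg_lt_particleEnergy hMx hz.2),
    hgen.mono fun z hz => hβ z hz.1 (neg_lt_particleEnergy hMx hz.2),
    hgen.mono fun z hz => hf.deriv_entropy_eq hsd hs' hMy hz.1⟩

lemma IsStabilityData.variation_eq (hS : IsStabilityData s α β f F)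
    (hp : IsPerturbation s f h)
    (he : IsEvenPerturbation (orderX f) h) :
    variation 2 s α β f h =
      (∫ z, deriv (deriv s) (f z) * h z ^ 2 ∂phaseMeasure) + β * orderX h ^ 2 := by
  rw [variation_two α β hS.pos hS.differentiableOn hS.differentiableOn_deriv hS.profile.integrable
    hS.integrable_kinetic hp.integrable hp.integrable_kinetic,
    he.orderY_eq_zero hS.profile.order_pos hp.integrable]
  ring

lemma IsStabilityData.integrable_second (hS : IsStabilityData s α β f F)
    (hp : IsPerturbation s f h) :
    Integrable (fun z => deriv (deriv s) (f z) * h z ^ 2) phaseMeasure := by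
  have := hp.integrable_second
  simpa only [iteratedDeriv_two_comp_affine (hS.pos _) hS.differentiableOn
    hS.differentiableOn_deriv] using this

lemma IsStabilityData.integral_second_neg (hS : IsStabilityData s α β f F)
    (hp : IsPerturbation s f h)
    (hne : ¬ h =ᵐ[phaseMeasure] 0) :
    ∫ z, deriv (deriv s) (f z) * h z ^ 2 ∂phaseMeasure < 0 := by
  have hneg : ∀ᵐ z ∂phaseMeasure, deriv (deriv s) (f z) < 0 := by
    filter_upwards [hS.slope_neg_ae, hS.slope_mul_ae] with z h1 h2
    have := hS.beta_pos
    by_contra hle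
    nlinarith
  have hnn : 0 ≤ᵐ[phaseMeasure] fun z => -(deriv (deriv s) (f z) * h z ^ 2) := by
    filter_upwards [hneg] with z hz
    have := mul_nonneg (neg_nonneg.2 hz.le) (sq_nonneg (h z))
    simp only [Pi.zero_apply]
    linarith
  have h1 := integral_nonneg_of_ae hnn
  rw [integral_neg] at h1
  refine lt_of_le_of_ne (by linarith) fun h0 => hne ?_
  have h2 := (integral_eq_zero_iff_of_nonneg_ae hnn (hS.integrable_second hp).neg).1
    (by rw [integral_neg, h0, neg_zero])
  filter_upwards [hneg, h2] with z hz h3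
  simpa [hz.ne] using h3

/-- The Cauchy-Schwarz inequality for the order parameter of a perturbation. -/
lemma IsStabilityData.orderX_sq_le (hS : IsStabilityData s α β f F)
    (hp : IsPerturbation s f h)
    (h0 : ∫ z, cosMeanEnergy (orderX f) (particleEnergy (orderX f) z) * h z ∂phaseMeasure = 0) :
    β * orderX h ^ 2 ≤ (1 - stabilityIndex f) *
      -∫ z, deriv (deriv s) (f z) * h z ^ 2 ∂phaseMeasure := by
  have hβ := hS.beta_pos
  obtain ⟨hX, hXi⟩ := orderX_eq_integral_fluctuation hS.profile.order_pos hp.integrable h0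
  set M := orderX f
  have i1 := hS.profile.integrable_fluctuation_sq
  have i2 := hS.integrable_second hp
  set A := ∫ z, deriv (deriv s) (f z) * h z ^ 2 ∂phaseMeasure
  -- With `D = F'(E) < 0` and `s''(f) = β / D`, this quadratic in `t` is the integral of `-D (c + t
  -- h / D)²`, where `c` is the fluctuation of `cos q`. Nonpositivity of its discriminant is the
  -- inequality sought.
  have key : ∀ t : ℝ, 0 ≤ -A / β * (t * t) + -(2 * orderX h) * t + (1 - stabilityIndex f) := by
    intro t
    have j1 : Integrable (fun z => t ^ 2 / β * (deriv (deriv s) (f z) * h z ^ 2)) phaseMeasure :=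
      i2.const_mul _
    have j2 : Integrable (fun z => 2 * t * (cosFluctuation M z * h z)) phaseMeasure :=
      hXi.const_mul _
    have j3 : Integrable (fun z => cosFluctuation M z ^ 2 * deriv F (particleEnergy M z) +
        2 * t * (cosFluctuation M z * h z)) phaseMeasure := i1.add j2
    have hle : ∫ z, (cosFluctuation M z ^ 2 * deriv F (particleEnergy M z) +
        2 * t * (cosFluctuation M z * h z)) + t ^ 2 / β * (deriv (deriv s) (f z) * h z ^ 2)
        ∂phaseMeasure ≤ 0 := by
      refine integral_nonpos_of_ae ?_
      filter_upwards [hS.slope_neg_ae, hS.slope_mul_ae] with z h1 h2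
      set D := deriv F (particleEnergy M z)
      have e : (cosFluctuation M z ^ 2 * D + 2 * t * (cosFluctuation M z * h z)) +
          t ^ 2 / β * (deriv (deriv s) (f z) * h z ^ 2) =
          D * (cosFluctuation M z + t * h z / D) ^ 2 := by
        have hD : D ≠ 0 := h1.ne
        have h3 : deriv (deriv s) (f z) = β / D := by rw [eq_div_iff hD, h2]
        rw [h3]
        field_simp
        ring
      rw [e]
      exact mul_nonpos_of_nonpos_of_nonneg h1.le (sq_nonneg _)
    rw [integral_add j3 j1, integral_add i1 j2, integral_const_mul, integral_const_mul,
      hS.profile.integral_fluctuation_sq, ← hX] at hle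
    have e : -A / β * (t * t) = -(t ^ 2 / β * A) := by ring
    rw [e]
    linarith
  have hd := discrim_le_zero key
  rw [discrim] at hd
  have e : -A / β * β = -A := div_mul_cancel₀ _ hβ.ne'
  have h2 : orderX h ^ 2 ≤ -A / β * (1 - stabilityIndex f) := by nlinarith
  calc β * orderX h ^ 2 ≤ β * (-A / β * (1 - stabilityIndex f)) :=
        mul_le_mul_of_nonneg_left h2 hβ.le
    _ = (1 - stabilityIndex f) * -A := by linear_combination (1 - stabilityIndex f) * e

/-- If `A < 0` denotes the entropy term, the Cauchy-Schwarz bound gives a second variation of at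
most `A - (1 - I) A = I A`. -/
theorem IsStabilityData.variation_neg (hS : IsStabilityData s α β f F)
    (hI : 0 < stabilityIndex f) (hp : IsPerturbation s f h)
    (he : IsEvenPerturbation (orderX f) h) (hne : ¬ h =ᵐ[phaseMeasure] 0)
    (h0 : ∫ z, cosMeanEnergy (orderX f) (particleEnergy (orderX f) z) * h z ∂phaseMeasure = 0) :
    variation 2 s α β f h < 0 := by
  have h1 := hS.orderX_sq_le hp h0
  have h2 := hS.integral_second_neg hp hne
  rw [hS.variation_eq hp he]
  nlinarith

/-- The perturbation along which the second variation is largest. -/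
theorem IsStabilityData.exists_variation_nonneg (hS : IsStabilityData s α β f F)
    (hI : stabilityIndex f ≤ 0) :
    ∃ h, IsPerturbation s f h ∧ IsEvenPerturbation (orderX f) h ∧
      HasZeroAngleAverage (orderX f) h ∧ ¬ h =ᵐ[phaseMeasure] 0 ∧ 0 ≤ variation 2 s α β f h := by
  have hβ := hS.beta_pos
  have hM := hS.profile.order_pos
  have hslope := hS.profile.integral_fluctuation_sq
  have hsqi := hS.profile.integrable_fluctuation_sq
  have hDi := hS.profile.integrable_deriv
  set M := orderX f
  have hcm := measurable_cosFluctuation hM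
  have hcb := abs_cosFluctuation_le M
  -- The equality case of the Cauchy-Schwarz inequality. It is admissible because `F'(E)` has finite
  -- mass and kinetic energy and the fluctuation is bounded by two.
  set h : ℝ × ℝ → ℝ := fun z => cosFluctuation M z * deriv F (particleEnergy M z) with hh
  have hint : Integrable h phaseMeasure :=
    hS.profile.integrable_slope.bdd_mul hcm.aestronglyMeasurable (ae_of_all _ hcb)
  have hint2 : Integrable (fun z => z.2 ^ 2 / 2 * h z) phaseMeasure := by
    refine (hDi.const_mul 2).mono ((by fun_prop : Measurable fun z : ℝ × ℝ =>
      z.2 ^ 2 / 2).aestronglyMeasurable.mul hint.1) (ae_of_all _ fun z => ?_)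
    simp only [hh, norm_mul, Real.norm_eq_abs]
    rw [abs_of_nonneg (a := z.2 ^ 2 / 2) (by positivity), abs_of_nonneg (a := 1 + z.2 ^ 2)
      (by positivity), abs_two, ← mul_assoc, ← mul_assoc]
    refine mul_le_mul_of_nonneg_right ?_ (abs_nonneg _)
    nlinarith [hcb z, abs_nonneg (cosFluctuation M z), sq_nonneg z.2]
  have hsecond : (fun z => deriv (deriv s) (f z) * h z ^ 2) =ᵐ[phaseMeasure]
      fun z => β * (cosFluctuation M z ^ 2 * deriv F (particleEnergy M z)) := by
    filter_upwards [hS.slope_mul_ae] with z hz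
    rw [← hz]
    simp only [hh]
    ring
  have hp : IsPerturbation s f h := ⟨hint, hint2, by
    simp only [iteratedDeriv_two_comp_affine (hS.pos _) hS.differentiableOn
      hS.differentiableOn_deriv]
    exact (hsqi.const_mul β).congr hsecond.symm⟩
  have hE : ∀ {i : Region} {J : ℝ}, J ∈ actionRange M i → ∀ θ,
      inAngleAction M h i θ J = (Real.cos (position M i θ J) - cosMean M i J) *
        profileSlope M F i J := fun {i J} hJ θ => by
    have h1 := particleEnergy_angleMap hM (x := (θ, J)) hJ
    have h2 := cosFluctuation_angleMap hM hJ θ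
    rw [angleMap] at h1 h2
    simp only [inAngleAction, hh, h1, h2, profileSlope]
  have he : IsEvenPerturbation M h := by
    intro i
    refine (ae_restrict_iff' (measurableSet_Ico.prod (measurableSet_actionRange M i))).2
      (ae_of_all _ fun x hx => ?_)
    have h1 : position M i (-x.1) x.2 = -position M i x.1 x.2 :=
      congrArg Prod.fst (angleMap_neg hM hx.2 x.1)
    rw [hE hx.2, hE hx.2, h1, Real.cos_neg]
  have hz : HasZeroAngleAverage M h := by
    intro i
    refine (ae_restrict_iff' (measurableSet_actionRange M i)).2 (ae_of_all _ fun J hJ => ?_)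
    rw [angleIntegral_slope hM hJ, integral_cosFluctuation hM hJ, zero_mul]
  have h0 := hz.integral_energy_mul hM (W := cosMeanEnergy M)
    (hint.bdd_mul (c := 1)
      ((measurable_cosMeanEnergy hM).comp (measurable_particleEnergy M)).aestronglyMeasurable
      (ae_of_all _ fun z => abs_cosMeanEnergy_le _ _))
  have hX : orderX h = stabilityIndex f - 1 := by
    rw [(orderX_eq_integral_fluctuation hM hint h0).1, ← hslope]
    refine integral_congr_ae (ae_of_all _ fun z => ?_)
    simp only [hh]
    ring
  refine ⟨h, hp, he, hz, fun hzero => ?_, ?_⟩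
  -- A vanishing perturbation would have `I - 1 = 0`, contrary to `I ≤ 0`.
  · have : orderX h = 0 := by
      refine integral_eq_zero_of_ae ?_
      filter_upwards [hzero] with z hz
      simp only [hz, Pi.zero_apply, mul_zero]
    rw [this] at hX
    linarith
  · rw [hS.variation_eq hp he, integral_congr_ae hsecond, integral_const_mul, hslope, hX]
    have : β * (stabilityIndex f - 1) + β * (stabilityIndex f - 1) ^ 2 =
        β * ((1 - stabilityIndex f) * -stabilityIndex f) := by ring
    rw [this]
    exact mul_nonneg hβ.le (mul_nonneg (by linarith) (by linarith))

/-- The first variation of a Casimir integrates `h` against `Q'(F(E))`, which is constant on orbits.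
-/
lemma IsStabilityData.preservesCasimirs (hS : IsStabilityData s α β f F)
    (hz : HasZeroAngleAverage (orderX f) h) :
    PreservesCasimirs f h := by
  intro Q hQ hi
  have e : ∀ z, iteratedDeriv 1 (fun ε : ℝ => Q (f z + ε * h z)) 0 = deriv Q (f z) * h z :=
    fun z => iteratedDeriv_one_comp_affine (hQ.differentiableAt (Ioi_mem_nhds (hS.pos z)))
  simp only [casimirVariation, e] at hi ⊢
  have hae : (fun z => deriv Q (f z) * h z) =ᵐ[phaseMeasure]
      fun z => deriv Q (F (particleEnergy (orderX f) z)) * h z := by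
    filter_upwards [hS.eq_comp_ae] with z hz
    rw [hz]
  rw [integral_congr_ae hae]
  exact hz.integral_energy_mul hS.profile.order_pos (W := fun e => deriv Q (F e)) (hi.congr hae)

/-- Preserving Casimirs does not force a zero angle average: a function of the energy taken with
opposite signs on the two rotation regions is also allowed. It does force orthogonality to functions
of the energy, first continuous ones and then measurable ones, and the orbit mean of `cos q` is of
this kind. -/
lemma IsStabilityData.integral_cosMeanEnergy_mul (hS : IsStabilityData s α β f F)
    (hh : Integrable h phaseMeasure)
    (hc : PreservesCasimirs f h) :
    ∫ z, cosMeanEnergy (orderX f) (particleEnergy (orderX f) z) * h z ∂phaseMeasure = 0 := by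
  have hβ := hS.beta_pos
  refine integral_comp_mul_eq_zero hh (measurable_particleEnergy _) ?_
    (measurable_cosMeanEnergy hS.profile.order_pos) (abs_cosMeanEnergy_le _)
  rintro W hW ⟨C, hC⟩
  -- By the Euler-Lagrange equation `g(f) = W(E)` almost everywhere, so the primitive of `g` is a
  -- Casimir density whose first variation tests `h` against `W(E)`.
  set g : ℝ → ℝ := fun x => W ((deriv s x - α) / β) with hg
  have hgc : ContinuousOn g (Ioi 0) :=
    hW.comp_continuousOn ((hS.differentiableOn_deriv.continuousOn.sub continuousOn_const).div_const β)
  have hder : ∀ x ∈ Ioi (0 : ℝ), HasDerivAt (fun x => ∫ y in (1 : ℝ)..x, g y) (g x) x := by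
    intro x hx
    refine intervalIntegral.integral_hasDerivAt_right
      (hgc.mono fun y hy => ?_).intervalIntegrable
      (hgc.stronglyMeasurableAtFilter isOpen_Ioi x hx) (hgc.continuousAt (Ioi_mem_nhds hx))
    exact (lt_min one_pos hx).trans_le hy.1
  have e : ∀ z, iteratedDeriv 1 (fun ε : ℝ => ∫ y in (1 : ℝ)..(f z + ε * h z), g y) 0 =
      g (f z) * h z := fun z => by
    have h1 := hder (f z) (hS.pos z)
    rw [iteratedDeriv_one_comp_affine (Q := fun x => ∫ y in (1 : ℝ)..x, g y) h1.differentiableAt,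
      h1.deriv]
  have hae : (fun z => W (particleEnergy (orderX f) z) * h z) =ᵐ[phaseMeasure]
      fun z => g (f z) * h z := by
    filter_upwards [hS.euler_ae] with z hz
    simp only [hg, hz, add_sub_cancel_right, mul_div_cancel_left₀ _ hβ.ne']
  have hWi : Integrable (fun z => W (particleEnergy (orderX f) z) * h z) phaseMeasure :=
    hh.bdd_mul (c := C) (hW.measurable.comp (measurable_particleEnergy _)).aestronglyMeasurable
      (ae_of_all _ fun z => hC _)
  have h2 := hc (fun x => ∫ y in (1 : ℝ)..x, g y)
    (fun x hx => (hder x hx).differentiableAt.differentiableWithinAt)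
    (by simp only [e]; exact hWi.congr hae)
  simp only [casimirVariation, e] at h2
  rw [integral_congr_ae hae, h2]

end Stability

end

end HMF

theorem proposition3 (s : ℝ → ℝ) (hs : StrictConcaveOn ℝ (Ici 0) s)
    (hs_diff : DifferentiableOn ℝ s (Ioi 0)) (hs_diff_two : DifferentiableOn ℝ (deriv s) (Ioi 0))
    (α β U : ℝ) (f₀ : ℝ × ℝ → ℝ) (hf₀ : HMF.IsCriticalPoint s α β U f₀)
    (hs_two : ∀ z, deriv (deriv s) (f₀ z) ≠ 0)
    (hMx : 0 < HMF.orderX f₀) (hMy : HMF.orderY f₀ = 0) :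
    -- the integrals in `I[f₀]` and the series of integrals in `D_x(iε)` converge
    (Integrable (HMF.cosSqIntegrand f₀) HMF.phaseMeasure ∧
      (∀ i : HMF.Region, IntegrableOn (HMF.zeroModeIntegrand f₀ i)
        (HMF.actionRange (HMF.orderX f₀) i)) ∧
      ∀ ε : ℝ, 0 < ε →
        (∀ (m : ℤ) (i : HMF.Region),
          IntegrableOn (HMF.dispersionIntegrand f₀ (Complex.I * ε) m i)
            (HMF.actionRange (HMF.orderX f₀) i)) ∧
        Summable (fun m : ℤ => HMF.actionIntegral (HMF.orderX f₀)
          (HMF.dispersionIntegrand f₀ (Complex.I * ε) m))) ∧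
    -- `D_x(0) = I[f₀]`
    Tendsto (fun ε : ℝ => HMF.dispersionX f₀ (Complex.I * ε)) (𝓝[>] 0)
      (𝓝 (HMF.stabilityIndex f₀ : ℂ)) ∧
    -- `I[f₀] > 0` if and only if the second variation is negative definite
    (0 < HMF.stabilityIndex f₀ ↔
      ∀ h : ℝ × ℝ → ℝ, HMF.IsPerturbation s f₀ h → HMF.IsEvenPerturbation (HMF.orderX f₀) h →
        HMF.HasZeroAngleAverage (HMF.orderX f₀) h → ¬ h =ᵐ[HMF.phaseMeasure] 0 →
        HMF.variation 2 s α β f₀ h < 0) ∧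
    -- `I[f₀] > 0` if and only if `f₀` is formally stable
    (0 < HMF.stabilityIndex f₀ ↔ HMF.IsFormallyStable s α β f₀) := by
  obtain ⟨F, hS⟩ := hf₀.exists_stabilityData hs hs_diff hs_diff_two hs_two hMx hMy
  have hF := hS.profile
  refine ⟨⟨hF.integrable_cosSqIntegrand, hF.integrableOn_zeroModeIntegrand, fun ε _ =>
    ⟨hF.integrableOn_dispersionIntegrand ε, hF.summable_dispersion ε⟩⟩,
    hF.tendsto_dispersionX, ⟨fun hI h hp he hz hne => ?_, fun H => ?_⟩,
    ⟨fun hI h hp he hc hne => ?_, fun H => ?_⟩⟩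
  -- Zero angle average enters only through the preservation of Casimirs, so both positivity claims
  -- rest on the same orthogonality.
  · exact hS.variation_neg hI hp he hne
      (hS.integral_cosMeanEnergy_mul hp.integrable (hS.preservesCasimirs hz))
  · by_contra hI
    obtain ⟨h, hp, he, hz, hne, hv⟩ := hS.exists_variation_nonneg (not_lt.1 hI)
    exact absurd (H h hp he hz hne) (not_lt.2 hv)
  · exact hS.variation_neg hI hp he hne (hS.integral_cosMeanEnergy_mul hp.integrable hc)
  · by_contra hI
    obtain ⟨h, hp, he, hz, hne, hv⟩ := hS.exists_variation_nonneg (not_lt.1 hI)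
    exact absurd (H h hp he (hS.preservesCasimirs hz) hne) (not_lt.2 hv)
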